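/- All graphs are undirected, without loops or multiple edges. An edge dominates itself and every edge sharing a vertex with it. A set $P\subseteq E(G)$ is a perfect edge dominating set (PEDS) of $G$ if every edge in $E(G)\setminus P$ is dominated by exactly one edge of $P$, and an efficient edge dominating set (EEDS) if every edge of $G$ is dominated by exactly one edge of $P$. A PEDS is proper if it is neither equal to $E(G)$ nor an EEDS. (1) If $G$ is a connected graph in which every vertex lies in a triangle, then $G$ has no proper PEDS. (2) Let $G$ be a finite connected cubic claw-free graph whose edges carry real, possibly negative, weights. Then $G$ has a PEDS of minimum weight, and every such set is either $E(G)$ or an EEDS of minimum weight. If $D$ is an EEDS of minimum weight, then whichever of $D$ and $E(G)$ has the smaller weight is a PEDS of minimum weight (each of them is, if the weights are equal). If $G$ has no EEDS, then $E(G)$ is the only PEDS of $G$. (3) There is an algorithm that, given any finite cubic claw-free graph $G$ on $n$ vertices (connected or not), as a list of its edges in arbitrary order, with arbitrary real edge weights, outputs a PEDS of $G$ of minimum weight in $O(n)$ steps. The model is a random access machine with unit-cost steps, whose integer arithmetic is limited to successor, predecessor and comparison, and whose arithmetic on reals is limited to addition, subtraction and comparison. -/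

import Mathlib

namespace EdgeDom

section Graphs

variable {V : Type*}

/-- An edge dominates itself and every edge sharing a vertex with it. -/
def Dominates (f e : Sym2 V) : Prop := f = e ∨ ∃ v, v ∈ f ∧ v ∈ e

/-- Perfect edge dominating set: a set `P` of edges of `G` such that every edge of `G` outside `P`
is dominated by exactly one edge of `P`. -/
structure IsPEDS (G : SimpleGraph V) (P : Set (Sym2 V)) : Prop where
  subset : P ⊆ G.edgeSet
  perfect : ∀ e ∈ G.edgeSet, e ∉ P → ∃! f, f ∈ P ∧ Dominates f e

/-- Efficient edge dominating set: a set `P` of edges of `G` such that every edge of `G`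
is dominated by exactly one edge of `P`. -/
structure IsEEDS (G : SimpleGraph V) (P : Set (Sym2 V)) : Prop where
  subset : P ⊆ G.edgeSet
  efficient : ∀ e ∈ G.edgeSet, ∃! f, f ∈ P ∧ Dominates f e

/-- A perfect edge dominating set is proper when it is neither trivial (that is, equal to `E(G)`)
nor efficient. -/
def IsProperPEDS (G : SimpleGraph V) (P : Set (Sym2 V)) : Prop :=
  IsPEDS G P ∧ P ≠ G.edgeSet ∧ ¬ IsEEDS G P

/-- The vertex `v` is contained in some triangle of `G`. -/
def InTriangle (G : SimpleGraph V) (v : V) : Prop :=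
  ∃ a b, G.Adj v a ∧ G.Adj v b ∧ G.Adj a b

/-- Claw-free: no induced subgraph is isomorphic to `K_{1,3}`. -/
def ClawFree (G : SimpleGraph V) : Prop :=
  ¬ (completeBipartiteGraph (Fin 1) (Fin 3)).IsIndContained G

/-- Total weight of a finite set of edges. -/
def weight (w : Sym2 V → ℝ) (P : Finset (Sym2 V)) : ℝ := ∑ e ∈ P, w e

/-- `P` is a perfect edge dominating set of minimum weight. -/
def IsMinPEDS (G : SimpleGraph V) (w : Sym2 V → ℝ) (P : Finset (Sym2 V)) : Prop :=
  IsPEDS G P ∧ ∀ Q : Finset (Sym2 V), IsPEDS G Q → weight w P ≤ weight w Q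

/-- `P` is an efficient edge dominating set of minimum weight. -/
def IsMinEEDS (G : SimpleGraph V) (w : Sym2 V → ℝ) (P : Finset (Sym2 V)) : Prop :=
  IsEEDS G P ∧ ∀ Q : Finset (Sym2 V), IsEEDS G Q → weight w P ≤ weight w Q

end Graphs

/-! A random access machine with unit-cost steps, programmed in a structured language. It has
integer variables and arrays and real variables and arrays. The only integer arithmetic is
successor and predecessor, so that after `t` steps every integer held by the machine, and every
address it has used, exceeds the largest integer in its input and its program by at most `t`. The
only real arithmetic is addition, subtraction and comparison, and the only real constant is `0`. -/

section Machine

/-- Contents of the memory. -/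
structure Mem where
  nvar : ℕ → ℕ
  narr : ℕ → ℕ → ℕ
  rvar : ℕ → ℝ
  rarr : ℕ → ℕ → ℝ

/-- Integer expressions; `get a e` reads cell `e` of the integer array `a`. -/
inductive NExp where
  | const (k : ℕ)
  | var (x : ℕ)
  | succ (e : NExp)
  | pred (e : NExp)
  | get (a : ℕ) (e : NExp)

/-- Real expressions; `get a e` reads cell `e` of the real array `a`. -/
inductive RExp where
  | zero
  | var (x : ℕ)
  | add (p q : RExp)
  | sub (p q : RExp)
  | get (a : ℕ) (e : NExp)

/-- Tests. -/
inductive Guard where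
  | eqN (e f : NExp)
  | ltN (e f : NExp)
  | ltR (p q : RExp)
  | not (b : Guard)
  | and (b c : Guard)

/-- Programs. -/
inductive Prog where
  | skip
  | nset (x : ℕ) (e : NExp)
  | nput (a : ℕ) (i e : NExp)
  | rset (x : ℕ) (p : RExp)
  | rput (a : ℕ) (i : NExp) (p : RExp)
  | seq (A B : Prog)
  | ite (b : Guard) (A B : Prog)
  | loop (b : Guard) (A : Prog)

def NExp.eval (s : Mem) : NExp → ℕ
  | .const k => k
  | .var x => s.nvar x
  | .succ e => e.eval s + 1
  | .pred e => e.eval s - 1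
  | .get a e => s.narr a (e.eval s)

/-- One step for each operation. -/
def NExp.cost : NExp → ℕ
  | .const _ => 1
  | .var _ => 1
  | .succ e => e.cost + 1
  | .pred e => e.cost + 1
  | .get _ e => e.cost + 1

noncomputable def RExp.eval (s : Mem) : RExp → ℝ
  | .zero => 0
  | .var x => s.rvar x
  | .add p q => p.eval s + q.eval s
  | .sub p q => p.eval s - q.eval s
  | .get a e => s.rarr a (e.eval s)

def RExp.cost : RExp → ℕ
  | .zero => 1
  | .var _ => 1
  | .add p q => p.cost + q.cost + 1
  | .sub p q => p.cost + q.cost + 1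
  | .get _ e => e.cost + 1

/-- `eqN` tests equality of two integers; `ltN` and `ltR` test strict inequality. -/
def Guard.Holds (s : Mem) : Guard → Prop
  | .eqN e f => e.eval s = f.eval s
  | .ltN e f => e.eval s < f.eval s
  | .ltR p q => p.eval s < q.eval s
  | .not b => ¬ b.Holds s
  | .and b c => b.Holds s ∧ c.Holds s

def Guard.cost : Guard → ℕ
  | .eqN e f => e.cost + f.cost + 1
  | .ltN e f => e.cost + f.cost + 1
  | .ltR p q => p.cost + q.cost + 1
  | .not b => b.cost + 1
  | .and b c => b.cost + c.cost + 1

def Mem.setN (s : Mem) (x v : ℕ) : Mem :=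
  { s with nvar := Function.update s.nvar x v }

def Mem.putN (s : Mem) (a i v : ℕ) : Mem :=
  { s with narr := Function.update s.narr a (Function.update (s.narr a) i v) }

def Mem.setR (s : Mem) (x : ℕ) (v : ℝ) : Mem :=
  { s with rvar := Function.update s.rvar x v }

def Mem.putR (s : Mem) (a i : ℕ) (v : ℝ) : Mem :=
  { s with rarr := Function.update s.rarr a (Function.update (s.rarr a) i v) }

/-- `Exec A s t s'`: started on memory `s`, the program `A` halts after exactly `t` steps with
memory `s'`. -/
inductive Exec : Prog → Mem → ℕ → Mem → Prop where
  | skip (s : Mem) : Exec .skip s 1 s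
  | nset (s : Mem) (x : ℕ) (e : NExp) :
      Exec (.nset x e) s (e.cost + 1) (s.setN x (e.eval s))
  | nput (s : Mem) (a : ℕ) (i e : NExp) :
      Exec (.nput a i e) s (i.cost + e.cost + 1) (s.putN a (i.eval s) (e.eval s))
  | rset (s : Mem) (x : ℕ) (p : RExp) :
      Exec (.rset x p) s (p.cost + 1) (s.setR x (p.eval s))
  | rput (s : Mem) (a : ℕ) (i : NExp) (p : RExp) :
      Exec (.rput a i p) s (i.cost + p.cost + 1) (s.putR a (i.eval s) (p.eval s))
  | seq {A B : Prog} {s s' s'' : Mem} {t t' : ℕ} :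
      Exec A s t s' → Exec B s' t' s'' → Exec (.seq A B) s (t + t') s''
  | iteTrue {b : Guard} {A B : Prog} {s s' : Mem} {t : ℕ} :
      b.Holds s → Exec A s t s' → Exec (.ite b A B) s (b.cost + t + 1) s'
  | iteFalse {b : Guard} {A B : Prog} {s s' : Mem} {t : ℕ} :
      ¬ b.Holds s → Exec B s t s' → Exec (.ite b A B) s (b.cost + t + 1) s'
  | loopDone {b : Guard} {A : Prog} {s : Mem} :
      ¬ b.Holds s → Exec (.loop b A) s (b.cost + 1) s
  | loopStep {b : Guard} {A : Prog} {s s' s'' : Mem} {t t' : ℕ} :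
      b.Holds s → Exec A s t s' → Exec (.loop b A) s' t' s'' →
      Exec (.loop b A) s (b.cost + t + t' + 1) s''

end Machine

section Encoding

variable {n : ℕ}

/-- A listing of the edges of `G`, each edge exactly once, in arbitrary order and with its two
ends in arbitrary order. -/
structure EdgeList (G : SimpleGraph (Fin n)) where
  m : ℕ
  src : Fin m → Fin n
  dst : Fin m → Fin n
  inj : Function.Injective fun j => s(src j, dst j)
  range : Set.range (fun j => s(src j, dst j)) = G.edgeSet

variable {G : SimpleGraph (Fin n)}

/-- The `j`-th edge of the list. -/
def EdgeList.edge (L : EdgeList G) (j : Fin L.m) : Sym2 (Fin n) := s(L.src j, L.dst j)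

/-- The input memory: variables `0` and `1` hold the numbers of vertices and of edges, the integer
arrays `0` and `1` hold the two ends of the edges of the list, and the real array `0` holds
their weights. Everything else is `0`. -/
noncomputable def EdgeList.input (L : EdgeList G) (w : Sym2 (Fin n) → ℝ) : Mem where
  nvar x := if x = 0 then n else if x = 1 then L.m else 0
  narr a j := if h : j < L.m then
      (if a = 0 then (L.src ⟨j, h⟩ : ℕ) else if a = 1 then (L.dst ⟨j, h⟩ : ℕ) else 0)
    else 0
  rvar _ := 0
  rarr a j := if h : j < L.m then (if a = 0 then w (L.edge ⟨j, h⟩) else 0) else 0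

/-- The output: the edges of the list that are marked by a `1` in the integer array `2`. -/
def EdgeList.output (L : EdgeList G) (s : Mem) : Finset (Sym2 (Fin n)) :=
  (Finset.univ.filter fun j : Fin L.m => s.narr 2 j = 1).image L.edge

end Encoding

end EdgeDom

/-! Call a vertex black if all its edges lie in P, and white if none of the edges of P meets it.
When every vertex lies in a triangle, blackness passes from a vertex to its neighbours
(`IsPEDS.black_of_adj`). So in a connected graph either every vertex is black and P = E(G), or none
is. In the second case every vertex has an edge outside P, which admits at most one edge of P at
that vertex, and P is an EEDS. A cubic claw-free graph has a triangle at every vertex, and this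
settles (1) and (2).

For (3), the dichotomy holds in each component. P consists of the edges without a white end, and no
two white vertices are adjacent, so the weight of P is the weight of E(G) minus the sum of the
weighted degrees of the white vertices (`EdgeList.weight_eq`). The task in each component is to find
the white set of an EEDS with the largest sum, and to use it if that sum is nonnegative; the empty
white set stands for taking all edges.

The neighbours of a vertex either span exactly one edge, giving two mates and an outer neighbour, or
span more, and then the vertex is never white. At a vertex of the first kind exactly one vertex of
its triangle is white, and exactly one end of its outer edge. Unit propagation marks what these
rules force. If a solution exists, no triangle keeps three unknown vertices: sending an unknown
white vertex to the white mate of its outer neighbour is a surjective self-map of a finite set, and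
a triangle of unknown vertices would give its white vertex two preimages
(`Solves.not_both_unknown_of_white`). Hence each unknown vertex is linked to its unknown outer
neighbour and to exactly one unknown mate, and whiteness alternates along links. Every connected
piece of unknown vertices then has two possible states, all combinations of states are solutions
(`Solves.chosen`), and the heavier state of each piece is optimal (`Solves.total_le`). A component
without a solution shows itself because the set chosen there fails the local test at some vertex.

Time is linear because the propagation loop runs at most 2n times, each depth-first search at most
3n times, and every other pass once per vertex or edge. -/

namespace EdgeDom

/-! ### Running time and memory frames of programs -/

section Semantics

open Classical in
/-- The effect of a loop-free program on the memory. -/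
noncomputable def Prog.run : Prog → Mem → Mem
  | .skip, s => s
  | .nset x e, s => s.setN x (e.eval s)
  | .nput a i e, s => s.putN a (i.eval s) (e.eval s)
  | .rset x p, s => s.setR x (p.eval s)
  | .rput a i p, s => s.putR a (i.eval s) (p.eval s)
  | .seq A B, s => B.run (A.run s)
  | .ite b A B, s => if b.Holds s then A.run s else B.run s
  | .loop _ _, s => s

/-- A program without loops. -/
def Prog.Straight : Prog → Prop
  | .seq A B => A.Straight ∧ B.Straight
  | .ite _ A B => A.Straight ∧ B.Straight
  | .loop _ _ => False
  | _ => True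

/-- A bound for the running time of a loop-free program. -/
def Prog.bound : Prog → ℕ
  | .skip => 1
  | .nset _ e => e.cost + 1
  | .nput _ i e => i.cost + e.cost + 1
  | .rset _ p => p.cost + 1
  | .rput _ i p => i.cost + p.cost + 1
  | .seq A B => A.bound + B.bound
  | .ite b A B => b.cost + (A.bound + B.bound) + 1
  | .loop _ _ => 0

theorem Prog.exec_run {A : Prog} (hA : A.Straight) (s : Mem) :
    ∃ t ≤ A.bound, Exec A s t (A.run s) := by
  induction A generalizing s with
  | skip => exact ⟨_, le_rfl, .skip s⟩
  | nset x e => exact ⟨_, le_rfl, .nset s x e⟩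
  | nput a i e => exact ⟨_, le_rfl, .nput s a i e⟩
  | rset x p => exact ⟨_, le_rfl, .rset s x p⟩
  | rput a i p => exact ⟨_, le_rfl, .rput s a i p⟩
  | seq A B ihA ihB =>
    obtain ⟨t, ht, h⟩ := ihA hA.1 s
    obtain ⟨t', ht', h'⟩ := ihB hA.2 (A.run s)
    exact ⟨t + t', add_le_add ht ht', .seq h h'⟩
  | ite b A B ihA ihB =>
    by_cases hb : b.Holds s
    · obtain ⟨t, ht, h⟩ := ihA hA.1 s
      refine ⟨b.cost + t + 1, by simp only [Prog.bound]; omega, ?_⟩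
      simpa only [Prog.run, if_pos hb] using Exec.iteTrue hb h
    · obtain ⟨t, ht, h⟩ := ihB hA.2 s
      refine ⟨b.cost + t + 1, by simp only [Prog.bound]; omega, ?_⟩
      simpa only [Prog.run, if_neg hb] using Exec.iteFalse hb h
  | loop b A => exact hA.elim

/-- The integer variables written by a program. -/
def Prog.nvars : Prog → List ℕ
  | .nset x _ => [x]
  | .seq A B => A.nvars ++ B.nvars
  | .ite _ A B => A.nvars ++ B.nvars
  | .loop _ A => A.nvars
  | _ => []

/-- The integer arrays written by a program. -/
def Prog.narrs : Prog → List ℕ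
  | .nput a _ _ => [a]
  | .seq A B => A.narrs ++ B.narrs
  | .ite _ A B => A.narrs ++ B.narrs
  | .loop _ A => A.narrs
  | _ => []

/-- The real arrays written by a program. -/
def Prog.rarrs : Prog → List ℕ
  | .rput a _ _ => [a]
  | .seq A B => A.rarrs ++ B.rarrs
  | .ite _ A B => A.rarrs ++ B.rarrs
  | .loop _ A => A.rarrs
  | _ => []

/-- The memory outside the variables and arrays that `A` writes is the same in `s` and `s'`. -/
structure Frame (A : Prog) (s s' : Mem) : Prop where
  nvar : ∀ x, x ∉ A.nvars → s'.nvar x = s.nvar x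
  narr : ∀ a, a ∉ A.narrs → s'.narr a = s.narr a
  rarr : ∀ a, a ∉ A.rarrs → s'.rarr a = s.rarr a

/-- Reasoning about a pass can then ignore all arrays it does not write. Real variables are not
tracked, so `rset` is a trivial case. -/
theorem Exec.frame {A : Prog} {s s' : Mem} {t : ℕ} (h : Exec A s t s') : Frame A s s' := by
  induction h with
  | skip s => exact ⟨fun _ _ => rfl, fun _ _ => rfl, fun _ _ => rfl⟩
  | nset s x e =>
    refine ⟨fun y hy => ?_, fun _ _ => rfl, fun _ _ => rfl⟩
    exact Function.update_of_ne (by simpa [Prog.nvars] using hy) _ _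
  | nput s a i e =>
    refine ⟨fun _ _ => rfl, fun y hy => ?_, fun _ _ => rfl⟩
    exact Function.update_of_ne (by simpa [Prog.narrs] using hy) _ _
  | rset s x p => exact ⟨fun _ _ => rfl, fun _ _ => rfl, fun _ _ => rfl⟩
  | rput s a i p =>
    refine ⟨fun _ _ => rfl, fun _ _ => rfl, fun y hy => ?_⟩
    exact Function.update_of_ne (by simpa [Prog.rarrs] using hy) _ _
  | seq _ _ h h' =>
    refine ⟨fun y hy => ?_, fun y hy => ?_, fun y hy => ?_⟩
    · simp only [Prog.nvars, List.mem_append, not_or] at hy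
      rw [h'.nvar y hy.2, h.nvar y hy.1]
    · simp only [Prog.narrs, List.mem_append, not_or] at hy
      rw [h'.narr y hy.2, h.narr y hy.1]
    · simp only [Prog.rarrs, List.mem_append, not_or] at hy
      rw [h'.rarr y hy.2, h.rarr y hy.1]
  | iteTrue _ _ h =>
    refine ⟨fun y hy => ?_, fun y hy => ?_, fun y hy => ?_⟩
    · simp only [Prog.nvars, List.mem_append, not_or] at hy
      exact h.nvar y hy.1
    · simp only [Prog.narrs, List.mem_append, not_or] at hy
      exact h.narr y hy.1
    · simp only [Prog.rarrs, List.mem_append, not_or] at hy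
      exact h.rarr y hy.1
  | iteFalse _ _ h =>
    refine ⟨fun y hy => ?_, fun y hy => ?_, fun y hy => ?_⟩
    · simp only [Prog.nvars, List.mem_append, not_or] at hy
      exact h.nvar y hy.2
    · simp only [Prog.narrs, List.mem_append, not_or] at hy
      exact h.narr y hy.2
    · simp only [Prog.rarrs, List.mem_append, not_or] at hy
      exact h.rarr y hy.2
  | loopDone _ => exact ⟨fun _ _ => rfl, fun _ _ => rfl, fun _ _ => rfl⟩
  | loopStep _ _ _ h h' =>
    exact ⟨fun y hy => (h'.nvar y hy).trans (h.nvar y hy),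
      fun y hy => (h'.narr y hy).trans (h.narr y hy),
      fun y hy => (h'.rarr y hy).trans (h.rarr y hy)⟩

theorem Prog.frame_run {A : Prog} (hA : A.Straight) (s : Mem) : Frame A s (A.run s) :=
  (A.exec_run hA s).choose_spec.2.frame

/-- From memory `s`, the program `A` halts after at most `c * (N + 1)` steps in a memory that
satisfies `Q`. -/
def Reaches (A : Prog) (c N : ℕ) (s : Mem) (Q : Mem → Prop) : Prop :=
  ∃ t s', Exec A s t s' ∧ t ≤ c * (N + 1) ∧ Q s'

/-- The second program receives the frame of the first, so `Q` need only speak of what the first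
program computes. -/
theorem Reaches.seq {A B : Prog} {c c' N : ℕ} {s : Mem} {Q R : Mem → Prop}
    (hA : Reaches A c N s Q) (hB : ∀ s', Frame A s s' → Q s' → Reaches B c' N s' R) :
    Reaches (.seq A B) (c + c') N s R := by
  obtain ⟨t, s', h, ht, hQ⟩ := hA
  obtain ⟨t', s'', h', ht', hR⟩ := hB s' h.frame hQ
  exact ⟨t + t', s'', .seq h h', by rw [add_mul]; exact add_le_add ht ht', hR⟩

theorem Reaches.run {A : Prog} (hA : A.Straight) {N : ℕ} {s : Mem} {Q : Mem → Prop}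
    (h : Q (A.run s)) : Reaches A A.bound N s Q := by
  obtain ⟨t, ht, hE⟩ := A.exec_run hA s
  exact ⟨t, _, hE, ht.trans (Nat.le_mul_of_pos_right _ N.succ_pos), h⟩

theorem Reaches.mono {A : Prog} {c N : ℕ} {s : Mem} {Q R : Mem → Prop}
    (h : Reaches A c N s Q) (hQR : ∀ s', Q s' → R s') : Reaches A c N s R := by
  obtain ⟨t, s', hE, ht, hQ⟩ := h
  exact ⟨t, s', hE, ht, hQR s' hQ⟩

/-- Strong induction on the potential `μ`: each round lowers it, and the extra 1 in `μ s + 1` pays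
for the final failing test. -/
theorem exec_loop {b : Guard} {A : Prog} (hA : A.Straight) (I : Mem → Prop) (μ : Mem → ℕ)
    (step : ∀ s, I s → b.Holds s → I (A.run s) ∧ μ (A.run s) < μ s) (s : Mem) (hs : I s) :
    ∃ t s', Exec (.loop b A) s t s' ∧ t ≤ (A.bound + b.cost + 1) * (μ s + 1) ∧
      I s' ∧ ¬ b.Holds s' := by
  induction hk : μ s using Nat.strong_induction_on generalizing s with
  | _ k ih =>
    subst hk
    by_cases hb : b.Holds s
    · obtain ⟨hI, hμ⟩ := step s hs hb
      obtain ⟨t, ht, hE⟩ := A.exec_run hA s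
      obtain ⟨t', s', hE', ht', hI', hb'⟩ := ih _ hμ _ hI rfl
      refine ⟨_, s', .loopStep hb hE hE', ?_, hI', hb'⟩
      have h1 : (A.bound + b.cost + 1) * (μ (A.run s) + 1) ≤ (A.bound + b.cost + 1) * μ s :=
        Nat.mul_le_mul_left _ hμ
      rw [mul_add]
      omega
    · refine ⟨_, s, .loopDone hb, ?_, hs, hb⟩
      rw [mul_add]
      omega

theorem Reaches.loop {b : Guard} {A : Prog} (hA : A.Straight) (I : Mem → Prop) (μ : Mem → ℕ)
    (step : ∀ s, I s → b.Holds s → I (A.run s) ∧ μ (A.run s) < μ s) {s : Mem} (hs : I s)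
    {k N : ℕ} (hk : μ s ≤ k * N) :
    Reaches (.loop b A) ((A.bound + b.cost + 1) * (k + 1)) N s
      (fun s' => I s' ∧ ¬ b.Holds s') := by
  obtain ⟨t, s', hE, ht, hI⟩ := exec_loop hA I μ step s hs
  refine ⟨t, s', hE, ht.trans ?_, hI⟩
  rw [mul_assoc]
  refine Nat.mul_le_mul_left _ ?_
  nlinarith

/-- `for i in 0 .. (variable x) do A`, with `i` in variable `2`. -/
def forLoop (x : ℕ) (A : Prog) : Prog :=
  .seq (.nset 2 (.const 0))
    (.loop (.ltN (.var 2) (.var x)) (.seq A (.nset 2 (.succ (.var 2)))))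

/-- The constant in the running time of a `forLoop`. -/
def forCost (A : Prog) (k : ℕ) : ℕ := 2 + ((A.bound + 3) + 3 + 1) * (k + 1)

/-- The step hypothesis gets the frame from the initial memory `s` to the current one, so arrays the
body does not write may be read off from `s`. The counter is variable 2, which the body must leave
alone. -/
theorem Reaches.forLoop {x : ℕ} {A : Prog} (hA : A.Straight) (h2 : 2 ∉ A.nvars)
    (hx : x ∉ A.nvars) (hx2 : x ≠ 2) {k N : ℕ} {s : Mem} (I : ℕ → Mem → Prop)
    (hN : s.nvar x ≤ k * N)
    (h0 : ∀ s' : Mem, s'.narr = s.narr → s'.rarr = s.rarr →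
      (∀ y, y ≠ 2 → s'.nvar y = s.nvar y) → I 0 s')
    (hstep : ∀ i s', i < s.nvar x → s'.nvar 2 = i → Frame (forLoop x A) s s' → I i s' →
      I (i + 1) ((A.run s').setN 2 (i + 1))) :
    Reaches (forLoop x A) (forCost A k) N s (I (s.nvar x)) := by
  have hL : (Prog.seq A (.nset 2 (.succ (.var 2)))).Straight := ⟨hA, trivial⟩
  refine Reaches.seq (Q := fun s' => s' = s.setN 2 0) 
    (Reaches.run (A := .nset 2 (.const 0)) trivial rfl) ?_
  rintro _ - rfl
  -- The constants of `forCost`: 2 for the initial assignment, 3 for the increment, 3 for the guard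
  -- and 1 for the loop itself.
  have key := Reaches.loop (b := .ltN (.var 2) (.var x)) hL
    (fun s' => s'.nvar 2 ≤ s.nvar x ∧ Frame (EdgeDom.forLoop x A) s s' ∧ I (s'.nvar 2) s')
    (fun s' => s.nvar x - s'.nvar 2) (s := s.setN 2 0) (k := k) (N := N) ?_ ?_ ?_
  · refine key.mono ?_
    rintro s' ⟨⟨h1, h2', h3⟩, h4⟩
    have hx' : s'.nvar x = s.nvar x := h2'.nvar x (by
      simp [EdgeDom.forLoop, Prog.nvars, hx, hx2])
    simp only [Guard.Holds, NExp.eval, hx', not_lt] at h4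
    rwa [le_antisymm h1 h4] at h3
  · rintro s' ⟨h1, hF, h3⟩ hb
    have hx' : s'.nvar x = s.nvar x := hF.nvar x (by
      simp [EdgeDom.forLoop, Prog.nvars, hx, hx2])
    simp only [Guard.Holds, NExp.eval, hx'] at hb
    have hR := Prog.frame_run hA s'
    have e2 : (A.run s').nvar 2 = s'.nvar 2 := hR.nvar 2 h2
    have hrun : (Prog.seq A (.nset 2 (.succ (.var 2)))).run s' =
        (A.run s').setN 2 (s'.nvar 2 + 1) := by
      simp only [Prog.run, NExp.eval, e2]
    have hn : ((A.run s').setN 2 (s'.nvar 2 + 1)).nvar 2 = s'.nvar 2 + 1 := by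
      simp [Mem.setN]
    rw [hrun, hn]
    refine ⟨⟨hb, ⟨fun y hy => ?_, fun y hy => ?_, fun y hy => ?_⟩, hstep _ s' hb rfl hF h3⟩,
      by omega⟩
    · have hy' : y ≠ 2 ∧ y ∉ A.nvars := by
        simp only [EdgeDom.forLoop, Prog.nvars, List.mem_append, List.mem_singleton] at hy
        tauto
      rw [← hF.nvar y hy, ← hR.nvar y hy'.2]
      exact Function.update_of_ne hy'.1 _ _
    · have hy' : y ∉ A.narrs := by simpa [EdgeDom.forLoop, Prog.narrs] using hy
      rw [← hF.narr y hy, ← hR.narr y hy']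
      rfl
    · have hy' : y ∉ A.rarrs := by simpa [EdgeDom.forLoop, Prog.rarrs] using hy
      rw [← hF.rarr y hy, ← hR.rarr y hy']
      rfl
  · have e : (s.setN 2 0).nvar 2 = 0 := by simp [Mem.setN]
    rw [e]
    refine ⟨Nat.zero_le _, ⟨fun y hy => ?_, fun y hy => rfl, fun y hy => rfl⟩,
      h0 _ rfl rfl fun y hy => Function.update_of_ne hy _ _⟩
    have hy' : y ≠ 2 := by
      rintro rfl
      simp [EdgeDom.forLoop, Prog.nvars] at hy
    exact Function.update_of_ne hy' _ _
  · have e : (s.setN 2 0).nvar 2 = 0 := by simp [Mem.setN]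
    rw [e]
    exact hN

section Lookup

variable (s : Mem) (x a i v y b j : ℕ) (r : ℝ)

theorem Mem.setN_nvar : (s.setN x v).nvar y = if y = x then v else s.nvar y := by
  simp [Mem.setN, Function.update_apply]

theorem Mem.setN_narr : (s.setN x v).narr = s.narr := rfl

theorem Mem.setN_rarr : (s.setN x v).rarr = s.rarr := rfl

theorem Mem.putN_nvar : (s.putN a i v).nvar = s.nvar := rfl

theorem Mem.putN_narr :
    (s.putN a i v).narr b j = if b = a then (if j = i then v else s.narr b j) else s.narr b j := by
  simp only [Mem.putN, Function.update_apply]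
  split_ifs with h1 h2 <;> simp_all

theorem Mem.putN_rarr : (s.putN a i v).rarr = s.rarr := rfl

theorem Mem.putR_nvar : (s.putR a i r).nvar = s.nvar := rfl

theorem Mem.putR_narr : (s.putR a i r).narr = s.narr := rfl

theorem Mem.putR_rarr :
    (s.putR a i r).rarr b j = if b = a then (if j = i then r else s.rarr b j) else s.rarr b j := by
  simp only [Mem.putR, Function.update_apply]
  split_ifs with h1 h2 <;> simp_all

end Lookup

end Semantics

end EdgeDom

namespace EdgeDom

/-! ### A PEDS is trivial or efficient when triangles cover the vertices -/

section Graphs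

variable {V : Type*} {G : SimpleGraph V} {P : Set (Sym2 V)}

theorem dominates_mk_iff {f : Sym2 V} {a b : V} : Dominates f s(a, b) ↔ a ∈ f ∨ b ∈ f := by
  constructor
  · rintro (rfl | ⟨v, hv, hv'⟩)
    · simp
    · rcases Sym2.mem_iff.1 hv' with rfl | rfl
      · exact .inl hv
      · exact .inr hv
  · rintro (h | h)
    · exact .inr ⟨a, h, by simp⟩
    · exact .inr ⟨b, h, by simp⟩

theorem isPEDS_edgeSet : IsPEDS G G.edgeSet :=
  ⟨subset_rfl, fun _ h h' => absurd h h'⟩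

theorem IsEEDS.isPEDS (h : IsEEDS G P) : IsPEDS G P :=
  ⟨h.subset, fun e he _ => h.efficient e he⟩

theorem IsPEDS.eq_of_dominates (h : IsPEDS G P) {a b : V} (hab : G.Adj a b) (hn : s(a, b) ∉ P)
    {f g : Sym2 V} (hf : f ∈ P) (hg : g ∈ P) (hf' : a ∈ f ∨ b ∈ f) (hg' : a ∈ g ∨ b ∈ g) :
    f = g :=
  (h.perfect _ hab hn).unique ⟨hf, dominates_mk_iff.2 hf'⟩ ⟨hg, dominates_mk_iff.2 hg'⟩

theorem IsPEDS.exists_dominates (h : IsPEDS G P) {a b : V} (hab : G.Adj a b) (hn : s(a, b) ∉ P) :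
    ∃ f ∈ P, a ∈ f ∨ b ∈ f := by
  obtain ⟨f, ⟨hf, hf'⟩, -⟩ := h.perfect _ hab hn
  exact ⟨f, hf, dominates_mk_iff.1 hf'⟩

/-- All edges of `G` at the vertex belong to `P`. -/
def Black (G : SimpleGraph V) (P : Set (Sym2 V)) (v : V) : Prop := ∀ u, G.Adj v u → s(v, u) ∈ P

/-- If u is not black, a missing edge at u forces vu to be the only edge of P at u. A triangle u, v,
b is impossible, since ub would be dominated by both vb and vu. For a triangle u, a, b avoiding v,
the missing edges ua and ub are dominated by vu alone, so P does not meet a or b and ab is left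
undominated. -/
theorem IsPEDS.black_of_adj (h : IsPEDS G P) (ht : ∀ v, InTriangle G v) {v u : V}
    (hv : Black G P v) (hvu : G.Adj v u) : Black G P u := by
  by_contra hu
  simp only [Black, not_forall] at hu
  obtain ⟨x, hux, hxP⟩ := hu
  have hvuP : s(v, u) ∈ P := hv u hvu
  have hnot : ∀ y, G.Adj u y → y ≠ v → s(u, y) ∉ P := by
    intro y hy hyv hyP
    have := h.eq_of_dominates hux hxP hyP hvuP (.inl (by simp)) (.inl (by simp))
    have hy' : y ∈ s(v, u) := this ▸ Sym2.mem_mk_right u y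
    rcases Sym2.mem_iff.1 hy' with rfl | rfl
    · exact hyv rfl
    · exact hy.ne rfl
  have corner : ∀ b, G.Adj u b → G.Adj v b → False := by
    intro b hub hvb
    have := h.eq_of_dominates hub (hnot b hub hvb.ne') (hv b hvb) hvuP (.inr (by simp))
      (.inl (by simp))
    have hb : b ∈ s(v, u) := this ▸ Sym2.mem_mk_right v b
    rcases Sym2.mem_iff.1 hb with rfl | rfl
    · exact hvb.ne rfl
    · exact hub.ne rfl
  obtain ⟨a, b, hua, hub, hab⟩ := ht u
  have hav : a ≠ v := by
    rintro rfl
    exact corner b hub hab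
  have hbv : b ≠ v := by
    rintro rfl
    exact corner a hua hab.symm
  have side : ∀ c, G.Adj u c → c ≠ v → ∀ f ∈ P, c ∉ f := by
    intro c huc hcv f hf hcf
    have := h.eq_of_dominates huc (hnot c huc hcv) hf hvuP (.inr hcf) (.inl (by simp))
    rw [this] at hcf
    rcases Sym2.mem_iff.1 hcf with rfl | rfl
    · exact hcv rfl
    · exact huc.ne rfl
  have habP : s(a, b) ∉ P := fun hP => side a hua hav _ hP (by simp)
  obtain ⟨f, hf, hf' | hf'⟩ := h.exists_dominates hab habP
  · exact side a hua hav f hf hf'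
  · exact side b hub hbv f hf hf'

theorem IsPEDS.black_of_reachable (h : IsPEDS G P) (ht : ∀ v, InTriangle G v) {v u : V}
    (hv : Black G P v) (hvu : G.Reachable v u) : Black G P u := by
  obtain ⟨p⟩ := hvu
  induction p with
  | nil => exact hv
  | cons hadj _ ih => exact ih (h.black_of_adj ht hv hadj)

/-- A missing edge at each vertex allows only one edge of P there, so P is a matching and its edges
are dominated only by themselves. -/
theorem IsPEDS.isEEDS_of_forall_not_black (h : IsPEDS G P) (hb : ∀ v, ¬ Black G P v) :
    IsEEDS G P := by
  refine ⟨h.subset, fun e he => ?_⟩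
  by_cases heP : e ∈ P
  · refine ⟨e, ⟨heP, .inl rfl⟩, ?_⟩
    rintro f ⟨hf, rfl | ⟨v, hvf, hve⟩⟩
    · rfl
    · have := hb v
      simp only [Black, not_forall] at this
      obtain ⟨x, hvx, hx⟩ := this
      exact h.eq_of_dominates hvx hx hf heP (.inl hvf) (.inl hve)
  · exact h.perfect e he heP

theorem IsPEDS.eq_edgeSet_or_isEEDS (hG : G.Connected)
    (ht : ∀ v, InTriangle G v)
    (h : IsPEDS G P) : P = G.edgeSet ∨ IsEEDS G P := by
  by_cases hb : ∃ v, Black G P v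
  · obtain ⟨v, hv⟩ := hb
    refine .inl (subset_antisymm h.subset ?_)
    intro e
    induction e with
    | _ a b => exact fun hab => h.black_of_reachable ht hv (hG.preconnected v a) b hab
  · push Not at hb
    exact .inr (h.isEEDS_of_forall_not_black hb)

/-- Otherwise v with a, b, c would be an induced claw with centre v. -/
theorem exists_pair_of_clawFree (h : ClawFree G) {v a b c : V} (ha : G.Adj v a) (hb : G.Adj v b)
    (hc : G.Adj v c) (hab : a ≠ b) (hac : a ≠ c) (hbc : b ≠ c) :
    G.Adj a b ∨ G.Adj b c ∨ G.Adj a c := by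
  by_contra hn
  push Not at hn
  obtain ⟨h1, h2, h3⟩ := hn
  have key : ∀ x y : Fin 1 ⊕ Fin 3, G.Adj (Sum.elim (fun _ => v) ![a, b, c] x)
      (Sum.elim (fun _ => v) ![a, b, c] y) ↔ (completeBipartiteGraph (Fin 1) (Fin 3)).Adj x y := by
    rintro (i | i) (j | j)
    · simp
    · fin_cases i; fin_cases j <;> simp_all
    · fin_cases j; fin_cases i <;> simp_all [G.adj_comm]
    · fin_cases i <;> fin_cases j <;> simp_all [G.adj_comm]
  refine h ⟨⟨⟨Sum.elim (fun _ => v) ![a, b, c], ?_⟩, key _ _⟩⟩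
  have := ha.ne
  have := hb.ne
  have := hc.ne
  rintro (i | i) (j | j) hij
  · fin_cases i; fin_cases j; rfl
  · fin_cases i; fin_cases j <;> simp_all
  · fin_cases j; fin_cases i <;> simp_all
  · fin_cases i <;> fin_cases j <;> simp_all

theorem inTriangle_of_clawFree [Fintype V] [DecidableEq V] [DecidableRel G.Adj]
    (hr : G.IsRegularOfDegree 3) (h : ClawFree G) (v : V) : InTriangle G v := by
  obtain ⟨a, b, c, hab, hac, hbc, hN⟩ := Finset.card_eq_three.1 (hr v)
  have hm : ∀ u, G.Adj v u ↔ u = a ∨ u = b ∨ u = c := fun u => by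
    rw [← G.mem_neighborFinset, hN]; simp
  have ha : G.Adj v a := (hm a).2 (by simp)
  have hb : G.Adj v b := (hm b).2 (by simp)
  have hc : G.Adj v c := (hm c).2 (by simp)
  rcases exists_pair_of_clawFree h ha hb hc hab hac hbc with h' | h' | h'
  exacts [⟨a, b, ha, hb, h'⟩, ⟨b, c, hb, hc, h'⟩, ⟨a, c, ha, hc, h'⟩]

theorem not_exists_isProperPEDS (hG : G.Connected)
    (ht : ∀ v, InTriangle G v) :
    ¬ ∃ P : Set (Sym2 V), IsProperPEDS G P := by
  rintro ⟨P, h, hE, hD⟩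
  exact (h.eq_edgeSet_or_isEEDS hG ht).elim hE hD

/-! ### Minimum weight in the connected case -/

section Weighted

theorem exists_isMinPEDS [Fintype V] (G : SimpleGraph V) [DecidableRel G.Adj] (w : Sym2 V → ℝ) :
    ∃ P, IsMinPEDS G w P := by
  classical
  obtain ⟨P, hP, hmin⟩ := (Finset.univ.filter fun P : Finset (Sym2 V) =>
    IsPEDS G P).exists_min_image (weight w) ⟨G.edgeFinset, by
      simpa using isPEDS_edgeSet⟩
  simp only [Finset.mem_filter, Finset.mem_univ, true_and] at hP hmin
  exact ⟨P, hP, hmin⟩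

theorem IsPEDS.eq_edgeFinset_or_isEEDS [Fintype V] [DecidableRel G.Adj] (hG : G.Connected)
    (ht : ∀ v, InTriangle G v) {P : Finset (Sym2 V)} (h : IsPEDS G P) :
    P = G.edgeFinset ∨ IsEEDS G P := by
  refine (h.eq_edgeSet_or_isEEDS hG ht).imp_left fun h => ?_
  rw [← Finset.coe_inj, h, SimpleGraph.coe_edgeFinset]

theorem weighted_connected [Fintype V] [DecidableEq V] [DecidableRel G.Adj] (w : Sym2 V → ℝ)
    (hG : G.Connected) (hr : G.IsRegularOfDegree 3) (hc : ClawFree G) :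
    (∃ P, IsMinPEDS G w P) ∧
      (∀ P, IsMinPEDS G w P → P = G.edgeFinset ∨ IsMinEEDS G w P) ∧
      (∀ D, IsMinEEDS G w D →
        (weight w D ≤ weight w G.edgeFinset → IsMinPEDS G w D) ∧
        (weight w G.edgeFinset ≤ weight w D → IsMinPEDS G w G.edgeFinset)) ∧
      ((¬ ∃ D : Finset (Sym2 V), IsEEDS G D) →
        ∀ P : Finset (Sym2 V), IsPEDS G P ↔ P = G.edgeFinset) := by
  have ht := inTriangle_of_clawFree hr hc
  have hE : IsPEDS G (G.edgeFinset : Set (Sym2 V)) := by simpa using isPEDS_edgeSet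
  refine ⟨exists_isMinPEDS G w, fun P hP => ?_, fun D hD => ⟨fun hle => ⟨hD.1.isPEDS, ?_⟩,
    fun hle => ⟨hE, ?_⟩⟩, fun hn P => ⟨fun hP => ?_, ?_⟩⟩
  · exact (hP.1.eq_edgeFinset_or_isEEDS hG ht).imp_right fun h =>
      ⟨h, fun Q hQ => hP.2 Q hQ.isPEDS⟩
  · intro Q hQ
    rcases hQ.eq_edgeFinset_or_isEEDS hG ht with rfl | h
    exacts [hle, hD.2 Q h]
  · intro Q hQ
    rcases hQ.eq_edgeFinset_or_isEEDS hG ht with rfl | h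
    exacts [le_rfl, hle.trans (hD.2 Q h)]
  · exact (hP.eq_edgeFinset_or_isEEDS hG ht).resolve_right fun h => hn ⟨P, h⟩
  · rintro rfl
    exact hE

end Weighted

end Graphs

end EdgeDom

namespace EdgeDom

/-! ### Local structure of cubic claw-free graphs and the local form of efficiency -/

section Structure

variable {H : SimpleGraph ℕ} {p q o : ℕ → ℕ} {W : ℕ → Prop} {u v : ℕ}

/-- The neighbours of `v` are `p v`, `q v` and `o v`, and only `p v` and `q v` are adjacent. -/
structure Tri (H : SimpleGraph ℕ) (p q o : ℕ → ℕ) (v : ℕ) : Prop where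
  adj : ∀ u, H.Adj v u ↔ u = p v ∨ u = q v ∨ u = o v
  ne_pq : p v ≠ q v
  ne_po : p v ≠ o v
  ne_qo : q v ≠ o v
  adj_pq : H.Adj (p v) (q v)
  not_po : ¬ H.Adj (p v) (o v)
  not_qo : ¬ H.Adj (q v) (o v)

/-- The vertex `v` has three neighbours, one of which is adjacent to the other two. -/
def Mid (H : SimpleGraph ℕ) (v : ℕ) : Prop :=
  ∃ a b c, (∀ u, H.Adj v u ↔ u = a ∨ u = b ∨ u = c) ∧ a ≠ b ∧ a ≠ c ∧ b ≠ c ∧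
    H.Adj c a ∧ H.Adj c b

/-- Each of the vertices below `n`, which are all the vertices of positive degree, has one of the
two local shapes of a cubic claw-free graph. -/
structure Local (H : SimpleGraph ℕ) (n : ℕ) (p q o : ℕ → ℕ) : Prop where
  lt : ∀ {u v}, H.Adj u v → v < n
  shape : ∀ v < n, Tri H p q o v ∨ Mid H v

/-- The symmetry between the two mates: facts about `q` follow from those about `p`. -/
theorem Tri.swap (h : Tri H p q o v) : Tri H q p o v :=
  ⟨fun u => by rw [h.adj]; tauto, h.ne_pq.symm, h.ne_qo, h.ne_po, h.adj_pq.symm, h.not_qo,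
    h.not_po⟩

theorem Local.swap {n : ℕ} (h : Local H n p q o) : Local H n q p o :=
  ⟨h.lt, fun v hv => (h.shape v hv).imp_left Tri.swap⟩

theorem Tri.adj_p (h : Tri H p q o v) : H.Adj v (p v) := (h.adj _).2 (.inl rfl)

theorem Tri.adj_q (h : Tri H p q o v) : H.Adj v (q v) := (h.adj _).2 (.inr (.inl rfl))

theorem Tri.adj_o (h : Tri H p q o v) : H.Adj v (o v) := (h.adj _).2 (.inr (.inr rfl))

/-- The neighbours span one edge in the first shape and at least two in the second. -/
theorem Tri.not_mid (h : Tri H p q o v) : ¬ Mid H v := by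
  rintro ⟨a, b, c, hN, hab, hac, hbc, hca, hcb⟩
  have ha := (h.adj a).1 ((hN a).2 (by simp))
  have hb := (h.adj b).1 ((hN b).2 (by simp))
  have hc := (h.adj c).1 ((hN c).2 (by simp))
  have h1 := h.not_po
  have h2 := h.not_qo
  have h1' := mt SimpleGraph.Adj.symm h1
  have h2' := mt SimpleGraph.Adj.symm h2
  rcases ha with rfl | rfl | rfl <;> rcases hb with rfl | rfl | rfl <;>
    rcases hc with rfl | rfl | rfl <;> simp_all

theorem Tri.no_common (h : Tri H p q o v) (hu : H.Adj v u) : ¬ H.Adj (o v) u := by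
  intro hou
  rcases (h.adj u).1 hu with rfl | rfl | rfl
  exacts [h.not_po hou.symm, h.not_qo hou.symm, hou.ne rfl]

/-- The edge from v to `o v` lies in no triangle, whereas every edge at a `Mid` vertex and every
edge to a mate lies in one. So `o v` is not `Mid`, and v can only be its outer neighbour. -/
theorem Tri.outer {n : ℕ} (L : Local H n p q o) (h : Tri H p q o v) :
    Tri H p q o (o v) ∧ o (o v) = v := by
  have ho : Tri H p q o (o v) := by
    refine (L.shape _ (L.lt h.adj_o)).resolve_right ?_
    rintro ⟨a, b, c, hN, hab, hac, hbc, hca, hcb⟩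
    have hnb : ∀ x, H.Adj (o v) x → ¬ H.Adj v x := fun x hx hx' => h.no_common hx' hx
    have hc := (hN c).2 (by simp)
    rcases (hN v).1 h.adj_o.symm with rfl | rfl | rfl
    exacts [hnb c hc hca.symm, hnb c hc hcb.symm, hnb a ((hN a).2 (by simp)) hca]
  refine ⟨ho, ?_⟩
  rcases (ho.adj v).1 h.adj_o.symm with e | e | e
  · have h1 := ho.adj_pq
    rw [← e] at h1
    exact absurd ho.adj_q (h.no_common h1)
  · have h1 := ho.adj_pq.symm
    rw [← e] at h1
    exact absurd ho.adj_p (h.no_common h1)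
  · exact e.symm

/-- Both v and `q v` lie in a triangle with `p v`, so neither is its outer neighbour. They are its
two mates, in an order that is not known. -/
theorem Tri.mate_p {n : ℕ} (L : Local H n p q o) (h : Tri H p q o v) (hp : Tri H p q o (p v)) :
    (p (p v) = v ∧ q (p v) = q v) ∨ (q (p v) = v ∧ p (p v) = q v) := by
  have ho : o (p v) ≠ v := fun e => by
    have := (hp.outer L).2
    rw [e] at this
    exact h.ne_po this.symm
  have ho' : o (p v) ≠ q v := fun e => by
    have := hp.no_common h.adj_p.symm
    rw [e] at this
    exact this h.adj_q.symm
  have h1 := (hp.adj v).1 h.adj_p.symm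
  have h2 := (hp.adj (q v)).1 h.adj_pq
  have := h.adj_q.ne
  grind

theorem Tri.mate_q {n : ℕ} (L : Local H n p q o) (h : Tri H p q o v) (hq : Tri H p q o (q v)) :
    (p (q v) = v ∧ q (q v) = p v) ∨ (q (q v) = v ∧ p (q v) = p v) :=
  (h.swap.mate_p L.swap hq.swap).symm

/-- The two mates are then the middle vertices of one diamond. If `q v` were a `Tri` vertex, the
third neighbour of `p v` would be adjacent to neither v nor `q v`, so the neighbours of `p v` would
span only one edge. -/
theorem Tri.mid_q_of_mid_p {n : ℕ} (L : Local H n p q o) (h : Tri H p q o v) (hp : Mid H (p v)) :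
    Mid H (q v) := by
  by_contra hn
  have hq := (L.shape _ (L.lt h.adj_q)).resolve_right hn
  have hqm := h.mate_q L hq
  obtain ⟨a, b, c, hN, hab, hac, hbc, hca, hcb⟩ := hp
  have hv := (hN v).1 h.adj_p.symm
  have hqv := (hN (q v)).1 h.adj_pq
  have hne := h.adj_q.ne
  have key : ∀ r, H.Adj (p v) r → r ≠ v → r ≠ q v → ¬ H.Adj v r ∧ ¬ H.Adj (q v) r := by
    intro r hr h1 h2
    refine ⟨fun h3 => ?_, fun h3 => ?_⟩
    · rcases (h.adj r).1 h3 with rfl | rfl | rfl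
      exacts [hr.ne rfl, h2 rfl, h.not_po hr]
    · have := hq.no_common (u := p v) h.adj_pq.symm
      rcases (hq.adj r).1 h3 with e | e | e
      · have := hr.ne
        grind
      · have := hr.ne
        grind
      · rw [← e] at this
        exact this hr.symm
  have ka := key a ((hN a).2 (by simp))
  have kb := key b ((hN b).2 (by simp))
  have kc := key c ((hN c).2 (by simp))
  have hca' := hca.symm
  have hcb' := hcb.symm
  grind

/-- Exactly one of `a`, `b`, `c` belongs to `W`. -/
def One (W : ℕ → Prop) (a b c : ℕ) : Prop :=
  (W a ∧ ¬ W b ∧ ¬ W c) ∨ (¬ W a ∧ W b ∧ ¬ W c) ∨ (¬ W a ∧ ¬ W b ∧ W c)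

/-- The condition at `v` for the edges with no end in `W` to form an efficient edge dominating
set. -/
def Valid (H : SimpleGraph ℕ) (W : ℕ → Prop) (v : ℕ) : Prop :=
  (W v → ∀ u, H.Adj v u → ¬ W u) ∧ (¬ W v → ∃! u, H.Adj v u ∧ ¬ W u)

theorem valid_iff_of_nbrs {a b c : ℕ} (hN : ∀ u, H.Adj v u ↔ u = a ∨ u = b ∨ u = c) (hab : a ≠ b)
    (hac : a ≠ c) (hbc : b ≠ c) : Valid H W v ↔ (W v ∧ ¬ W a ∧ ¬ W b ∧ ¬ W c) ∨
      (¬ W v ∧ ((¬ W a ∧ W b ∧ W c) ∨ (W a ∧ ¬ W b ∧ W c) ∨ (W a ∧ W b ∧ ¬ W c))) := by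
  have hex : (∃! u, H.Adj v u ∧ ¬ W u) ↔
      (¬ W a ∧ W b ∧ W c) ∨ (W a ∧ ¬ W b ∧ W c) ∨ (W a ∧ W b ∧ ¬ W c) := by
    simp only [hN]
    constructor
    · rintro ⟨u, ⟨hu, h⟩, hun⟩
      have hW : ∀ y, (y = a ∨ y = b ∨ y = c) → y ≠ u → W y := fun y hy hne => by
        by_contra hw
        exact hne (hun y ⟨hy, hw⟩)
      rcases hu with rfl | rfl | rfl
      · exact .inl ⟨h, hW b (by simp) hab.symm, hW c (by simp) hac.symm⟩
      · exact .inr (.inl ⟨hW a (by simp) hab, h, hW c (by simp) hbc.symm⟩)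
      · exact .inr (.inr ⟨hW a (by simp) hac, hW b (by simp) hbc, h⟩)
    · rintro (⟨h1, h2, h3⟩ | ⟨h1, h2, h3⟩ | ⟨h1, h2, h3⟩)
      · exact ⟨a, ⟨by simp, h1⟩, by rintro u ⟨rfl | rfl | rfl, hu⟩ <;> first | rfl | contradiction⟩
      · exact ⟨b, ⟨by simp, h2⟩, by rintro u ⟨rfl | rfl | rfl, hu⟩ <;> first | rfl | contradiction⟩
      · exact ⟨c, ⟨by simp, h3⟩, by rintro u ⟨rfl | rfl | rfl, hu⟩ <;> first | rfl | contradiction⟩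
  rw [Valid, hex]
  simp only [hN]
  have : (∀ u, u = a ∨ u = b ∨ u = c → ¬ W u) ↔ ¬ W a ∧ ¬ W b ∧ ¬ W c := by
    simp
  rw [this]
  by_cases hv : W v <;> simp [hv]

theorem Tri.valid_iff (h : Tri H p q o v) : Valid H W v ↔
    (W v ∧ ¬ W (p v) ∧ ¬ W (q v) ∧ ¬ W (o v)) ∨ (¬ W v ∧ ((¬ W (p v) ∧ W (q v) ∧ W (o v)) ∨
      (W (p v) ∧ ¬ W (q v) ∧ W (o v)) ∨ (W (p v) ∧ W (q v) ∧ ¬ W (o v)))) :=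
  valid_iff_of_nbrs h.adj h.ne_pq h.ne_po h.ne_qo

theorem Tri.valid_of (h : Tri H p q o v) (h1 : One W v (p v) (q v)) (h2 : W (o v) ↔ ¬ W v) :
    Valid H W v := by
  rw [h.valid_iff]
  unfold One at h1
  tauto

/-- Validity at v alone still allows both mates to be white and `o v` not. Validity at `p v` rules
this out because the mates are adjacent. -/
theorem Tri.of_valid (h : Tri H p q o v) (hv : Valid H W v) (hp : Valid H W (p v)) :
    One W v (p v) (q v) ∧ (W (o v) ↔ ¬ W v) := by
  rw [h.valid_iff] at hv
  have := fun hw => hp.1 hw _ h.adj_pq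
  unfold One
  tauto

/-- If v were white, c would not be, and neither would its two neighbours a and b, which are also
neighbours of v; but c may have only one neighbour outside W. -/
theorem Mid.not_white (h : Mid H v) (hW : ∀ u, u = v ∨ H.Adj v u → Valid H W u) : ¬ W v := by
  obtain ⟨a, b, c, hN, hab, hac, hbc, hca, hcb⟩ := h
  intro hv
  have h0 := (hW v (.inl rfl)).1 hv
  have hvc := (hN c).2 (by simp)
  have hc := (hW c (.inr hvc)).2 (h0 c hvc)
  exact hab (hc.unique ⟨hca, h0 a ((hN a).2 (by simp))⟩ ⟨hcb, h0 b ((hN b).2 (by simp))⟩)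

end Structure

end EdgeDom

namespace EdgeDom

/-! ### Consequences of closure under unit propagation -/

section Propagation

variable {H : SimpleGraph ℕ} {n : ℕ} {p q o x : ℕ → ℕ} {W C : ℕ → Prop} {u v : ℕ}

/-- A union of connected components. -/
def Closed (H : SimpleGraph ℕ) (C : ℕ → Prop) : Prop := ∀ ⦃u v⦄, H.Adj u v → C u → C v

/-- `W` is the set of vertices not covered by an efficient edge dominating set of the graph
induced on `C`. -/
structure Solves (H : SimpleGraph ℕ) (n : ℕ) (C W : ℕ → Prop) : Prop where
  closed : Closed H C
  valid : ∀ v < n, C v → Valid H W v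

/-- The marks `x` are closed under unit propagation: `1` marks vertices that no solution contains,
`2` vertices that all solutions contain, and `0` the other vertices. -/
structure Propagated (H : SimpleGraph ℕ) (n : ℕ) (p q o x : ℕ → ℕ) : Prop where
  agree : ∀ C W, Solves H n C W → ∀ v < n, C v → (x v = 1 → ¬ W v) ∧ (x v = 2 → W v)
  out : ∀ v < n, Tri H p q o v → x v ≠ 0 → x (o v) ≠ 0
  mates : ∀ v < n, Tri H p q o v → x v = 2 → x (p v) = 1 ∧ x (q v) = 1
  mid : ∀ v < n, Mid H v → x v = 1
  le : ∀ v < n, x v ≤ 2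
  test : ∀ v < n, x v = 0 → x (p v) = 1 → x (q v) = 1 → False

theorem Propagated.swap (X : Propagated H n p q o x) : Propagated H n q p o x :=
  ⟨X.agree, fun v hv h => X.out v hv h.swap, fun v hv h h2 => (X.mates v hv h.swap h2).symm, X.mid,
    X.le, fun v hv h1 h2 h3 => X.test v hv h1 h3 h2⟩

theorem Propagated.tri (X : Propagated H n p q o x) (L : Local H n p q o) (hv : v < n)
    (h : x v = 0) : Tri H p q o v :=
  (L.shape v hv).resolve_right fun hm => by simp [X.mid v hv hm] at h

theorem Propagated.outer (X : Propagated H n p q o x) (L : Local H n p q o) (hv : v < n)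
    (h : x v = 0) : x (o v) = 0 := by
  have hT := X.tri L hv h
  obtain ⟨h1, h2⟩ := hT.outer L
  by_contra hn
  have := X.out _ (L.lt hT.adj_o) h1 hn
  rw [h2] at this
  exact this h

/-- A mark 2 comes with marks on both mates, so no mate of an unknown vertex can carry it. -/
theorem Propagated.eq_one_p (X : Propagated H n p q o x) (L : Local H n p q o) (hv : v < n)
    (h : x v = 0) (hp : x (p v) ≠ 0) : x (p v) = 1 := by
  have hT := X.tri L hv h
  have hpn := L.lt hT.adj_p
  rcases L.shape _ hpn with h1 | h1
  · by_contra h2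
    have h3 := X.le _ hpn
    obtain ⟨h4, h5⟩ := X.mates _ hpn h1 (by omega)
    rcases hT.mate_p L h1 with ⟨e, -⟩ | ⟨e, -⟩
    · rw [e, h] at h4
      exact zero_ne_one h4
    · rw [e, h] at h5
      exact zero_ne_one h5
  · exact X.mid _ hpn h1

theorem Propagated.eq_one_q (X : Propagated H n p q o x) (L : Local H n p q o) (hv : v < n)
    (h : x v = 0) (hq : x (q v) ≠ 0) : x (q v) = 1 :=
  X.swap.eq_one_p L.swap hv h hq

theorem Propagated.mate_unknown (X : Propagated H n p q o x) (L : Local H n p q o) (hv : v < n)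
    (h : x v = 0) : x (p v) = 0 ∨ x (q v) = 0 := by
  by_contra hn
  push Not at hn
  exact X.test v hv h (X.eq_one_p L hv h hn.1) (X.eq_one_q L hv h hn.2)

/-- An unknown neighbour u would have the `Mid` vertex as a mate, since outer neighbours are never
`Mid`. Then both its mates are `Mid`, hence marked 1, and propagation would have marked u. -/
theorem Propagated.marked_of_mid (X : Propagated H n p q o x) (L : Local H n p q o)
    (hm : Mid H v) (huv : H.Adj v u) : x u ≠ 0 := by
  intro h
  have hu := L.lt huv
  have hv := L.lt huv.symm
  have hT := X.tri L hu h
  rcases (hT.adj v).1 huv.symm with rfl | rfl | rfl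
  · exact X.test u hu h (X.mid _ hv hm)
      (X.mid _ (L.lt hT.adj_q) (hT.mid_q_of_mid_p L hm))
  · exact X.test u hu h (X.mid _ (L.lt hT.adj_p) (hT.swap.mid_q_of_mid_p L.swap hm))
      (X.mid _ hv hm)
  · exact (hT.outer L).1.not_mid hm

theorem Solves.tri (S : Solves H n C W) (L : Local H n p q o) (hv : v < n) (hC : C v)
    (hT : Tri H p q o v) : One W v (p v) (q v) ∧ (W (o v) ↔ ¬ W v) :=
  hT.of_valid (S.valid v hv hC) (S.valid _ (L.lt hT.adj_p) (S.closed hT.adj_p hC))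

open Classical in
/-- The mate of `o u` in `W`. -/
noncomputable def nextWhite (p q o : ℕ → ℕ) (W : ℕ → Prop) (u : ℕ) : ℕ :=
  if W (p (o u)) then p (o u) else q (o u)

open Classical in
/-- The unknown vertices of `C` in `W`. -/
noncomputable def unknownWhite (n : ℕ) (x : ℕ → ℕ) (C W : ℕ → Prop) : Finset ℕ :=
  (Finset.range n).filter fun v => C v ∧ x v = 0 ∧ W v

theorem mem_unknownWhite : v ∈ unknownWhite n x C W ↔ v < n ∧ C v ∧ x v = 0 ∧ W v := by
  simp [unknownWhite]

/-- The outer neighbour of an unknown white vertex is unknown and not white, so one of its mates is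
white. That mate is unknown, because a marked mate of an unknown vertex carries the mark 1. -/
theorem Solves.nextWhite_mem (S : Solves H n C W) (L : Local H n p q o)
    (X : Propagated H n p q o x) (hv : v ∈ unknownWhite n x C W) :
    nextWhite p q o W v ∈ unknownWhite n x C W := by
  rw [mem_unknownWhite] at hv ⊢
  obtain ⟨hn, hC, hx, hW⟩ := hv
  have hT := X.tri L hn hx
  have hT' := (hT.outer L).1
  have hn' := L.lt hT.adj_o
  have hC' := S.closed hT.adj_o hC
  have hx' := X.outer L hn hx
  have hW' : ¬ W (o v) := fun h => (S.tri L hn hC hT).2.1 h hW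
  have h1 := (S.tri L hn' hC' hT').1
  unfold nextWhite
  split_ifs with hp
  · refine ⟨L.lt hT'.adj_p, S.closed hT'.adj_p hC', ?_, hp⟩
    by_contra h
    exact (X.agree C W S _ (L.lt hT'.adj_p) (S.closed hT'.adj_p hC')).1
      (X.eq_one_p L hn' hx' h) hp
  · have hq : W (q (o v)) := by
      unfold One at h1
      tauto
    refine ⟨L.lt hT'.adj_q, S.closed hT'.adj_q hC', ?_, hq⟩
    by_contra h
    exact (X.agree C W S _ (L.lt hT'.adj_q) (S.closed hT'.adj_q hC')).1
      (X.eq_one_q L hn' hx' h) hq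

/-- Each unknown mate of a white vertex v yields a preimage of v under `nextWhite`: the mate is not
white, its outer neighbour is, and `nextWhite` leads from there back to v. -/
theorem Solves.nextWhite_outer_p (S : Solves H n C W) (L : Local H n p q o)
    (X : Propagated H n p q o x) (hv : v ∈ unknownWhite n x C W) (hp : x (p v) = 0) :
    o (p v) ∈ unknownWhite n x C W ∧ nextWhite p q o W (o (p v)) = v := by
  rw [mem_unknownWhite] at hv ⊢
  obtain ⟨hn, hC, hx, hW⟩ := hv
  have hT := X.tri L hn hx
  have hnp := L.lt hT.adj_p
  have hT' := X.tri L hnp hp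
  have hC' := S.closed hT.adj_p hC
  have h1 := (S.tri L hn hC hT).1
  have hWp : ¬ W (p v) := by unfold One at h1; tauto
  have hWq : ¬ W (q v) := by unfold One at h1; tauto
  refine ⟨⟨L.lt hT'.adj_o, S.closed hT'.adj_o hC', X.outer L hnp hp,
    (S.tri L hnp hC' hT').2.2 hWp⟩, ?_⟩
  rw [nextWhite, (hT'.outer L).2]
  rcases hT.mate_p L hT' with ⟨e1, e2⟩ | ⟨e1, e2⟩
  · rw [e1, if_pos hW]
  · rw [e1, e2, if_neg hWq]

theorem Solves.nextWhite_outer_q (S : Solves H n C W) (L : Local H n p q o)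
    (X : Propagated H n p q o x) (hv : v ∈ unknownWhite n x C W) (hq : x (q v) = 0) :
    o (q v) ∈ unknownWhite n x C W ∧ nextWhite p q o W (o (q v)) = v := by
  rw [mem_unknownWhite] at hv ⊢
  obtain ⟨hn, hC, hx, hW⟩ := hv
  have hT := X.tri L hn hx
  have hnp := L.lt hT.adj_q
  have hT' := X.tri L hnp hq
  have hC' := S.closed hT.adj_q hC
  have h1 := (S.tri L hn hC hT).1
  have hWp : ¬ W (p v) := by unfold One at h1; tauto
  have hWq : ¬ W (q v) := by unfold One at h1; tauto
  refine ⟨⟨L.lt hT'.adj_o, S.closed hT'.adj_o hC', X.outer L hnp hq,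
    (S.tri L hnp hC' hT').2.2 hWq⟩, ?_⟩
  rw [nextWhite, (hT'.outer L).2]
  rcases hT.mate_q L hT' with ⟨e1, e2⟩ | ⟨e1, e2⟩
  · rw [e1, if_pos hW]
  · rw [e1, e2, if_neg hWp]

/-- `nextWhite` maps the unknown white vertices onto themselves, since each has an unknown mate.
Being injective by finiteness, it cannot have the two preimages `o (p v)` and `o (q v)` of v. -/
theorem Solves.not_both_unknown_of_white (S : Solves H n C W) (L : Local H n p q o)
    (X : Propagated H n p q o x) (hv : v ∈ unknownWhite n x C W) :
    ¬ (x (p v) = 0 ∧ x (q v) = 0) := by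
  rintro ⟨hp, hq⟩
  have hinj : Set.InjOn (nextWhite p q o W) (unknownWhite n x C W) := by
    -- A surjection of a finite set onto itself is injective.
    refine Finset.injOn_of_surjOn_of_card_le (t := unknownWhite n x C W) _
      (fun u hu => S.nextWhite_mem L X hu) (fun u hu => ?_) le_rfl
    have hu' := mem_unknownWhite.1 hu
    rcases X.mate_unknown L hu'.1 hu'.2.2.1 with h | h
    · exact ⟨_, (S.nextWhite_outer_p L X hu h).1, (S.nextWhite_outer_p L X hu h).2⟩
    · exact ⟨_, (S.nextWhite_outer_q L X hu h).1, (S.nextWhite_outer_q L X hu h).2⟩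
  obtain ⟨hp1, hp2⟩ := S.nextWhite_outer_p L X hv hp
  obtain ⟨hq1, hq2⟩ := S.nextWhite_outer_q L X hv hq
  have e := hinj hp1 hq1 (hp2.trans hq2.symm)
  have hv' := mem_unknownWhite.1 hv
  have hT := X.tri L hv'.1 hv'.2.2.1
  have e1 := ((X.tri L (L.lt hT.adj_p) hp).outer L).2
  have e2 := ((X.tri L (L.lt hT.adj_q) hq).outer L).2
  rw [e, e2] at e1
  exact hT.ne_pq e1.symm

/-- Whichever vertex of the triangle is white, the previous lemma applies to it. -/
theorem Solves.not_both_unknown (S : Solves H n C W) (L : Local H n p q o)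
    (X : Propagated H n p q o x) (hn : v < n) (hC : C v) (hx : x v = 0) :
    ¬ (x (p v) = 0 ∧ x (q v) = 0) := by
  rintro ⟨hp, hq⟩
  have hT := X.tri L hn hx
  rcases (S.tri L hn hC hT).1 with ⟨h, -, -⟩ | ⟨-, h, -⟩ | ⟨-, -, h⟩
  · exact S.not_both_unknown_of_white L X (mem_unknownWhite.2 ⟨hn, hC, hx, h⟩) ⟨hp, hq⟩
  · have hpn := L.lt hT.adj_p
    refine S.not_both_unknown_of_white L X
      (mem_unknownWhite.2 ⟨hpn, S.closed hT.adj_p hC, hp, h⟩) ?_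
    rcases hT.mate_p L (X.tri L hpn hp) with ⟨e1, e2⟩ | ⟨e1, e2⟩ <;> simp [e1, e2, hx, hq]
  · have hqn := L.lt hT.adj_q
    refine S.not_both_unknown_of_white L X
      (mem_unknownWhite.2 ⟨hqn, S.closed hT.adj_q hC, hq, h⟩) ?_
    rcases hT.mate_q L (X.tri L hqn hq) with ⟨e1, e2⟩ | ⟨e1, e2⟩ <;> simp [e1, e2, hx, hp]

theorem Solves.flip_p (S : Solves H n C W) (L : Local H n p q o) (X : Propagated H n p q o x)
    (hn : v < n) (hC : C v) (hx : x v = 0) (hp : x (p v) = 0) :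
    x (q v) = 1 ∧ (W (p v) ↔ ¬ W v) := by
  have hT := X.tri L hn hx
  have hq : x (q v) = 1 :=
    X.eq_one_q L hn hx fun h => S.not_both_unknown L X hn hC hx ⟨hp, h⟩
  have hWq := (X.agree C W S _ (L.lt hT.adj_q) (S.closed hT.adj_q hC)).1 hq
  have h1 := (S.tri L hn hC hT).1
  unfold One at h1
  tauto

theorem Solves.flip_q (S : Solves H n C W) (L : Local H n p q o) (X : Propagated H n p q o x)
    (hn : v < n) (hC : C v) (hx : x v = 0) (hq : x (q v) = 0) :
    x (p v) = 1 ∧ (W (q v) ↔ ¬ W v) :=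
  S.flip_p L.swap X.swap hn hC hx hq

end Propagation

/-! ### Two-colouring the unknown vertices and choosing a colour for each piece -/

section Labels

/-- `u` is one of the neighbours `d1 v`, `d2 v`, `d3 v` of `v`. -/
def Link (n : ℕ) (d1 d2 d3 : ℕ → ℕ) (v u : ℕ) : Prop :=
  v < n ∧ u < n ∧ u ≠ v ∧ (u = d1 v ∨ u = d2 v ∨ u = d3 v)

/-- There is a walk from `r` to `v` along `R` whose length has the parity `b`. -/
inductive AltWalk (R : ℕ → ℕ → Prop) (r : ℕ) : ℕ → ℕ → Prop
  | refl : AltWalk R r r 0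
  | step {v u b : ℕ} : AltWalk R r v b → R v u → AltWalk R r u (1 - b)

/-- `lab` labels the connected components of the graph with the neighbours `d1 v`, `d2 v`, `d3 v`,
and `col` is the parity of a walk from the vertex `lab v - 1` to `v`. -/
structure Labelled (n : ℕ) (d1 d2 d3 lab col : ℕ → ℕ) : Prop where
  same : ∀ v < n, lab (d1 v) = lab v ∧ lab (d2 v) = lab v ∧ lab (d3 v) = lab v
  walk : ∀ v < n, ∃ r < n, lab v = r + 1 ∧ AltWalk (Link n d1 d2 d3) r v (col v)

variable {H : SimpleGraph ℕ} {n : ℕ} {p q o x lab col : ℕ → ℕ} {W C : ℕ → Prop} {u v r b : ℕ}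

/-- Unknown vertices are linked to their unknown outer neighbours and mates. -/
abbrev UnknownLabelled (n : ℕ) (p q o x lab col : ℕ → ℕ) : Prop :=
  Labelled n (fun v => if x v = 0 then o v else v)
    (fun v => if x v = 0 ∧ x (p v) = 0 then p v else v)
    (fun v => if x v = 0 ∧ x (q v) = 0 then q v else v) lab col

/-- Every link joins two adjacent unknown vertices, exactly one of which is white. So the parity of
a walk decides whether its ends agree in W. -/
theorem Solves.walk (S : Solves H n C W) (L : Local H n p q o) (X : Propagated H n p q o x)
    (h : AltWalk (Link n (fun v => if x v = 0 then o v else v)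
      (fun v => if x v = 0 ∧ x (p v) = 0 then p v else v)
      (fun v => if x v = 0 ∧ x (q v) = 0 then q v else v)) r v b) :
    (C v ↔ C r) ∧ (x v = 0 ↔ x r = 0) ∧ (C r → x r = 0 → (W v ↔ (W r ↔ b = 0))) := by
  induction h with
  | refl => simp
  | @step v u b _ hR ih =>
    obtain ⟨hv, hu, hne, hR⟩ := hR
    obtain ⟨ih1, ih2, ih3⟩ := ih
    have key : x v = 0 ∧ x u = 0 ∧ H.Adj v u ∧ (C v → (W u ↔ ¬ W v)) := by
      rcases hR with h | h | h <;> simp only at h <;> split_ifs at h with hx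
      · have hT := X.tri L hv hx
        subst h
        exact ⟨hx, X.outer L hv hx, hT.adj_o, fun hC => (S.tri L hv hC hT).2⟩
      · exact absurd h hne
      · have hT := X.tri L hv hx.1
        subst h
        exact ⟨hx.1, hx.2, hT.adj_p, fun hC => (S.flip_p L X hv hC hx.1 hx.2).2⟩
      · exact absurd h hne
      · have hT := X.tri L hv hx.1
        subst h
        exact ⟨hx.1, hx.2, hT.adj_q, fun hC => (S.flip_q L X hv hC hx.1 hx.2).2⟩
      · exact absurd h hne
    obtain ⟨h1, h2, h3, h4⟩ := key
    have hC : C u ↔ C v := ⟨S.closed h3.symm, S.closed h3⟩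
    refine ⟨hC.trans ih1, by simp [← ih2, h1, h2], fun hr hxr => ?_⟩
    rw [h4 (ih1.2 hr), ih3 hr hxr]
    have : 1 - b = 0 ↔ ¬ b = 0 := by omega
    rw [this]
    tauto

theorem valid_congr {W' : ℕ → Prop} (h : ∀ u, u = v ∨ H.Adj v u → (W u ↔ W' u)) :
    Valid H W v ↔ Valid H W' v := by
  have h1 : ∀ u, H.Adj v u ∧ ¬ W u ↔ H.Adj v u ∧ ¬ W' u := fun u =>
    and_congr_right fun hu => by rw [h u (.inr hu)]
  have h2 : (∀ u, H.Adj v u → ¬ W u) ↔ ∀ u, H.Adj v u → ¬ W' u :=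
    forall_congr' fun u => forall_congr' fun hu => by rw [h u (.inr hu)]
  simp only [Valid, h1, h2, h v (.inl rfl)]

/-- The vertices chosen by the marks, the colours, and a bit `f` for each label. -/
def Chosen (x lab col : ℕ → ℕ) (f : ℕ → Prop) (v : ℕ) : Prop :=
  x v = 2 ∨ (x v = 0 ∧ (col v = 0 ↔ f (lab v)))

theorem Solves.chosen_of_marked (S : Solves H n C W) (X : Propagated H n p q o x) {f : ℕ → Prop}
    (hn : v < n) (hC : C v) (hx : x v ≠ 0) : Chosen x lab col f v ↔ W v := by
  have h1 := X.le v hn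
  have h2 := X.agree C W S v hn hC
  have h3 : x v = 1 ∨ x v = 2 := by omega
  rcases h3 with h3 | h3
  · simp [Chosen, h3, h2.1 h3]
  · simp [Chosen, h3, h2.2 h3]

/-- The solution W only serves to show that u and v have different colours, by comparing both with
the common root. The chosen set then separates them whatever the bit of their label is. -/
theorem Solves.chosen_flip (S : Solves H n C W) (L : Local H n p q o) (X : Propagated H n p q o x)
    (hl : UnknownLabelled n p q o x lab col) {f : ℕ → Prop} (hv : v < n) (hu : u < n) (hCv : C v)
    (hxv : x v = 0) (hxu : x u = 0) (hlab : lab u = lab v) (hW : W u ↔ ¬ W v) :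
    Chosen x lab col f u ↔ ¬ Chosen x lab col f v := by
  obtain ⟨r, hr, hlr, hw⟩ := hl.walk v hv
  obtain ⟨r', hr', hlr', hw'⟩ := hl.walk u hu
  obtain rfl : r = r' := by omega
  obtain ⟨h1, h2, h3⟩ := S.walk L X hw
  obtain ⟨h1', h2', h3'⟩ := S.walk L X hw'
  have e := h3 (h1.1 hCv) (h2.1 hxv)
  have e' := h3' (h1.1 hCv) (h2.1 hxv)
  simp only [Chosen, hxv, hxu, hlab]
  grind

/-- One solution makes every choice of bits a solution. A triangle with an unknown vertex has two,
linked to each other, and a third vertex marked 1; fully marked triangles, and the neighbourhoods of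
`Mid` vertices, are treated as in W. -/
theorem Solves.chosen (S : Solves H n C W) (L : Local H n p q o) (X : Propagated H n p q o x)
    (hl : UnknownLabelled n p q o x lab col) (f : ℕ → Prop) :
    Solves H n C (Chosen x lab col f) := by
  refine ⟨S.closed, fun v hv hC => ?_⟩
  have hmark : ∀ u, u < n → C u → x u ≠ 0 → (Chosen x lab col f u ↔ W u) :=
    fun u hu hCu hx => S.chosen_of_marked X hu hCu hx
  have hflip_p : ∀ u, u < n → C u → x u = 0 → x (p u) = 0 →
      (Chosen x lab col f (p u) ↔ ¬ Chosen x lab col f u) := by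
    intro u hu hCu hx hp
    have hT := X.tri L hu hx
    have := (hl.same u hu).2.1
    rw [if_pos ⟨hx, hp⟩] at this
    exact S.chosen_flip L X hl hu (L.lt hT.adj_p) hCu hx hp this
      (S.flip_p L X hu hCu hx hp).2
  have hflip_q : ∀ u, u < n → C u → x u = 0 → x (q u) = 0 →
      (Chosen x lab col f (q u) ↔ ¬ Chosen x lab col f u) := by
    intro u hu hCu hx hq
    have hT := X.tri L hu hx
    have := (hl.same u hu).2.2
    rw [if_pos ⟨hx, hq⟩] at this
    exact S.chosen_flip L X hl hu (L.lt hT.adj_q) hCu hx hq this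
      (S.flip_q L X hu hCu hx hq).2
  rcases L.shape v hv with hT | hM
  · have hCp := S.closed hT.adj_p hC
    have hCq := S.closed hT.adj_q hC
    have hCo := S.closed hT.adj_o hC
    have hpn := L.lt hT.adj_p
    have hqn := L.lt hT.adj_q
    have hon := L.lt hT.adj_o
    obtain ⟨hone, hW⟩ := S.tri L hv hC hT
    refine hT.valid_of ?_ ?_
    · by_cases hx : x v = 0
      · by_cases hp : x (p v) = 0
        · have hq := (S.flip_p L X hv hC hx hp).1
          have h1 := hflip_p v hv hC hx hp
          have h2 := hmark _ hqn hCq (by omega)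
          have h3 := (X.agree C W S _ hqn hCq).1 hq
          unfold One
          tauto
        · have hp := X.eq_one_p L hv hx hp
          have hq : x (q v) = 0 := (X.mate_unknown L hv hx).resolve_left (by omega)
          have h1 := hflip_q v hv hC hx hq
          have h2 := hmark _ hpn hCp (by omega)
          have h3 := (X.agree C W S _ hpn hCp).1 hp
          unfold One
          tauto
      -- Here v is marked, so the triangle is viewed from `p v`: its unknown mate must be `q v`, and
      -- the mark of v is 1.
      · by_cases hp : x (p v) = 0
        · have hTp := X.tri L hpn hp
          have h0 := X.mate_unknown L hpn hp
          rcases hT.mate_p L hTp with ⟨e1, e2⟩ | ⟨e1, e2⟩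
          · rw [e1, e2] at h0
            have hq := h0.resolve_left hx
            have h1 := hflip_q _ hpn hCp hp (by rw [e2]; exact hq)
            have h2 := hmark _ hv hC hx
            have h3 := X.eq_one_p L hpn hp (by rw [e1]; exact hx)
            rw [e1] at h3
            have h4 := (X.agree C W S _ hv hC).1 h3
            rw [e2] at h1
            unfold One
            tauto
          · rw [e1, e2] at h0
            have hq := h0.resolve_right hx
            have h1 := hflip_p _ hpn hCp hp (by rw [e2]; exact hq)
            have h2 := hmark _ hv hC hx
            have h3 := X.eq_one_q L hpn hp (by rw [e1]; exact hx)
            rw [e1] at h3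
            have h4 := (X.agree C W S _ hv hC).1 h3
            rw [e2] at h1
            unfold One
            tauto
        · have hq : x (q v) ≠ 0 := by
            intro hq
            have hTq := X.tri L hqn hq
            have h0 := X.mate_unknown L hqn hq
            rcases hT.mate_q L hTq with ⟨e1, e2⟩ | ⟨e1, e2⟩ <;> rw [e1, e2] at h0 <;> tauto
          have h1 := hmark _ hv hC hx
          have h2 := hmark _ hpn hCp hp
          have h3 := hmark _ hqn hCq hq
          unfold One at hone ⊢
          rwa [h1, h2, h3]
    · by_cases hx : x v = 0
      · have := (hl.same v hv).1
        rw [if_pos hx] at this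
        exact S.chosen_flip L X hl hv hon hC hx (X.outer L hv hx) this hW
      · rw [hmark _ hv hC hx, hmark _ hon hCo (X.out v hv hT hx)]
        exact hW
  · rw [valid_congr (W' := W)]
    · exact S.valid v hv hC
    · rintro u (rfl | hu)
      · exact hmark u hv hC (by rw [X.mid u hv hM]; exact one_ne_zero)
      · exact hmark u (L.lt hu) (S.closed hu hC) (X.marked_of_mid L hM hu)

open Classical in
/-- The total weight of `v < n` in both `C` and `W`. -/
noncomputable def total (n : ℕ) (g : ℕ → ℝ) (C W : ℕ → Prop) : ℝ :=
  ∑ v ∈ Finset.range n, if C v ∧ W v then g v else 0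

/-- How much the unknown vertices of colour `0` and label `k` outweigh those of other colours. -/
noncomputable def diff (n : ℕ) (g : ℕ → ℝ) (x lab col : ℕ → ℕ) (k : ℕ) : ℝ :=
  ∑ v ∈ Finset.range n, if lab v = k then
    (if x v = 0 then (if col v = 0 then g v else - g v) else 0) else 0

/-- Vertices are grouped by label. All vertices of a group agree with its root on membership in C
and on being unknown, and in an unknown group inside C the set W is one of the two colour classes.
The gain over W is then 0 or the absolute value of `diff`. -/
theorem Solves.total_le (S : Solves H n C W) (L : Local H n p q o) (X : Propagated H n p q o x)
    (hl : UnknownLabelled n p q o x lab col) (g : ℕ → ℝ) :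
    total n g C W ≤ total n g C (Chosen x lab col fun k => 0 ≤ diff n g x lab col k) := by
  classical
  set f : ℕ → Prop := fun k => 0 ≤ diff n g x lab col k with hf
  rw [← sub_nonneg, total, total, ← Finset.sum_sub_distrib,
    ← Finset.sum_fiberwise_of_maps_to (t := (Finset.range n).image lab) (g := lab)
      (fun v hv => Finset.mem_image_of_mem _ hv)]
  refine Finset.sum_nonneg fun k hk => ?_
  obtain ⟨v₀, hv₀, rfl⟩ := Finset.mem_image.1 hk
  obtain ⟨r, hr, hlr, -⟩ := hl.walk v₀ (Finset.mem_range.1 hv₀)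
  have hw : ∀ v < n, lab v = lab v₀ → (C v ↔ C r) ∧ (x v = 0 ↔ x r = 0) ∧
      (C r → x r = 0 → (W v ↔ (W r ↔ col v = 0))) := by
    intro v hv hlv
    obtain ⟨r', hr', hlr', hw'⟩ := hl.walk v hv
    obtain rfl : r = r' := by omega
    exact S.walk L X hw'
  by_cases hr' : C r ∧ x r = 0
  -- The factor `σ` is 0 if W already has the chosen colour, and otherwise 1 or -1 according to
  -- which colour is chosen.
  · have hd : ∀ σ : ℝ, (∀ v < n, lab v = lab v₀ →
        ((if C v ∧ Chosen x lab col f v then g v else 0) - if C v ∧ W v then g v else 0) =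
          σ * (if x v = 0 then (if col v = 0 then g v else - g v) else 0)) →
        ∑ v ∈ Finset.range n with lab v = lab v₀,
          ((if C v ∧ Chosen x lab col f v then g v else 0) - if C v ∧ W v then g v else 0) =
        σ * diff n g x lab col (lab v₀) := by
      intro σ h
      rw [diff, ← Finset.sum_filter, Finset.mul_sum]
      refine Finset.sum_congr rfl fun v hv => ?_
      rw [Finset.mem_filter, Finset.mem_range] at hv
      exact h v hv.1 hv.2
    by_cases hfk : f (lab v₀) <;> by_cases hWr : W r
    · rw [hd 0, zero_mul]
      intro v hv hlv
      obtain ⟨h1, h2, h3⟩ := hw v hv hlv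
      have h3 := h3 hr'.1 hr'.2
      have hx := h2.2 hr'.2
      simp [h1, hr'.1, h3, hWr, Chosen, hx, hlv, hfk]
    · rw [hd 1, one_mul]
      · exact hfk
      intro v hv hlv
      obtain ⟨h1, h2, h3⟩ := hw v hv hlv
      have h3 := h3 hr'.1 hr'.2
      have hx := h2.2 hr'.2
      by_cases hc : col v = 0 <;> simp [h1, hr'.1, h3, hWr, Chosen, hx, hlv, hfk, hc]
    · rw [hd (-1)]
      · simp only [hf, not_le] at hfk
        linarith
      intro v hv hlv
      obtain ⟨h1, h2, h3⟩ := hw v hv hlv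
      have h3 := h3 hr'.1 hr'.2
      have hx := h2.2 hr'.2
      by_cases hc : col v = 0 <;> simp [h1, hr'.1, h3, hWr, Chosen, hx, hlv, hfk, hc]
    · rw [hd 0, zero_mul]
      intro v hv hlv
      obtain ⟨h1, h2, h3⟩ := hw v hv hlv
      have h3 := h3 hr'.1 hr'.2
      have hx := h2.2 hr'.2
      by_cases hc : col v = 0 <;> simp [h1, hr'.1, h3, hWr, Chosen, hx, hlv, hfk, hc]
  · refine (Finset.sum_eq_zero fun v hv => ?_).ge
    rw [Finset.mem_filter, Finset.mem_range] at hv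
    obtain ⟨h1, h2, h3⟩ := hw v hv.1 hv.2
    by_cases hC : C v
    · have hx : x v ≠ 0 := fun h => hr' ⟨h1.1 hC, h2.1 h⟩
      simp only [S.chosen_of_marked X hv.1 hC hx, sub_self]
    · simp [hC]

end Labels

end EdgeDom

namespace EdgeDom

/-! ### Unit propagation in linear time -/

section PropagationLoop

/-- The number of zeros of `x` below `n`. -/
def zeros (n : ℕ) (x : ℕ → ℕ) : ℕ := ((Finset.range n).filter fun v => x v = 0).card

theorem zeros_le (n : ℕ) (x : ℕ → ℕ) : zeros n x ≤ n := by
  simpa [zeros] using (Finset.card_filter_le (Finset.range n) fun v => x v = 0)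

theorem zeros_lt {n : ℕ} {x y : ℕ → ℕ} (h : ∀ v, y v = 0 → x v = 0) {v : ℕ} (hv : v < n)
    (hx : x v = 0) (hy : y v ≠ 0) : zeros n y < zeros n x := by
  refine Finset.card_lt_card ⟨fun u hu => ?_, fun hs => hy ?_⟩
  · simp only [Finset.mem_filter] at hu ⊢
    exact ⟨hu.1, h u hu.2⟩
  · exact (Finset.mem_filter.1 (hs (Finset.mem_filter.2 ⟨Finset.mem_range.2 hv, hx⟩))).2

variable {H : SimpleGraph ℕ} {n : ℕ} {p q o x : ℕ → ℕ} {i c : ℕ}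

/-- The invariant of the propagation loop: only `c` and vertices greater than `i` may still allow
a propagation step. -/
structure Propagating (H : SimpleGraph ℕ) (n : ℕ) (p q o x : ℕ → ℕ) (i c : ℕ) : Prop where
  agree : ∀ C W, Solves H n C W → ∀ v < n, C v → (x v = 1 → ¬ W v) ∧ (x v = 2 → W v)
  out : ∀ v < n, Tri H p q o v → x v ≠ 0 → x (o v) ≠ 0
  mates : ∀ v < n, Tri H p q o v → x v = 2 → x (p v) = 1 ∧ x (q v) = 1
  mid : ∀ v < n, Mid H v → x v = 1
  le : ∀ v < n, x v ≤ 2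
  test : ∀ v < n, x v = 0 → x (p v) = 1 → x (q v) = 1 → i < v ∨ v = c
  range : (i < n ∧ c < n) ∨ (i = n ∧ c = n)

theorem Propagating.start (L : Local H n p q o)
    (hx : ∀ v < n, (x v = 0 ∧ Tri H p q o v) ∨ (x v = 1 ∧ Mid H v)) :
    Propagating H n p q o x 0 0 where
  agree C W S v hv hC := by
    rcases hx v hv with ⟨h, -⟩ | ⟨h, hM⟩
    · simp [h]
    · refine ⟨fun _ => hM.not_white ?_, by simp [h]⟩
      rintro u (rfl | hu)
      exacts [S.valid u hv hC, S.valid u (L.lt hu) (S.closed hu hC)]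
  out v hv hT h := by
    rcases hx v hv with ⟨h', -⟩ | ⟨-, hM⟩
    exacts [absurd h' h, absurd hM hT.not_mid]
  mates v hv hT h := by
    rcases hx v hv with ⟨h', -⟩ | ⟨-, hM⟩
    exacts [by omega, absurd hM hT.not_mid]
  mid v hv hM := by
    rcases hx v hv with ⟨-, hT⟩ | ⟨h, -⟩
    exacts [absurd hM hT.not_mid, h]
  le v hv := by
    rcases hx v hv with ⟨h, -⟩ | ⟨h, -⟩ <;> omega
  test v hv _ _ _ := by omega
  range := by omega

/-- The chain of forced steps ends at c, where the test fails, so the scan resumes with the next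
vertex. -/
theorem Propagating.next (h : Propagating H n p q o x i c) (hi : i < n)
    (hc : ¬ (x c = 0 ∧ x (p c) = 1 ∧ x (q c) = 1)) :
    Propagating H n p q o x (i + 1) (i + 1) where
  agree := h.agree
  out := h.out
  mates := h.mates
  mid := h.mid
  le := h.le
  test v hv h1 h2 h3 := by
    rcases h.test v hv h1 h2 h3 with h4 | rfl
    · omega
    · exact absurd ⟨h1, h2, h3⟩ hc
  range := by omega

/-- The only possible new mark 1 is at `o c`, so only a mate of `o c` can newly pass the test, and
only if the other mate is marked 1. There is a single candidate to look at next, and no queue is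
needed. -/
theorem Propagating.white (L : Local H n p q o) (h : Propagating H n p q o x i c) (hi : i < n)
    (hc : x c = 0 ∧ x (p c) = 1 ∧ x (q c) = 1) {y : ℕ → ℕ}
    (hy : ∀ v, y v = if v = c then 2 else if v = o c ∧ x v = 0 then 1 else x v) :
    Propagating H n p q o y i (if y (p (o c)) = 1 then q (o c) else p (o c)) := by
  obtain ⟨hc0, hcp, hcq⟩ := hc
  have hcn : c < n := by have := h.range; omega
  have hT : Tri H p q o c := (L.shape c hcn).resolve_right fun hM => by
    simp [h.mid c hcn hM] at hc0
  obtain ⟨hTo, hoo⟩ := hT.outer L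
  have hno := hT.adj_o.ne
  have yc : y c = 2 := by simp [hy]
  have yo : y (o c) ≠ 0 := by
    rw [hy, if_neg hno.symm]
    split_ifs with h1
    · exact one_ne_zero
    · exact fun h2 => h1 ⟨rfl, h2⟩
  have ykeep : ∀ v, x v ≠ 0 → y v = x v := fun v hv => by
    rw [hy, if_neg (by rintro rfl; exact hv hc0), if_neg fun h => hv h.2]
  have hcase : ∀ v, v ≠ c → y v = x v ∨ (v = o c ∧ x v = 0 ∧ y v = 1) := fun v hv => by
    rw [hy, if_neg hv]
    split_ifs with h1
    · exact .inr ⟨h1.1, h1.2, rfl⟩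
    · exact .inl rfl
  refine ⟨?_, ?_, ?_, ?_, ?_, ?_, ?_⟩
  · intro C W S v hv hC
    -- Neither mate of c is white, so c is the white vertex of its triangle and the other end of its
    -- outer edge is not white.
    have hwhite : C c → W c ∧ ¬ W (o c) := fun hCc => by
      obtain ⟨h1, h2⟩ := S.tri L hcn hCc hT
      have h3 := (h.agree C W S _ (L.lt hT.adj_p) (S.closed hT.adj_p hCc)).1 hcp
      have h4 := (h.agree C W S _ (L.lt hT.adj_q) (S.closed hT.adj_q hCc)).1 hcq
      unfold One at h1
      tauto
    by_cases hvc : v = c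
    · subst hvc
      simp [yc, (hwhite hC).1]
    · rcases hcase v hvc with e | ⟨rfl, -, e⟩
      · rw [e]
        exact h.agree C W S v hv hC
      · simp [e, (hwhite (S.closed hT.adj_o.symm hC)).2]
  · intro v hv hTv hyv
    by_cases hvc : v = c
    · subst hvc
      exact yo
    · rcases hcase v hvc with e | ⟨rfl, -, e⟩
      · rw [e] at hyv
        have := h.out v hv hTv hyv
        rwa [ykeep _ this]
      · rw [hoo, yc]
        exact two_ne_zero
  · intro v hv hTv hyv
    by_cases hvc : v = c
    · subst hvc
      rw [ykeep _ (by omega), ykeep _ (by omega)]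
      exact ⟨hcp, hcq⟩
    · rcases hcase v hvc with e | ⟨rfl, -, e⟩
      · rw [e] at hyv
        obtain ⟨h1, h2⟩ := h.mates v hv hTv hyv
        rw [ykeep _ (by omega), ykeep _ (by omega)]
        exact ⟨h1, h2⟩
      · omega
  · intro v hv hM
    have := h.mid v hv hM
    rw [ykeep _ (by omega), this]
  · intro v hv
    have := h.le v hv
    rw [hy]
    split_ifs <;> omega
  · intro v hv h0 h1 h2
    have hvc : v ≠ c := by
      rintro rfl
      omega
    have hx0 : x v = 0 := by
      by_contra hx
      rw [ykeep v hx] at h0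
      exact hx h0
    have hTv : Tri H p q o v := (L.shape v hv).resolve_right fun hM => by
      simp [h.mid v hv hM] at hx0
    have hmate : ∀ w, y w = 1 → x w = 1 ∨ w = o c := fun w hw => by
      have hwc : w ≠ c := by
        rintro rfl
        omega
      rcases hcase w hwc with e | e
      · exact .inl (e ▸ hw)
      · exact .inr e.1
    -- Then v is a mate of `o c` whose other mate is `q v`, marked 1, so v is the selected
    -- candidate.
    by_cases hp : p v = o c
    · right
      rcases hTv.mate_p L (hp ▸ hTo) with ⟨e1, e2⟩ | ⟨e1, e2⟩ <;> rw [hp] at e1 e2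
      · rw [e1, if_neg (by omega)]
      · rw [e2, if_pos h2, e1]
    · by_cases hq : q v = o c
      · right
        rcases hTv.mate_q L (hq ▸ hTo) with ⟨e1, e2⟩ | ⟨e1, e2⟩ <;> rw [hq] at e1 e2
        · rw [e1, if_neg (by omega)]
        · rw [e2, if_pos h1, e1]
      · rcases h.test v hv hx0 ((hmate _ h1).resolve_right hp) ((hmate _ h2).resolve_right hq)
          with h3 | h3
        · exact .inl h3
        · exact absurd h3 hvc
  · left
    refine ⟨hi, ?_⟩
    split_ifs
    exacts [L.lt hTo.adj_q, L.lt hTo.adj_p]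

theorem Propagating.propagated (h : Propagating H n p q o x i c) (hi : ¬ i < n) :
    Propagated H n p q o x :=
  ⟨h.agree, h.out, h.mates, h.mid, h.le, fun v hv h1 h2 h3 => by
    have := h.test v hv h1 h2 h3
    have := h.range
    omega⟩

/-- Whether the vertex in variable `3` is unknown and both of its mates are marked `1`. -/
def propTest : Guard :=
  .and (.eqN (.get 10 (.var 3)) (.const 0)) (.and (.eqN (.get 10 (.get 7 (.var 3))) (.const 1))
    (.eqN (.get 10 (.get 8 (.var 3))) (.const 1)))

/-- A propagation step at the vertex in variable `3`. -/
def propWhite : Prog :=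
  .seq (.nput 10 (.var 3) (.const 2)) (.seq (.nset 4 (.get 9 (.var 3)))
    (.seq (.ite (.eqN (.get 10 (.var 4)) (.const 0)) (.nput 10 (.var 4) (.const 1)) .skip)
      (.ite (.eqN (.get 10 (.get 7 (.var 4))) (.const 1)) (.nset 3 (.get 8 (.var 4)))
        (.nset 3 (.get 7 (.var 4))))))

def propBody : Prog :=
  .ite propTest propWhite (.seq (.nset 2 (.succ (.var 2))) (.nset 3 (.var 2)))

def propLoop : Prog :=
  .seq (.seq (.nset 2 (.const 0)) (.nset 3 (.const 0)))
    (.loop (.ltN (.var 2) (.var 0)) propBody)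

/-- The constant in the running time of `propLoop`. -/
def propCost : ℕ :=
  (Prog.seq (.nset 2 (.const 0)) (.nset 3 (.const 0))).bound +
    (propBody.bound + (Guard.ltN (.var 2) (.var 0)).cost + 1) * (2 + 1)

/-- The hypothesis keeps the write at the outer neighbour from hitting the vertex just marked 2. -/
theorem propWhite_run {s : Mem} (h : s.narr 9 (s.nvar 3) ≠ s.nvar 3) :
    (∀ v, (propWhite.run s).narr 10 v = if v = s.nvar 3 then 2 else
      if v = s.narr 9 (s.nvar 3) ∧ s.narr 10 v = 0 then 1 else s.narr 10 v) ∧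
    (propWhite.run s).nvar 3 =
      if (propWhite.run s).narr 10 (s.narr 7 (s.narr 9 (s.nvar 3))) = 1
        then s.narr 8 (s.narr 9 (s.nvar 3)) else s.narr 7 (s.narr 9 (s.nvar 3)) := by
  have h' := h.symm
  constructor
  · intro v
    simp only [propWhite, Prog.run, NExp.eval, Guard.Holds, Mem.putN_nvar, Mem.putN_narr,
      Mem.setN_nvar, Mem.setN_narr]
    split_ifs <;>
      simp_all [Mem.putN_nvar, Mem.putN_narr, Mem.setN_nvar, Mem.setN_narr] <;> grind
  · simp only [propWhite, Prog.run, NExp.eval, Guard.Holds, Mem.putN_nvar, Mem.putN_narr,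
      Mem.setN_nvar, Mem.setN_narr]
    split_ifs <;>
      simp_all [Mem.putN_nvar, Mem.putN_narr, Mem.setN_nvar, Mem.setN_narr]

theorem propLoop_reaches {s : Mem} (hn : s.nvar 0 = n)
    (L : Local H n (s.narr 7) (s.narr 8) (s.narr 9))
    (hx : ∀ v < n, (s.narr 10 v = 0 ∧ Tri H (s.narr 7) (s.narr 8) (s.narr 9) v) ∨
      (s.narr 10 v = 1 ∧ Mid H v)) :
    Reaches propLoop propCost n s fun s' =>
      Propagated H n (s.narr 7) (s.narr 8) (s.narr 9) (s'.narr 10) := by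
  have hS : propBody.Straight := by simp [propBody, propWhite, Prog.Straight]
  refine Reaches.seq (Q := fun s' => s' = (s.setN 2 0).setN 3 0)
    (Reaches.run (by simp [Prog.Straight]) rfl) ?_
  rintro _ - rfl
  refine (Reaches.loop hS (fun s' => s'.nvar 0 = n ∧ s'.narr 7 = s.narr 7 ∧
    s'.narr 8 = s.narr 8 ∧ s'.narr 9 = s.narr 9 ∧
    Propagating H n (s.narr 7) (s.narr 8) (s.narr 9) (s'.narr 10) (s'.nvar 2) (s'.nvar 3))
    -- Each round advances the scan or marks an unknown vertex, so there are at most 2n rounds.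
    (fun s' => (n - s'.nvar 2) + zeros n (s'.narr 10)) ?_ ?_ ?_).mono ?_
  · rintro s' ⟨h0, h7, h8, h9, hP⟩ hb
    simp only [Guard.Holds, NExp.eval, h0] at hb
    have hF := Prog.frame_run hS s'
    have e0 : (propBody.run s').nvar 0 = n := (hF.nvar 0 (by decide)).trans h0
    have e7 : (propBody.run s').narr 7 = s.narr 7 := (hF.narr 7 (by decide)).trans h7
    have e8 : (propBody.run s').narr 8 = s.narr 8 := (hF.narr 8 (by decide)).trans h8
    have e9 : (propBody.run s').narr 9 = s.narr 9 := (hF.narr 9 (by decide)).trans h9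
    by_cases ht : propTest.Holds s'
    · have er : propBody.run s' = propWhite.run s' := by simp only [propBody, Prog.run, if_pos ht]
      have ht' : s'.narr 10 (s'.nvar 3) = 0 ∧ s'.narr 10 (s.narr 7 (s'.nvar 3)) = 1 ∧
          s'.narr 10 (s.narr 8 (s'.nvar 3)) = 1 := by
        simpa [propTest, Guard.Holds, NExp.eval, h7, h8] using ht
      have hc : s'.nvar 3 < n := by have := hP.range; omega
      have hT : Tri H (s.narr 7) (s.narr 8) (s.narr 9) (s'.nvar 3) :=
        (L.shape _ hc).resolve_right fun hM => by
          have := hP.mid _ hc hM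
          omega
      obtain ⟨r1, r2⟩ := propWhite_run (s := s') (by rw [h9]; exact hT.adj_o.ne')
      have e2 : (propBody.run s').nvar 2 = s'.nvar 2 := by
        rw [er]
        exact (Prog.frame_run (A := propWhite) (by simp [propWhite, Prog.Straight]) s').nvar 2
          (by decide)
      rw [h9] at r1
      rw [h7, h8, h9] at r2
      have hP' := hP.white L hb ht' r1
      rw [← r2] at hP'
      refine ⟨⟨e0, e7, e8, e9, ?_⟩, ?_⟩
      · rw [e2, er]
        exact hP'
      · rw [e2, er]
        refine Nat.add_lt_add_left (zeros_lt (fun v hv => ?_) hc ht'.1 ?_) _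
        · rw [r1] at hv
          split_ifs at hv
          exact hv
        · rw [r1, if_pos rfl]
          exact two_ne_zero
    · have er : propBody.run s' =
          (s'.setN 2 (s'.nvar 2 + 1)).setN 3 (s'.nvar 2 + 1) := by
        simp [propBody, Prog.run, if_neg ht, NExp.eval, Mem.setN_nvar]
      have ht' : ¬ (s'.narr 10 (s'.nvar 3) = 0 ∧ s'.narr 10 (s.narr 7 (s'.nvar 3)) = 1 ∧
          s'.narr 10 (s.narr 8 (s'.nvar 3)) = 1) := by
        simpa [propTest, Guard.Holds, NExp.eval, h7, h8] using ht
      have hP' := hP.next hb ht'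
      refine ⟨⟨e0, e7, e8, e9, ?_⟩, ?_⟩
      · simpa [er, Mem.setN_nvar, Mem.setN_narr] using hP'
      · simp only [er, Mem.setN_nvar, Mem.setN_narr]
        simp
        omega
  · refine ⟨by simpa [Mem.setN_nvar] using hn, rfl, rfl, rfl, ?_⟩
    simpa [Mem.setN_nvar, Mem.setN_narr] using Propagating.start L hx
  · have := zeros_le n (((s.setN 2 0).setN 3 0).narr 10)
    omega
  · rintro s' ⟨⟨h0, -, -, -, hP⟩, hb⟩
    simp only [Guard.Holds, NExp.eval, h0] at hb
    exact hP.propagated hb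

end PropagationLoop

end EdgeDom

namespace EdgeDom

/-! ### Components and parities by depth-first search -/

section Search

variable {n : ℕ} {d1 d2 d3 lab col stk : ℕ → ℕ} {i sp : ℕ} {E : ℕ → Prop}

/-- The invariant of a depth-first search with the stack `stk 0`, ..., `stk (sp - 1)`, which
numbers the components: the component of `i` is being explored, and the labelled vertices, except
those in `E` or on the stack, have all their neighbours labelled. -/
structure Searching (n : ℕ) (d1 d2 d3 lab col stk : ℕ → ℕ) (i sp : ℕ) (E : ℕ → Prop) : Prop where
  le : i ≤ n
  walk : ∀ v < n, lab v ≠ 0 → ∃ r < n, lab v = r + 1 ∧ AltWalk (Link n d1 d2 d3) r v (col v)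
  stack : ∀ j < sp, stk j < n ∧ lab (stk j) = i + 1
  closed : ∀ w < n, lab w ≠ 0 → (∃ j < sp, stk j = w) ∨ E w ∨
    ∀ u, Link n d1 d2 d3 w u → lab u = lab w
  past : ∀ w < i, lab w ≠ 0

/-- The vertex v has left the stack while its neighbours are still being visited, which is why it is
exempt from the closure condition. -/
theorem Searching.push {v u : ℕ} {lab' col' stk' : ℕ → ℕ}
    (h : Searching n d1 d2 d3 lab col stk i sp (· = v)) (hv : v < n) (hlv : lab v = i + 1)
    (hL : Link n d1 d2 d3 v u) (hu : lab u = 0)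
    (hlab : ∀ w, lab' w = if w = u then lab v else lab w)
    (hcol : ∀ w, col' w = if w = u then 1 - col v else col w)
    (hstk : ∀ w, stk' w = if w = sp then u else stk w) :
    Searching n d1 d2 d3 lab' col' stk' i (sp + 1) (· = v) := by
  have keep : ∀ w, lab w ≠ 0 → lab' w = lab w := fun w hw => by
    rw [hlab, if_neg (by rintro rfl; exact hw hu)]
  refine ⟨h.le, fun w hw hlw => ?_, fun j hj => ?_, fun w hw hlw => ?_, fun w hw => ?_⟩
  · rw [hlab, hcol]
    rw [hlab] at hlw
    split_ifs at hlw ⊢ with h1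
    · subst h1
      obtain ⟨r, hr, e, hwalk⟩ := h.walk v hv (by omega)
      exact ⟨r, hr, e, hwalk.step hL⟩
    · exact h.walk w hw hlw
  · rw [hstk]
    split_ifs with h1
    · exact ⟨hL.2.1, by rw [hlab, if_pos rfl, hlv]⟩
    · have := h.stack j (by omega)
      exact ⟨this.1, by rw [keep _ (by omega), this.2]⟩
  · by_cases hwu : w = u
    · exact .inl ⟨sp, by omega, by rw [hstk, if_pos rfl, hwu]⟩
    · rw [hlab, if_neg hwu] at hlw ⊢
      rcases h.closed w hw hlw with ⟨j, hj, e⟩ | e | e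
      · exact .inl ⟨j, by omega, by rw [hstk, if_neg (by omega), e]⟩
      · exact .inr (.inl e)
      · refine .inr (.inr fun z hz => ?_)
        rw [keep z (by rw [e z hz]; exact hlw), e z hz]
  · have := h.past w hw
    rwa [keep w this]

/-- A labelled neighbour of v is on the stack, or is v, or is finished; a finished vertex shares its
label with all its neighbours, so by symmetry of the links with v. -/
theorem Searching.seen {v u : ℕ} (hsymm : ∀ v u, Link n d1 d2 d3 v u → Link n d1 d2 d3 u v)
    (h : Searching n d1 d2 d3 lab col stk i sp (· = v)) (hlv : lab v = i + 1)
    (hL : Link n d1 d2 d3 v u) (hu : lab u ≠ 0) : lab u = lab v := by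
  rcases h.closed u hL.2.1 hu with ⟨j, hj, e⟩ | e | e
  · rw [hlv, ← (h.stack j hj).2, e]
  · rw [e]
  · exact (e v (hsymm v u hL)).symm

theorem Searching.pop (h : Searching n d1 d2 d3 lab col stk i (sp + 1) (fun _ => False)) :
    Searching n d1 d2 d3 lab col stk i sp (· = stk sp) := by
  refine ⟨h.le, h.walk, fun j hj => h.stack j (by omega), fun w hw hlw => ?_, h.past⟩
  rcases h.closed w hw hlw with ⟨j, hj, e⟩ | e | e
  · by_cases hjs : j = sp
    · exact .inr (.inl (by rw [← e, hjs]))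
    · exact .inl ⟨j, by omega, e⟩
  · exact e.elim
  · exact .inr (.inr e)

theorem Searching.done {v : ℕ} (h : Searching n d1 d2 d3 lab col stk i sp (· = v))
    (hv : ∀ u, Link n d1 d2 d3 v u → lab u = lab v) :
    Searching n d1 d2 d3 lab col stk i sp (fun _ => False) := by
  refine ⟨h.le, h.walk, h.stack, fun w hw hlw => ?_, h.past⟩
  rcases h.closed w hw hlw with e | e | e
  · exact .inl e
  · subst e
    exact .inr (.inr hv)
  · exact .inr (.inr e)

theorem Searching.next (h : Searching n d1 d2 d3 lab col stk i 0 (fun _ => False)) (hi : i < n)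
    (hl : lab i ≠ 0) : Searching n d1 d2 d3 lab col stk (i + 1) 0 (fun _ => False) := by
  refine ⟨hi, h.walk, by simp, h.closed, fun w hw => ?_⟩
  rcases Nat.lt_succ_iff_lt_or_eq.1 hw with h1 | rfl
  exacts [h.past w h1, hl]

theorem Searching.root {lab' col' stk' : ℕ → ℕ}
    (h : Searching n d1 d2 d3 lab col stk i 0 (fun _ => False)) (hi : i < n) (hl : lab i = 0)
    (hlab : ∀ w, lab' w = if w = i then i + 1 else lab w)
    (hcol : ∀ w, col' w = if w = i then 0 else col w)
    (hstk : ∀ w, stk' w = if w = 0 then i else stk w) :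
    Searching n d1 d2 d3 lab' col' stk' i 1 (fun _ => False) := by
  have keep : ∀ w, lab w ≠ 0 → lab' w = lab w := fun w hw => by
    rw [hlab, if_neg (by rintro rfl; exact hw hl)]
  refine ⟨h.le, fun w hw hlw => ?_, fun j hj => ?_, fun w hw hlw => ?_, fun w hw => ?_⟩
  · rw [hlab, hcol]
    rw [hlab] at hlw
    split_ifs at hlw ⊢ with h1
    · subst h1
      exact ⟨w, hw, rfl, .refl⟩
    · exact h.walk w hw hlw
  · rw [hstk, if_pos (by omega)]
    exact ⟨hi, by rw [hlab, if_pos rfl]⟩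
  · by_cases hwi : w = i
    · exact .inl ⟨0, by omega, by rw [hstk, if_pos rfl, hwi]⟩
    · rw [hlab, if_neg hwi] at hlw ⊢
      rcases h.closed w hw hlw with ⟨j, hj, e⟩ | e | e
      · omega
      · exact e.elim
      · refine .inr (.inr fun z hz => ?_)
        rw [keep z (by rw [e z hz]; exact hlw), e z hz]
  · have := h.past w hw
    rwa [keep w this]

theorem Searching.labelled (h : Searching n d1 d2 d3 lab col stk i sp (fun _ => False))
    (hd : ∀ v < n, d1 v < n ∧ d2 v < n ∧ d3 v < n) (hi : ¬ i < n) :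
    Labelled n d1 d2 d3 lab col := by
  obtain rfl : i = n := le_antisymm h.le (not_lt.1 hi)
  -- A vertex on the stack would have the label n + 1, but labels are r + 1 with r < n. So the stack
  -- is empty.
  have hs : ∀ j, ¬ j < sp := fun j hj => by
    obtain ⟨h1, h2⟩ := h.stack j hj
    obtain ⟨r, hr, h3, -⟩ := h.walk _ h1 (by omega)
    omega
  refine ⟨fun v hv => ?_, fun v hv => h.walk v hv (h.past v hv)⟩
  have hc : ∀ u, Link i d1 d2 d3 v u → lab u = lab v := by
    rcases h.closed v hv (h.past v hv) with ⟨j, hj, -⟩ | e | e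
    exacts [absurd hj (hs j), e.elim, e]
  have hc' : ∀ u, u < i → (u = d1 v ∨ u = d2 v ∨ u = d3 v) → lab u = lab v := fun u hu hu' => by
    by_cases huv : u = v
    · rw [huv]
    · exact hc u ⟨hv, hu, huv, hu'⟩
  exact ⟨hc' _ (hd v hv).1 (by simp), hc' _ (hd v hv).2.1 (by simp),
    hc' _ (hd v hv).2.2 (by simp)⟩

/-- Label and push the vertex in variable `5`, a neighbour of the vertex in variable `4`. -/
def visit (k : ℕ) : Prog :=
  .ite (.eqN (.get k (.var 5)) (.const 0))
    (.seq (.nput k (.var 5) (.get k (.var 4)))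
      (.seq (.ite (.eqN (.get (k + 1) (.var 4)) (.const 0)) (.nput (k + 1) (.var 5) (.const 1))
          (.nput (k + 1) (.var 5) (.const 0)))
        (.seq (.nput (k + 2) (.var 3) (.var 5)) (.nset 3 (.succ (.var 3))))))
    .skip

/-- Visit the neighbour of the vertex in variable `4` that is stored in the array `d`. -/
def visitAt (k d : ℕ) : Prog := .seq (.nset 5 (.get d (.var 4))) (visit k)

theorem visit_run_of_seen {k : ℕ} {s : Mem} (h : s.narr k (s.nvar 5) ≠ 0) :
    (visit k).run s = s := by
  simp [visit, Prog.run, Guard.Holds, NExp.eval, h]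

theorem visit_run_of_new {k : ℕ} {s : Mem} (h : s.narr k (s.nvar 5) = 0) :
    (∀ w, ((visit k).run s).narr k w =
      if w = s.nvar 5 then s.narr k (s.nvar 4) else s.narr k w) ∧
    (∀ w, ((visit k).run s).narr (k + 1) w =
      if w = s.nvar 5 then 1 - s.narr (k + 1) (s.nvar 4) else s.narr (k + 1) w) ∧
    (∀ w, ((visit k).run s).narr (k + 2) w =
      if w = s.nvar 3 then s.nvar 5 else s.narr (k + 2) w) ∧
    ((visit k).run s).nvar 3 = s.nvar 3 + 1 := by
  by_cases hc : s.narr (k + 1) (s.nvar 4) = 0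
  · simp [visit, Prog.run, Guard.Holds, NExp.eval, h, hc, Mem.putN_nvar, Mem.putN_narr,
      Mem.setN_nvar, Mem.setN_narr]
  · have : 1 - s.narr (k + 1) (s.nvar 4) = 0 := by omega
    simp [visit, Prog.run, Guard.Holds, NExp.eval, h, hc, Mem.putN_nvar, Mem.putN_narr,
      Mem.setN_nvar, Mem.setN_narr, this]

theorem visitAt_straight (k d : ℕ) : (visitAt k d).Straight := by
  simp [visitAt, visit, Prog.Straight]

theorem visitAt_nvar (k d : ℕ) (s : Mem) {y : ℕ} (h3 : y ≠ 3) (h5 : y ≠ 5) :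
    ((visitAt k d).run s).nvar y = s.nvar y :=
  (Prog.frame_run (visitAt_straight k d) s).nvar y (by simp [visitAt, visit, Prog.nvars, h3, h5])

theorem visitAt_narr (k d : ℕ) (s : Mem) {a : ℕ} (h : a ≠ k ∧ a ≠ k + 1 ∧ a ≠ k + 2) :
    ((visitAt k d).run s).narr a = s.narr a :=
  (Prog.frame_run (visitAt_straight k d) s).narr a (by simp [visitAt, visit, Prog.narrs, h])

/-- The potential counts unlabelled vertices twice and adds the stack height, so a push lowers it by
one. -/
theorem visitAt_run {k d : ℕ} {s : Mem}
    (hsymm : ∀ v u, Link n d1 d2 d3 v u → Link n d1 d2 d3 u v)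
    (h : Searching n d1 d2 d3 (s.narr k) (s.narr (k + 1)) (s.narr (k + 2)) (s.nvar 2) (s.nvar 3)
      (· = s.nvar 4))
    (hv : s.nvar 4 < n) (hlv : s.narr k (s.nvar 4) = s.nvar 2 + 1)
    (hu : s.narr d (s.nvar 4) < n)
    (hL : s.narr d (s.nvar 4) = d1 (s.nvar 4) ∨ s.narr d (s.nvar 4) = d2 (s.nvar 4) ∨
      s.narr d (s.nvar 4) = d3 (s.nvar 4)) :
    Searching n d1 d2 d3 (((visitAt k d).run s).narr k) (((visitAt k d).run s).narr (k + 1))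
      (((visitAt k d).run s).narr (k + 2)) (s.nvar 2) (((visitAt k d).run s).nvar 3)
      (· = s.nvar 4) ∧
    ((visitAt k d).run s).narr k (s.narr d (s.nvar 4)) = s.nvar 2 + 1 ∧
    (∀ w, s.narr k w ≠ 0 → ((visitAt k d).run s).narr k w = s.narr k w) ∧
    2 * zeros n (((visitAt k d).run s).narr k) + ((visitAt k d).run s).nvar 3 ≤
      2 * zeros n (s.narr k) + s.nvar 3 := by
  set u := s.narr d (s.nvar 4) with hu'
  set t := s.setN 5 u with ht
  have hrun : (visitAt k d).run s = (visit k).run t := rfl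
  have t5 : t.nvar 5 = u := by simp [ht, Mem.setN_nvar]
  have ty : ∀ y, y ≠ 5 → t.nvar y = s.nvar y := fun y hy => by simp [ht, Mem.setN_nvar, hy]
  have ta : t.narr = s.narr := rfl
  rw [hrun]
  by_cases hl : s.narr k u = 0
  · have huv : u ≠ s.nvar 4 := by
      intro e
      rw [e] at hl
      omega
    have hLink : Link n d1 d2 d3 (s.nvar 4) u := ⟨hv, hu, huv, hL⟩
    obtain ⟨r1, r2, r3, r4⟩ := visit_run_of_new (k := k) (s := t) (by rw [t5, ta]; exact hl)
    rw [t5, ta, ty 4 (by decide)] at r1 r2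
    rw [t5, ta, ty 3 (by decide)] at r3
    rw [ty 3 (by decide)] at r4
    have keep : ∀ w, s.narr k w ≠ 0 → ((visit k).run t).narr k w = s.narr k w := fun w hw => by
      rw [r1, if_neg (by rintro rfl; exact hw hl)]
    have hz : zeros n (((visit k).run t).narr k) < zeros n (s.narr k) := by
      refine zeros_lt (fun w hw => ?_) hu hl ?_
      · by_contra hne
        rw [keep w hne] at hw
        exact hne hw
      · rw [r1, if_pos rfl]
        omega
    rw [r4]
    refine ⟨h.push hv hlv hLink hl r1 r2 r3, by rw [r1, if_pos rfl, hlv], keep, by omega⟩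
  · rw [visit_run_of_seen (by rw [t5, ta]; exact hl), ty 3 (by decide), ta]
    refine ⟨h, ?_, fun _ _ => rfl, le_rfl⟩
    by_cases huv : u = s.nvar 4
    · rw [huv, hlv]
    · rw [h.seen hsymm hlv ⟨hv, hu, huv, hL⟩ hl, hlv]

/-- Take the last vertex from the stack and visit its neighbours. -/
def popStep (e1 e2 e3 k : ℕ) : Prog :=
  .seq (.seq (.nset 3 (.pred (.var 3))) (.nset 4 (.get (k + 2) (.var 3))))
    (.seq (visitAt k e1) (.seq (visitAt k e2) (visitAt k e3)))

/-- Start the exploration of a component at the vertex in variable `2`. -/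
def rootStep (k : ℕ) : Prog :=
  .seq (.nput k (.var 2) (.succ (.var 2))) (.seq (.nput (k + 1) (.var 2) (.const 0))
    (.seq (.nput (k + 2) (.const 0) (.var 2)) (.nset 3 (.const 1))))

def searchBody (e1 e2 e3 k : ℕ) : Prog :=
  .ite (.eqN (.var 3) (.const 0))
    (.ite (.eqN (.get k (.var 2)) (.const 0)) (rootStep k) (.nset 2 (.succ (.var 2))))
    (popStep e1 e2 e3 k)

/-- Label the components of the graph on the vertices below variable `0` whose adjacency lists are
stored in the arrays `e1`, `e2` and `e3`. -/
def search (e1 e2 e3 k : ℕ) : Prog :=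
  .seq (.seq (.nset 2 (.const 0)) (.nset 3 (.const 0)))
    (.loop (.ltN (.var 2) (.var 0)) (searchBody e1 e2 e3 k))

/-- The constant in the running time of `search`. -/
def searchCost (e1 e2 e3 k : ℕ) : ℕ :=
  (Prog.seq (.nset 2 (.const 0)) (.nset 3 (.const 0))).bound +
    ((searchBody e1 e2 e3 k).bound + (Guard.ltN (.var 2) (.var 0)).cost + 1) * (3 + 1)

theorem searchBody_straight (e1 e2 e3 k : ℕ) : (searchBody e1 e2 e3 k).Straight := by
  simp [searchBody, popStep, rootStep, Prog.Straight, visitAt_straight]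

/-- Popping lowers the potential by one and the three visits never raise it. Labels once given are
kept, so after the visits all neighbours of the popped vertex have its label. -/
theorem popStep_run {e1 e2 e3 k : ℕ} {s : Mem} (hk : e1 < k ∧ e2 < k ∧ e3 < k)
    (hsymm : ∀ v u, Link n d1 d2 d3 v u → Link n d1 d2 d3 u v)
    (hd : ∀ v < n, d1 v < n ∧ d2 v < n ∧ d3 v < n)
    (h1 : s.narr e1 = d1) (h2 : s.narr e2 = d2) (h3 : s.narr e3 = d3)
    (h : Searching n d1 d2 d3 (s.narr k) (s.narr (k + 1)) (s.narr (k + 2)) (s.nvar 2) (s.nvar 3)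
      (fun _ => False)) (hs : s.nvar 3 ≠ 0) :
    Searching n d1 d2 d3 (((popStep e1 e2 e3 k).run s).narr k)
      (((popStep e1 e2 e3 k).run s).narr (k + 1)) (((popStep e1 e2 e3 k).run s).narr (k + 2))
      (s.nvar 2) (((popStep e1 e2 e3 k).run s).nvar 3) (fun _ => False) ∧
    2 * zeros n (((popStep e1 e2 e3 k).run s).narr k) + ((popStep e1 e2 e3 k).run s).nvar 3 <
      2 * zeros n (s.narr k) + s.nvar 3 := by
  obtain ⟨m, hm⟩ : ∃ m, s.nvar 3 = m + 1 := ⟨s.nvar 3 - 1, by omega⟩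
  rw [hm] at h
  set t := (s.setN 3 m).setN 4 (s.narr (k + 2) m) with ht
  have hrun : (popStep e1 e2 e3 k).run s =
      (visitAt k e3).run ((visitAt k e2).run ((visitAt k e1).run t)) := by
    simp [popStep, Prog.run, NExp.eval, hm, ht, Mem.setN_nvar, Mem.setN_narr]
  have ta : t.narr = s.narr := rfl
  have t2 : t.nvar 2 = s.nvar 2 := by simp [ht, Mem.setN_nvar]
  have t3 : t.nvar 3 = m := by simp [ht, Mem.setN_nvar]
  have t4 : t.nvar 4 = s.narr (k + 2) m := by simp [ht, Mem.setN_nvar]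
  obtain ⟨hvn, hvl⟩ := h.stack m (by omega)
  have hP := h.pop
  set v := s.narr (k + 2) m with hv
  obtain ⟨b1, b2, b3⟩ := hd v hvn
  obtain ⟨S1, l1, m1, z1⟩ := visitAt_run (k := k) (d := e1) (s := t) hsymm
    (by rw [ta, t2, t3, t4]; exact hP) (by rw [t4]; exact hvn)
    (by rw [ta, t2, t4]; exact hvl) (by rw [ta, t4, h1]; exact b1)
    (by rw [ta, h1]; exact .inl rfl)
  set t' := (visitAt k e1).run t with ht'
  have a1 : ∀ a, a < k → t'.narr a = s.narr a := fun a ha => by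
    rw [ht', visitAt_narr _ _ _ (by omega), ta]
  have t2' : t'.nvar 2 = s.nvar 2 := by rw [ht', visitAt_nvar _ _ _ (by omega) (by omega), t2]
  have t4' : t'.nvar 4 = v := by rw [ht', visitAt_nvar _ _ _ (by omega) (by omega), t4]
  rw [t2, t4, ← t2', ← t4'] at S1
  have hvl' : t'.narr k v = s.nvar 2 + 1 := by
    rw [m1 v (by rw [ta, hvl]; omega), ta, hvl]
  obtain ⟨S2, l2, m2, z2⟩ := visitAt_run (k := k) (d := e2) (s := t') hsymm S1
    (by rw [t4']; exact hvn)
    (by rw [t2', t4']; exact hvl') (by rw [a1 _ hk.2.1, t4', h2]; exact b2)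
    (by rw [a1 _ hk.2.1, h2]; exact .inr (.inl rfl))
  set t'' := (visitAt k e2).run t' with ht''
  have a2 : ∀ a, a < k → t''.narr a = s.narr a := fun a ha => by
    rw [ht'', visitAt_narr _ _ _ (by omega), a1 a ha]
  have t2'' : t''.nvar 2 = s.nvar 2 := by
    rw [ht'', visitAt_nvar _ _ _ (by omega) (by omega), t2']
  have t4'' : t''.nvar 4 = v := by rw [ht'', visitAt_nvar _ _ _ (by omega) (by omega), t4']
  rw [t2', t4', ← t2'', ← t4''] at S2
  have hvl'' : t''.narr k v = s.nvar 2 + 1 := by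
    rw [m2 v (by rw [hvl']; omega), hvl']
  obtain ⟨S3, l3, m3, z3⟩ := visitAt_run (k := k) (d := e3) (s := t'') hsymm S2
    (by rw [t4'']; exact hvn)
    (by rw [t2'', t4'']; exact hvl'') (by rw [a2 _ hk.2.2, t4'', h3]; exact b3)
    (by rw [a2 _ hk.2.2, h3]; exact .inr (.inr rfl))
  rw [hrun]
  rw [t2'', t4''] at S3
  rw [ta, t2, t4, h1] at l1
  rw [a1 _ hk.2.1, t2', t4', h2] at l2
  rw [a2 _ hk.2.2, t2'', t4'', h3] at l3
  rw [ta, t3] at z1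
  refine ⟨S3.done ?_, by omega⟩
  rintro u ⟨-, -, -, hu⟩
  rw [m3 v (by rw [hvl'']; omega), hvl'']
  rcases hu with rfl | rfl | rfl
  · have e : t''.narr k (d1 v) = s.nvar 2 + 1 := by rw [m2 _ (by rw [l1]; omega), l1]
    rw [m3 _ (by rw [e]; omega), e]
  · rw [m3 _ (by rw [l2]; omega), l2]
  · exact l3

/-- The bounds on `e1`, `e2`, `e3` protect the adjacency arrays, since only the arrays k, k + 1 and
k + 2 are written. Only the label array must start at 0. -/
theorem search_reaches {e1 e2 e3 k : ℕ} {s : Mem} (hk : e1 < k ∧ e2 < k ∧ e3 < k)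
    (hn : s.nvar 0 = n) (hsymm : ∀ v u, Link n (s.narr e1) (s.narr e2) (s.narr e3) v u →
      Link n (s.narr e1) (s.narr e2) (s.narr e3) u v)
    (hd : ∀ v < n, s.narr e1 v < n ∧ s.narr e2 v < n ∧ s.narr e3 v < n)
    (h0 : ∀ v < n, s.narr k v = 0) :
    Reaches (search e1 e2 e3 k) (searchCost e1 e2 e3 k) n s fun s' =>
      Labelled n (s.narr e1) (s.narr e2) (s.narr e3) (s'.narr k) (s'.narr (k + 1)) := by
  have hS := searchBody_straight e1 e2 e3 k
  refine Reaches.seq (Q := fun s' => s' = (s.setN 2 0).setN 3 0)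
    (Reaches.run (by simp [Prog.Straight]) rfl) ?_
  rintro _ - rfl
  refine (Reaches.loop hS (fun s' => s'.nvar 0 = n ∧ s'.narr e1 = s.narr e1 ∧
    s'.narr e2 = s.narr e2 ∧ s'.narr e3 = s.narr e3 ∧
    Searching n (s.narr e1) (s.narr e2) (s.narr e3) (s'.narr k) (s'.narr (k + 1))
      (s'.narr (k + 2)) (s'.nvar 2) (s'.nvar 3) (fun _ => False))
    -- Initially at most n + 2n, which is the 3 in `searchCost`.
    (fun s' => (n - s'.nvar 2) + (2 * zeros n (s'.narr k) + s'.nvar 3)) ?_ ?_ ?_).mono ?_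
  · rintro s' ⟨h0', h1, h2, h3, hP⟩ hb
    simp only [Guard.Holds, NExp.eval, h0'] at hb
    have hF := Prog.frame_run hS s'
    have ea : ∀ a, a < k → ((searchBody e1 e2 e3 k).run s').narr a = s'.narr a := fun a ha =>
      hF.narr a (by
        simp [searchBody, popStep, rootStep, visitAt, visit, Prog.narrs]
        omega)
    have e0 : ((searchBody e1 e2 e3 k).run s').nvar 0 = n := by
      rw [hF.nvar 0 (by simp [searchBody, popStep, rootStep, visitAt, visit, Prog.nvars]), h0']
    rw [e0, ea _ hk.1, ea _ hk.2.1, ea _ hk.2.2, h1, h2, h3]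
    by_cases hs : s'.nvar 3 = 0
    · rw [hs] at hP
      by_cases hl : s'.narr k (s'.nvar 2) = 0
      · have er : (searchBody e1 e2 e3 k).run s' = (rootStep k).run s' := by
          simp [searchBody, Prog.run, Guard.Holds, NExp.eval, hs, hl]
        have r1 : ∀ w, ((rootStep k).run s').narr k w =
            if w = s'.nvar 2 then s'.nvar 2 + 1 else s'.narr k w := fun w => by
          simp [rootStep, Prog.run, NExp.eval, Mem.putN_nvar, Mem.putN_narr, Mem.setN_narr]
        have r2 : ∀ w, ((rootStep k).run s').narr (k + 1) w =
            if w = s'.nvar 2 then 0 else s'.narr (k + 1) w := fun w => by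
          simp [rootStep, Prog.run, NExp.eval, Mem.putN_nvar, Mem.putN_narr, Mem.setN_narr]
        have r3 : ∀ w, ((rootStep k).run s').narr (k + 2) w =
            if w = 0 then s'.nvar 2 else s'.narr (k + 2) w := fun w => by
          simp [rootStep, Prog.run, NExp.eval, Mem.putN_nvar, Mem.putN_narr, Mem.setN_narr]
        have r4 : ((rootStep k).run s').nvar 3 = 1 := by
          simp [rootStep, Prog.run, NExp.eval, Mem.setN_nvar]
        have r5 : ((rootStep k).run s').nvar 2 = s'.nvar 2 := by
          simp [rootStep, Prog.run, Mem.putN_nvar, Mem.setN_nvar]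
        have hz : zeros n (((rootStep k).run s').narr k) < zeros n (s'.narr k) := by
          refine zeros_lt (fun w hw => ?_) hb hl ?_
          · rw [r1] at hw
            split_ifs at hw
            exact hw
          · rw [r1, if_pos rfl]
            omega
        rw [er, r4, r5, hs]
        exact ⟨⟨rfl, rfl, rfl, rfl, hP.root hb hl r1 r2 r3⟩, by omega⟩
      · have er : (searchBody e1 e2 e3 k).run s' = s'.setN 2 (s'.nvar 2 + 1) := by
          simp [searchBody, Prog.run, Guard.Holds, NExp.eval, hs, hl]
        have r3 : (s'.setN 2 (s'.nvar 2 + 1)).nvar 3 = 0 := by simp [Mem.setN_nvar, hs]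
        have r2 : (s'.setN 2 (s'.nvar 2 + 1)).nvar 2 = s'.nvar 2 + 1 := by simp [Mem.setN_nvar]
        rw [er, r3, r2, hs, Mem.setN_narr]
        exact ⟨⟨rfl, rfl, rfl, rfl, hP.next hb hl⟩, by omega⟩
    · have er : (searchBody e1 e2 e3 k).run s' = (popStep e1 e2 e3 k).run s' := by
        simp [searchBody, Prog.run, Guard.Holds, NExp.eval, hs]
      have r2 : ((popStep e1 e2 e3 k).run s').nvar 2 = s'.nvar 2 :=
        (Prog.frame_run (A := popStep e1 e2 e3 k)
          (by simp [popStep, Prog.Straight, visitAt_straight]) s').nvar 2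
          (by simp [popStep, visitAt, visit, Prog.nvars])
      obtain ⟨hP', hz⟩ := popStep_run hk hsymm hd h1 h2 h3 hP hs
      rw [er, r2]
      exact ⟨⟨rfl, rfl, rfl, rfl, hP'⟩, by omega⟩
  · have t2 : ((s.setN 2 0).setN 3 0).nvar 2 = 0 := by simp [Mem.setN_nvar]
    have t3 : ((s.setN 2 0).setN 3 0).nvar 3 = 0 := by simp [Mem.setN_nvar]
    rw [t2, t3]
    refine ⟨by simpa [Mem.setN_nvar] using hn, rfl, rfl, rfl, Nat.zero_le _, ?_, by simp, ?_,
      by simp⟩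
    · exact fun v hv h => absurd (h0 v hv) h
    · exact fun v hv h => absurd (h0 v hv) h
  · have t2 : ((s.setN 2 0).setN 3 0).nvar 2 = 0 := by simp [Mem.setN_nvar]
    have t3 : ((s.setN 2 0).setN 3 0).nvar 3 = 0 := by simp [Mem.setN_nvar]
    have := zeros_le n (((s.setN 2 0).setN 3 0).narr k)
    omega
  · rintro s' ⟨⟨h0', -, -, -, hP⟩, hb⟩
    simp only [Guard.Holds, NExp.eval, h0'] at hb
    exact hP.labelled hd hb

end Search

end EdgeDom

namespace EdgeDom

/-! ### Adjacency lists, weighted degrees and local shapes -/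

section Passes

variable {H : SimpleGraph ℕ} {n m : ℕ}

/-- Disjunction of tests. -/
def Guard.or (b c : Guard) : Guard := .not (.and (.not b) (.not c))

theorem Guard.holds_or {s : Mem} {b c : Guard} : (b.or c).Holds s ↔ b.Holds s ∨ c.Holds s := by
  simp only [Guard.or, Guard.Holds]
  tauto

/-- The `j`-th edge joins `v` and `u`. -/
def Joins (src dst : ℕ → ℕ) (j v u : ℕ) : Prop :=
  (src j = v ∧ dst j = u) ∨ (src j = u ∧ dst j = v)

/-- `src` and `dst` list the edges of the cubic claw-free graph `H` on the vertices below `n`. -/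
structure Listing (H : SimpleGraph ℕ) (n m : ℕ) (src dst : ℕ → ℕ) : Prop where
  lt : ∀ {u v}, H.Adj u v → v < n
  edge : ∀ j < m, H.Adj (src j) (dst j)
  exists_joins : ∀ {u v}, H.Adj u v → ∃ j < m, Joins src dst j u v
  inj : ∀ {j k u v}, j < m → k < m → Joins src dst j u v → Joins src dst k u v → j = k
  cubic : ∀ v < n, ∃ a b c, (∀ u, H.Adj v u ↔ u = a ∨ u = b ∨ u = c) ∧ a ≠ b ∧ a ≠ c ∧ b ≠ c
  claw : ∀ {v a b c}, H.Adj v a → H.Adj v b → H.Adj v c → a ≠ b → a ≠ c → b ≠ c →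
    H.Adj a b ∨ H.Adj b c ∨ H.Adj a c

/-- The three neighbours of each vertex. -/
structure Nbrs (H : SimpleGraph ℕ) (n : ℕ) (a b c : ℕ → ℕ) : Prop where
  adj : ∀ v < n, ∀ u, H.Adj v u ↔ u = a v ∨ u = b v ∨ u = c v
  ne_ab : ∀ v < n, a v ≠ b v
  ne_ac : ∀ v < n, a v ≠ c v
  ne_bc : ∀ v < n, b v ≠ c v

/-- Add `v` to the neighbours of `u`. -/
def pushNbr (u v : NExp) : Prog :=
  .seq (.nput 6 u (.get 5 u)) (.seq (.nput 5 u (.get 4 u)) (.nput 4 u v))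

/-- The integer arrays 4, 5, 6 act as a shift register of the latest neighbours of each vertex; the
real array 1 accumulates weighted degrees. -/
def adjBody : Prog :=
  .seq (pushNbr (.get 0 (.var 2)) (.get 1 (.var 2)))
    (.seq (pushNbr (.get 1 (.var 2)) (.get 0 (.var 2)))
      (.seq (.rput 1 (.get 0 (.var 2)) (.add (.get 1 (.get 0 (.var 2))) (.get 0 (.var 2))))
        (.rput 1 (.get 1 (.var 2)) (.add (.get 1 (.get 1 (.var 2))) (.get 0 (.var 2))))))

theorem adjBody_run {s : Mem} {j a b : ℕ} (hj : s.nvar 2 = j) (ha : s.narr 0 j = a)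
    (hb : s.narr 1 j = b) (hab : a ≠ b) :
    (∀ v, (adjBody.run s).narr 4 v = if v = a then b else if v = b then a else s.narr 4 v) ∧
    (∀ v, (adjBody.run s).narr 5 v = if v = a ∨ v = b then s.narr 4 v else s.narr 5 v) ∧
    (∀ v, (adjBody.run s).narr 6 v = if v = a ∨ v = b then s.narr 5 v else s.narr 6 v) ∧
    (∀ v, (adjBody.run s).rarr 1 v =
      s.rarr 1 v + if a = v ∨ b = v then s.rarr 0 j else 0) := by
  have hba := hab.symm
  refine ⟨fun v => ?_, fun v => ?_, fun v => ?_, fun v => ?_⟩ <;>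
  · simp only [adjBody, pushNbr, Prog.run, NExp.eval, RExp.eval, Mem.putN_nvar, Mem.putN_narr,
      Mem.putN_rarr, Mem.putR_narr, Mem.putR_nvar, Mem.putR_rarr, hj, ha, hb]
    by_cases h1 : v = a
    · subst h1
      simp_all
    · by_cases h2 : v = b
      · subst h2
        simp_all
      · simp_all [Ne.symm h1, Ne.symm h2]

/-- The most recent neighbours of `v` among the first `i` edges are `a`, `b` and `c`. -/
def Recent (src dst : ℕ → ℕ) (i v a b c : ℕ) : Prop :=
  ∃ l : List ℕ, l.Nodup ∧ (∀ u, u ∈ l ↔ ∃ j < i, Joins src dst j v u) ∧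
    l.take 3 = [a, b, c].take l.length

theorem Recent.push {src dst : ℕ → ℕ} {i v a b c u : ℕ} (h : Recent src dst i v a b c)
    (hu : ∀ w, Joins src dst i v w ↔ w = u) (hnew : ∀ j < i, ¬ Joins src dst j v u) :
    Recent src dst (i + 1) v u a b := by
  obtain ⟨l, hl, hm, ht⟩ := h
  refine ⟨u :: l, List.nodup_cons.2 ⟨fun hul => ?_, hl⟩, fun w => ?_, ?_⟩
  · obtain ⟨j, hj, hJ⟩ := (hm u).1 hul
    exact hnew j hj hJ
  · rw [List.mem_cons, hm]
    constructor
    · rintro (rfl | ⟨j, hj, hJ⟩)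
      · exact ⟨i, by omega, (hu _).2 rfl⟩
      · exact ⟨j, by omega, hJ⟩
    · rintro ⟨j, hj, hJ⟩
      rcases Nat.lt_succ_iff_lt_or_eq.1 hj with h1 | rfl
      · exact .inr ⟨j, h1, hJ⟩
      · exact .inl ((hu w).1 hJ)
  -- The oldest entry is shifted out, so only agreement in the first two entries is needed.
  · have := congrArg (List.take 2) ht
    rw [List.take_take, List.take_take] at this
    simp only [List.take_succ_cons, List.length_cons]
    rw [show min 2 3 = 2 from rfl, min_comm, ← List.take_take] at this
    rw [this]
    rfl

theorem Recent.skip {src dst : ℕ → ℕ} {i v a b c : ℕ} (h : Recent src dst i v a b c)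
    (hu : ∀ w, ¬ Joins src dst i v w) : Recent src dst (i + 1) v a b c := by
  obtain ⟨l, hl, hm, ht⟩ := h
  refine ⟨l, hl, fun w => (hm w).trans ⟨?_, ?_⟩, ht⟩
  · rintro ⟨j, hj, hJ⟩
    exact ⟨j, by omega, hJ⟩
  · rintro ⟨j, hj, hJ⟩
    rcases Nat.lt_succ_iff_lt_or_eq.1 hj with h1 | rfl
    exacts [⟨j, h1, hJ⟩, absurd hJ (hu w)]

/-- After all edges, the list behind `Recent` consists of the three neighbours of v, so the
registers hold all of it. -/
theorem Listing.nbrs {src dst a b c : ℕ → ℕ} (h : Listing H n m src dst)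
    (hR : ∀ v < n, Recent src dst m v (a v) (b v) (c v)) : Nbrs H n a b c := by
  have key : ∀ v < n, (∀ u, H.Adj v u ↔ u = a v ∨ u = b v ∨ u = c v) ∧ a v ≠ b v ∧ a v ≠ c v ∧
      b v ≠ c v := by
    intro v hv
    obtain ⟨l, hl, hm, ht⟩ := hR v hv
    have hadj : ∀ u, u ∈ l ↔ H.Adj v u := fun u => by
      rw [hm]
      constructor
      · rintro ⟨j, hj, ⟨rfl, rfl⟩ | ⟨rfl, rfl⟩⟩
        exacts [h.edge j hj, (h.edge j hj).symm]
      · exact h.exists_joins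
    obtain ⟨a', b', c', hN, h1, h2, h3⟩ := h.cubic v hv
    have hp : l.Perm [a', b', c'] :=
      (List.perm_ext_iff_of_nodup hl (by simp [h1, h2, h3])).2 fun u => by simp [hadj, hN]
    have hlen : l.length = 3 := hp.length_eq
    have hl3 : l = [a v, b v, c v] := by
      rw [hlen] at ht
      rw [← hlen, List.take_length] at ht
      rw [ht, hlen]
      rfl
    rw [hl3] at hl hadj
    simp only [List.mem_cons, List.not_mem_nil, or_false, List.nodup_cons, not_or] at hl hadj
    exact ⟨fun u => (hadj u).symm, hl.1.1, hl.1.2, hl.2.1⟩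
  exact ⟨fun v hv => (key v hv).1, fun v hv => (key v hv).2.1, fun v hv => (key v hv).2.2.1,
    fun v hv => (key v hv).2.2.2⟩

/-- The total weight of the edges at `v` among the first `m` edges. -/
noncomputable def wdeg (m : ℕ) (src dst : ℕ → ℕ) (w : ℕ → ℝ) (v : ℕ) : ℝ :=
  ∑ j ∈ Finset.range m, if src j = v ∨ dst j = v then w j else 0

theorem adj_reaches {s : Mem} (hm : s.nvar 1 = m) (hmn : m ≤ 2 * n)
    (hL : Listing H n m (s.narr 0) (s.narr 1)) (h0 : ∀ v, s.rarr 1 v = 0) :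
    Reaches (forLoop 1 adjBody) (forCost adjBody 2) n s fun s' =>
      Nbrs H n (s'.narr 4) (s'.narr 5) (s'.narr 6) ∧
      ∀ v, s'.rarr 1 v = wdeg m (s.narr 0) (s.narr 1) (s.rarr 0) v := by
  refine (Reaches.forLoop (by simp [adjBody, pushNbr, Prog.Straight]) (by decide) (by decide)
    (by decide) (fun i s' => (∀ v < n, Recent (s.narr 0) (s.narr 1) i v (s'.narr 4 v) (s'.narr 5 v)
      (s'.narr 6 v)) ∧ ∀ v, s'.rarr 1 v = wdeg i (s.narr 0) (s.narr 1) (s.rarr 0) v)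
    (by rw [hm]; exact hmn) ?_ ?_).mono ?_
  · rintro s' e1 e2 -
    refine ⟨fun v hv => ⟨[], by simp⟩, fun v => ?_⟩
    rw [e2, h0]
    simp [wdeg]
  · rintro i s' hi h2 hF ⟨hR, hw⟩
    rw [hm] at hi
    have e0 : s'.narr 0 = s.narr 0 := hF.narr 0 (by decide)
    have e1 : s'.narr 1 = s.narr 1 := hF.narr 1 (by decide)
    have er : s'.rarr 0 = s.rarr 0 := hF.rarr 0 (by decide)
    have hadj := hL.edge i hi
    obtain ⟨r4, r5, r6, r1⟩ := adjBody_run (s := s') h2 (by rw [e0]) (by rw [e1]) hadj.ne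
    rw [Mem.setN_narr, Mem.setN_rarr]
    constructor
    · intro v hv
      rw [r4, r5, r6]
      have hnew : ∀ u, Joins (s.narr 0) (s.narr 1) i v u →
          ∀ j < i, ¬ Joins (s.narr 0) (s.narr 1) j v u := fun u hu j hj hJ => by
        have := hL.inj (hj.trans hi) hi hJ hu
        omega
      have hne := hadj.ne
      by_cases ha : v = s.narr 0 i
      · subst ha
        have hJ : ∀ w, Joins (s.narr 0) (s.narr 1) i (s.narr 0 i) w ↔ w = s.narr 1 i :=
          fun w => by unfold Joins; grind
        simpa using (hR _ hv).push hJ (hnew _ ((hJ _).2 rfl))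
      · by_cases hb : v = s.narr 1 i
        · subst hb
          have hJ : ∀ w, Joins (s.narr 0) (s.narr 1) i (s.narr 1 i) w ↔ w = s.narr 0 i :=
            fun w => by unfold Joins; grind
          simpa [hne.symm] using (hR _ hv).push hJ (hnew _ ((hJ _).2 rfl))
        · simpa [ha, hb] using (hR v hv).skip fun w => by unfold Joins; grind
    · intro v
      rw [r1, hw, er, wdeg, wdeg, Finset.sum_range_succ]
  · rintro s' ⟨hR, hw⟩
    rw [hm] at hR hw
    exact ⟨hL.nbrs hR, hw⟩

/-- Whether `v` is a neighbour of `u`. -/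
def adjTest (u v : NExp) : Guard :=
  ((Guard.eqN v (.get 4 u)).or ((Guard.eqN v (.get 5 u)).or (.eqN v (.get 6 u))))

theorem Nbrs.holds_adjTest {s : Mem} (h : Nbrs H n (s.narr 4) (s.narr 5) (s.narr 6)) {u v : NExp}
    (hu : u.eval s < n) : (adjTest u v).Holds s ↔ H.Adj (u.eval s) (v.eval s) := by
  rw [h.adj _ hu]
  simp [adjTest, Guard.holds_or, Guard.Holds, NExp.eval]

/-- Store the mates and the outer neighbour of the vertex in variable `2`. -/
def setTri (p q o : ℕ) : Prog :=
  .seq (.nput 7 (.var 2) (.get p (.var 2))) (.seq (.nput 8 (.var 2) (.get q (.var 2)))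
    (.nput 9 (.var 2) (.get o (.var 2))))

/-- Whether the neighbours of the vertex in variable `2` that are stored in the arrays `a` and `b`
are adjacent. -/
def nbrTest (a b : ℕ) : Guard := adjTest (.get a (.var 2)) (.get b (.var 2))

/-- Only the first of the three tests succeeds. -/
def onlyFirst (b c d : Guard) : Guard := .and b (.and (.not c) (.not d))

/-- Exactly one adjacent pair of neighbours gives the mates; in all other cases the vertex is marked
1, since it is then `Mid`. -/
def shapeBody : Prog :=
  .ite (onlyFirst (nbrTest 4 5) (nbrTest 5 6) (nbrTest 4 6)) (setTri 4 5 6)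
    (.ite (onlyFirst (nbrTest 5 6) (nbrTest 4 5) (nbrTest 4 6)) (setTri 5 6 4)
      (.ite (onlyFirst (nbrTest 4 6) (nbrTest 4 5) (nbrTest 5 6)) (setTri 4 6 5)
        (.nput 10 (.var 2) (.const 1))))

theorem Tri.congr {p q o p' q' o' : ℕ → ℕ} {v : ℕ} (h : Tri H p q o v) (hp : p' v = p v)
    (hq : q' v = q v) (ho : o' v = o v) : Tri H p' q' o' v := by
  obtain ⟨h1, h2, h3, h4, h5, h6, h7⟩ := h
  constructor <;> simpa only [hp, hq, ho]

theorem setTri_run {s : Mem} {p q o : ℕ} (hq : q < 7) (ho : o < 7) :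
    (∀ v, ((setTri p q o).run s).narr 7 v =
      if v = s.nvar 2 then s.narr p (s.nvar 2) else s.narr 7 v) ∧
    (∀ v, ((setTri p q o).run s).narr 8 v =
      if v = s.nvar 2 then s.narr q (s.nvar 2) else s.narr 8 v) ∧
    (∀ v, ((setTri p q o).run s).narr 9 v =
      if v = s.nvar 2 then s.narr o (s.nvar 2) else s.narr 9 v) ∧
    ((setTri p q o).run s).narr 10 = s.narr 10 := by
  have h1 : q ≠ 7 := by omega
  have h2 : o ≠ 7 := by omega
  have h3 : o ≠ 8 := by omega
  refine ⟨fun v => ?_, fun v => ?_, fun v => ?_, funext fun v => ?_⟩ <;>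
    simp [setTri, Prog.run, NExp.eval, Mem.putN_nvar, Mem.putN_narr, h1, h2, h3]

/-- Some pair is adjacent but not exactly one, so at least two are, and any two of the three pairs
share a vertex. -/
theorem mid_of_pairs {v a b c : ℕ} (hadj : ∀ u, H.Adj v u ↔ u = a ∨ u = b ∨ u = c) (hab : a ≠ b)
    (hac : a ≠ c) (hbc : b ≠ c) (h : H.Adj a b ∨ H.Adj b c ∨ H.Adj a c)
    (h1 : ¬ (H.Adj a b ∧ ¬ H.Adj b c ∧ ¬ H.Adj a c))
    (h2 : ¬ (H.Adj b c ∧ ¬ H.Adj a b ∧ ¬ H.Adj a c))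
    (h3 : ¬ (H.Adj a c ∧ ¬ H.Adj a b ∧ ¬ H.Adj b c)) : Mid H v := by
  by_cases j1 : H.Adj a b
  · by_cases j2 : H.Adj b c
    · exact ⟨a, c, b, fun u => (hadj u).trans (or_congr_right or_comm), hac, hab, hbc.symm,
        j1.symm, j2⟩
    · have j3 : H.Adj a c := by tauto
      exact ⟨b, c, a, fun u => (hadj u).trans or_rotate, hbc, hab.symm, hac.symm, j1, j3⟩
  · have j2 : H.Adj b c := by tauto
    have j3 : H.Adj a c := by tauto
    exact ⟨a, b, c, hadj, hab, hac, hbc, j3.symm, j2.symm⟩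

theorem shapeBody_run {s : Mem} (hN : Nbrs H n (s.narr 4) (s.narr 5) (s.narr 6))
    (hlt : ∀ {u v}, H.Adj u v → v < n)
    (claw : ∀ {v a b c}, H.Adj v a → H.Adj v b → H.Adj v c → a ≠ b → a ≠ c → b ≠ c →
      H.Adj a b ∨ H.Adj b c ∨ H.Adj a c) (hv : s.nvar 2 < n) (hx : s.narr 10 (s.nvar 2) = 0) :
    (((shapeBody.run s).narr 10 (s.nvar 2) = 0 ∧ Tri H ((shapeBody.run s).narr 7)
      ((shapeBody.run s).narr 8) ((shapeBody.run s).narr 9) (s.nvar 2)) ∨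
      ((shapeBody.run s).narr 10 (s.nvar 2) = 1 ∧ Mid H (s.nvar 2))) ∧
    ∀ u, u ≠ s.nvar 2 → (shapeBody.run s).narr 7 u = s.narr 7 u ∧
      (shapeBody.run s).narr 8 u = s.narr 8 u ∧ (shapeBody.run s).narr 9 u = s.narr 9 u ∧
      (shapeBody.run s).narr 10 u = s.narr 10 u := by
  set v := s.nvar 2 with hv'
  have hadj := hN.adj v hv
  have ha : H.Adj v (s.narr 4 v) := (hadj _).2 (by simp)
  have hb : H.Adj v (s.narr 5 v) := (hadj _).2 (by simp)
  have hc : H.Adj v (s.narr 6 v) := (hadj _).2 (by simp)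
  have hab := hN.ne_ab v hv
  have hac := hN.ne_ac v hv
  have hbc := hN.ne_bc v hv
  have g1 : (nbrTest 4 5).Holds s ↔ H.Adj (s.narr 4 v) (s.narr 5 v) :=
    hN.holds_adjTest (u := .get 4 (.var 2)) (hlt ha)
  have g2 : (nbrTest 5 6).Holds s ↔ H.Adj (s.narr 5 v) (s.narr 6 v) :=
    hN.holds_adjTest (u := .get 5 (.var 2)) (hlt hb)
  have g3 : (nbrTest 4 6).Holds s ↔ H.Adj (s.narr 4 v) (s.narr 6 v) :=
    hN.holds_adjTest (u := .get 4 (.var 2)) (hlt ha)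
  have tri : ∀ {p q o : ℕ}, q < 7 → o < 7 →
      Tri H (s.narr p) (s.narr q) (s.narr o) v → shapeBody.run s = (setTri p q o).run s →
      (((shapeBody.run s).narr 10 v = 0 ∧ Tri H ((shapeBody.run s).narr 7)
      ((shapeBody.run s).narr 8) ((shapeBody.run s).narr 9) v) ∨
      ((shapeBody.run s).narr 10 v = 1 ∧ Mid H v)) ∧
      ∀ u, u ≠ v → (shapeBody.run s).narr 7 u = s.narr 7 u ∧
      (shapeBody.run s).narr 8 u = s.narr 8 u ∧ (shapeBody.run s).narr 9 u = s.narr 9 u ∧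
      (shapeBody.run s).narr 10 u = s.narr 10 u := by
    intro p q o hq ho hT e
    obtain ⟨r1, r2, r3, r4⟩ := setTri_run (s := s) (p := p) hq ho
    rw [e]
    refine ⟨.inl ⟨by rw [r4]; exact hx, ?_⟩, fun u hu => ?_⟩
    · exact hT.congr (by rw [r1, if_pos hv']) (by rw [r2, if_pos hv'])
        (by rw [r3, if_pos hv'])
    · rw [r1, r2, r3, r4, if_neg hu, if_neg hu, if_neg hu]
      exact ⟨rfl, rfl, rfl, rfl⟩
  by_cases k1 : (onlyFirst (nbrTest 4 5) (nbrTest 5 6) (nbrTest 4 6)).Holds s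
  · refine tri (p := 4) (q := 5) (o := 6) (by decide) (by decide) ?_
      (by simp only [shapeBody, Prog.run, if_pos k1])
    simp only [onlyFirst, Guard.Holds, g1, g2, g3] at k1
    exact ⟨hadj, hab, hac, hbc, k1.1, k1.2.2, k1.2.1⟩
  by_cases k2 : (onlyFirst (nbrTest 5 6) (nbrTest 4 5) (nbrTest 4 6)).Holds s
  · refine tri (p := 5) (q := 6) (o := 4) (by decide) (by decide) ?_
      (by simp only [shapeBody, Prog.run, if_neg k1, if_pos k2])
    simp only [onlyFirst, Guard.Holds, g1, g2, g3] at k2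
    exact ⟨fun u => (hadj u).trans or_rotate, hbc, hab.symm, hac.symm, k2.1, mt .symm k2.2.1,
      mt .symm k2.2.2⟩
  by_cases k3 : (onlyFirst (nbrTest 4 6) (nbrTest 4 5) (nbrTest 5 6)).Holds s
  · refine tri (p := 4) (q := 6) (o := 5) (by decide) (by decide) ?_
      (by simp only [shapeBody, Prog.run, if_neg k1, if_neg k2, if_pos k3])
    simp only [onlyFirst, Guard.Holds, g1, g2, g3] at k3
    exact ⟨fun u => (hadj u).trans (or_congr_right or_comm), hac, hab, hbc.symm, k3.1, k3.2.1,
      mt .symm k3.2.2⟩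
  have e : shapeBody.run s = s.putN 10 v 1 := by
    simp only [shapeBody, Prog.run, if_neg k1, if_neg k2, if_neg k3, NExp.eval, ← hv']
  rw [e]
  refine ⟨.inr ⟨by simp [Mem.putN_narr], ?_⟩, fun u hu => ?_⟩
  · simp only [onlyFirst, Guard.Holds, g1, g2, g3] at k1 k2 k3
    exact mid_of_pairs hadj hab hac hbc (claw ha hb hc hab hac hbc) k1 k2 k3
  · simp [Mem.putN_narr, hu]

theorem shape_reaches {s : Mem} {src dst : ℕ → ℕ} (hn : s.nvar 0 = n)
    (hL : Listing H n m src dst) (hN : Nbrs H n (s.narr 4) (s.narr 5) (s.narr 6))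
    (h0 : ∀ v, s.narr 10 v = 0) :
    Reaches (forLoop 0 shapeBody) (forCost shapeBody 1) n s fun s' =>
      Local H n (s'.narr 7) (s'.narr 8) (s'.narr 9) ∧ ∀ v < n, (s'.narr 10 v = 0 ∧
        Tri H (s'.narr 7) (s'.narr 8) (s'.narr 9) v) ∨ (s'.narr 10 v = 1 ∧ Mid H v) := by
  refine (Reaches.forLoop (by simp [shapeBody, setTri, Prog.Straight]) (by decide) (by decide)
    (by decide) (fun i s' => (∀ v < i, (s'.narr 10 v = 0 ∧
        Tri H (s'.narr 7) (s'.narr 8) (s'.narr 9) v) ∨ (s'.narr 10 v = 1 ∧ Mid H v)) ∧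
      ∀ v, i ≤ v → s'.narr 10 v = 0) (by rw [hn, one_mul]) ?_ ?_).mono ?_
  · rintro s' e1 - -
    exact ⟨by simp, fun v _ => by rw [e1, h0]⟩
  · rintro i s' hi h2 hF ⟨h3, h4⟩
    have e4 : s'.narr 4 = s.narr 4 := hF.narr 4 (by decide)
    have e5 : s'.narr 5 = s.narr 5 := hF.narr 5 (by decide)
    have e6 : s'.narr 6 = s.narr 6 := hF.narr 6 (by decide)
    subst h2
    obtain ⟨r1, r2⟩ := shapeBody_run (s := s') (by rw [e4, e5, e6]; exact hN) hL.lt hL.claw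
      (hn ▸ hi) (h4 _ le_rfl)
    rw [Mem.setN_narr]
    constructor
    · intro v hv
      rcases Nat.lt_succ_iff_lt_or_eq.1 hv with h | rfl
      · obtain ⟨q1, q2, q3, q4⟩ := r2 v (by omega)
        rw [q4]
        exact (h3 v h).imp_left fun hT => ⟨hT.1, hT.2.congr q1 q2 q3⟩
      · exact r1
    · intro v hv
      rw [(r2 v (by omega)).2.2.2, h4 v (by omega)]
  · rintro s' ⟨h1, -⟩
    rw [hn] at h1
    exact ⟨⟨hL.lt, fun v hv => (h1 v hv).imp And.right And.right⟩, h1⟩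

end Passes

end EdgeDom

namespace EdgeDom

/-! ### Linking unknown vertices, choosing colours, testing components, writing the output -/

section Selection

variable {H : SimpleGraph ℕ} {n m : ℕ}

/-- The arrays 11, 12, 13 are adjacency lists of the unknown graph. A missing link is stored as the
vertex itself, which `Link` ignores. -/
def linkBody : Prog :=
  .seq (.ite (.eqN (.get 10 (.var 2)) (.const 0)) (.nput 11 (.var 2) (.get 9 (.var 2)))
      (.nput 11 (.var 2) (.var 2)))
    (.seq (.ite (.and (.eqN (.get 10 (.var 2)) (.const 0))
        (.eqN (.get 10 (.get 7 (.var 2))) (.const 0)))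
        (.nput 12 (.var 2) (.get 7 (.var 2))) (.nput 12 (.var 2) (.var 2)))
      (.ite (.and (.eqN (.get 10 (.var 2)) (.const 0))
        (.eqN (.get 10 (.get 8 (.var 2))) (.const 0)))
        (.nput 13 (.var 2) (.get 8 (.var 2))) (.nput 13 (.var 2) (.var 2))))

theorem linkBody_run (s : Mem) (v : ℕ) :
    (linkBody.run s).narr 11 v = (if v = s.nvar 2 then
      (if s.narr 10 v = 0 then s.narr 9 v else v) else s.narr 11 v) ∧
    (linkBody.run s).narr 12 v = (if v = s.nvar 2 then
      (if s.narr 10 v = 0 ∧ s.narr 10 (s.narr 7 v) = 0 then s.narr 7 v else v)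
        else s.narr 12 v) ∧
    (linkBody.run s).narr 13 v = (if v = s.nvar 2 then
      (if s.narr 10 v = 0 ∧ s.narr 10 (s.narr 8 v) = 0 then s.narr 8 v else v)
        else s.narr 13 v) := by
  set i := s.nvar 2 with hi
  by_cases h1 : s.narr 10 i = 0 <;> by_cases h2 : s.narr 10 (s.narr 7 i) = 0 <;>
    by_cases h3 : s.narr 10 (s.narr 8 i) = 0 <;> by_cases hv : v = i <;>
    simp [linkBody, Prog.run, NExp.eval, Guard.Holds, Mem.putN_nvar, Mem.putN_narr, ← hi, h1,
      h2, h3, hv]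

theorem link_reaches {s : Mem} (hn : s.nvar 0 = n) :
    Reaches (forLoop 0 linkBody) (forCost linkBody 1) n s fun s' => ∀ v < n,
      s'.narr 11 v = (if s.narr 10 v = 0 then s.narr 9 v else v) ∧
      s'.narr 12 v = (if s.narr 10 v = 0 ∧ s.narr 10 (s.narr 7 v) = 0 then s.narr 7 v else v) ∧
      s'.narr 13 v = (if s.narr 10 v = 0 ∧ s.narr 10 (s.narr 8 v) = 0 then s.narr 8 v else v) := by
  have key := Reaches.forLoop (A := linkBody) (x := 0) (k := 1) (N := n) (s := s)
    (by simp [linkBody, Prog.Straight]) (by decide) (by decide)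
    (by decide) (fun i s' => ∀ v < i,
      s'.narr 11 v = (if s.narr 10 v = 0 then s.narr 9 v else v) ∧
      s'.narr 12 v = (if s.narr 10 v = 0 ∧ s.narr 10 (s.narr 7 v) = 0 then s.narr 7 v else v) ∧
      s'.narr 13 v = (if s.narr 10 v = 0 ∧ s.narr 10 (s.narr 8 v) = 0 then s.narr 8 v else v))
    (by rw [hn, one_mul]) (by simp) ?_
  · rwa [hn] at key
  intro i s' hi h2 hF h v hv
  have e7 : s'.narr 7 = s.narr 7 := hF.narr 7 (by decide)
  have e8 : s'.narr 8 = s.narr 8 := hF.narr 8 (by decide)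
  have e9 : s'.narr 9 = s.narr 9 := hF.narr 9 (by decide)
  have e10 : s'.narr 10 = s.narr 10 := hF.narr 10 (by decide)
  obtain ⟨r1, r2, r3⟩ := linkBody_run s' v
  rw [Mem.setN_narr, r1, r2, r3, e7, e8, e9, e10, h2]
  rcases Nat.lt_succ_iff_lt_or_eq.1 hv with h1 | rfl
  · rw [if_neg h1.ne, if_neg h1.ne, if_neg h1.ne]
    exact h v h1
  · simp

theorem Link.congr {d1 d2 d3 d1' d2' d3' : ℕ → ℕ}
    (h : ∀ v < n, d1 v = d1' v ∧ d2 v = d2' v ∧ d3 v = d3' v) :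
    Link n d1 d2 d3 = Link n d1' d2' d3' := by
  funext v u
  refine propext (and_congr_right fun hv => ?_)
  rw [(h v hv).1, (h v hv).2.1, (h v hv).2.2]

theorem Labelled.congr {d1 d2 d3 d1' d2' d3' lab col : ℕ → ℕ} (hl : Labelled n d1 d2 d3 lab col)
    (h : ∀ v < n, d1 v = d1' v ∧ d2 v = d2' v ∧ d3 v = d3' v) :
    Labelled n d1' d2' d3' lab col := by
  refine ⟨fun v hv => ?_, ?_⟩
  · rw [← (h v hv).1, ← (h v hv).2.1, ← (h v hv).2.2]
    exact hl.same v hv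
  · rw [← Link.congr h]
    exact hl.walk

/-- The arrays 14 and 15 hold the labels and colours of the first search; the real array 2 is
indexed by label. -/
def diffBody : Prog :=
  .ite (.eqN (.get 10 (.var 2)) (.const 0))
    (.ite (.eqN (.get 15 (.var 2)) (.const 0))
      (.rput 2 (.get 14 (.var 2)) (.add (.get 2 (.get 14 (.var 2))) (.get 1 (.var 2))))
      (.rput 2 (.get 14 (.var 2)) (.sub (.get 2 (.get 14 (.var 2))) (.get 1 (.var 2)))))
    .skip

theorem diffBody_run (s : Mem) (k : ℕ) : (diffBody.run s).rarr 2 k = s.rarr 2 k +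
    if s.narr 14 (s.nvar 2) = k then (if s.narr 10 (s.nvar 2) = 0 then
      (if s.narr 15 (s.nvar 2) = 0 then s.rarr 1 (s.nvar 2) else - s.rarr 1 (s.nvar 2))
        else 0) else 0 := by
  by_cases h1 : s.narr 10 (s.nvar 2) = 0 <;> by_cases h2 : s.narr 15 (s.nvar 2) = 0 <;>
    by_cases h3 : s.narr 14 (s.nvar 2) = k <;>
    simp [diffBody, Prog.run, NExp.eval, RExp.eval, Guard.Holds, Mem.putR_rarr, h1, h2, h3,
      eq_comm (a := k), sub_eq_add_neg]

theorem diff_reaches {s : Mem} (hn : s.nvar 0 = n) (h0 : ∀ k, s.rarr 2 k = 0) :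
    Reaches (forLoop 0 diffBody) (forCost diffBody 1) n s fun s' => ∀ k,
      s'.rarr 2 k = diff n (s.rarr 1) (s.narr 10) (s.narr 14) (s.narr 15) k := by
  have key := Reaches.forLoop (A := diffBody) (x := 0) (k := 1) (N := n) (s := s)
    (by simp [diffBody, Prog.Straight]) (by decide) (by decide)
    (by decide) (fun i s' => ∀ k,
      s'.rarr 2 k = diff i (s.rarr 1) (s.narr 10) (s.narr 14) (s.narr 15) k)
    (by rw [hn, one_mul]) ?_ ?_
  · rwa [hn] at key
  · rintro s' - e - k
    rw [e, h0]
    simp [diff]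
  intro i s' hi h2 hF h k
  have e10 : s'.narr 10 = s.narr 10 := hF.narr 10 (by decide)
  have e14 : s'.narr 14 = s.narr 14 := hF.narr 14 (by decide)
  have e15 : s'.narr 15 = s.narr 15 := hF.narr 15 (by decide)
  have e1 : s'.rarr 1 = s.rarr 1 := hF.rarr 1 (by decide)
  rw [Mem.setN_rarr, diffBody_run, h k, e10, e14, e15, e1, h2, diff, diff, Finset.sum_range_succ]

/-- Whether the vertex in variable `2` is chosen. -/
def chosenTest : Guard :=
  (Guard.eqN (.get 10 (.var 2)) (.const 2)).or (.and (.eqN (.get 10 (.var 2)) (.const 0))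
    ((Guard.and (.eqN (.get 15 (.var 2)) (.const 0))
      (.not (.ltR (.get 2 (.get 14 (.var 2))) .zero))).or
      (.and (.not (.eqN (.get 15 (.var 2)) (.const 0))) (.ltR (.get 2 (.get 14 (.var 2))) .zero))))

def chosenBody : Prog :=
  .ite chosenTest (.nput 20 (.var 2) (.const 1)) (.nput 20 (.var 2) (.const 0))

theorem chosenTest_holds (s : Mem) : chosenTest.Holds s ↔
    Chosen (s.narr 10) (s.narr 14) (s.narr 15) (fun k => 0 ≤ s.rarr 2 k) (s.nvar 2) := by
  simp only [chosenTest, Guard.holds_or, Guard.Holds, NExp.eval, RExp.eval, Chosen, not_lt]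
  by_cases h1 : s.narr 15 (s.nvar 2) = 0 <;>
    by_cases h2 : 0 ≤ s.rarr 2 (s.narr 14 (s.nvar 2)) <;>
    simp [h1, h2, not_lt.2, lt_of_not_ge]

theorem chosen_reaches {s : Mem} (hn : s.nvar 0 = n) :
    Reaches (forLoop 0 chosenBody) (forCost chosenBody 1) n s fun s' => ∀ v < n,
      s'.narr 20 v = 1 ↔
        Chosen (s.narr 10) (s.narr 14) (s.narr 15) (fun k => 0 ≤ s.rarr 2 k) v := by
  have key := Reaches.forLoop (A := chosenBody) (x := 0) (k := 1) (N := n) (s := s)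
    (by simp [chosenBody, Prog.Straight]) (by decide) (by decide)
    (by decide) (fun i s' => ∀ v < i, s'.narr 20 v = 1 ↔
        Chosen (s.narr 10) (s.narr 14) (s.narr 15) (fun k => 0 ≤ s.rarr 2 k) v)
    (by rw [hn, one_mul]) (by simp) ?_
  · rwa [hn] at key
  intro i s' hi h2 hF h v hv
  have e10 : s'.narr 10 = s.narr 10 := hF.narr 10 (by decide)
  have e14 : s'.narr 14 = s.narr 14 := hF.narr 14 (by decide)
  have e15 : s'.narr 15 = s.narr 15 := hF.narr 15 (by decide)
  have e2 : s'.rarr 2 = s.rarr 2 := hF.rarr 2 (by decide)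
  have ht := chosenTest_holds s'
  rw [e10, e14, e15, e2, h2] at ht
  rw [Mem.setN_narr]
  rcases Nat.lt_succ_iff_lt_or_eq.1 hv with h1 | rfl
  · rw [← h v h1]
    by_cases hc : chosenTest.Holds s' <;>
      simp [chosenBody, Prog.run, NExp.eval, hc, Mem.putN_narr, h2, h1.ne]
  · rw [← ht]
    by_cases hc : chosenTest.Holds s' <;>
      simp [chosenBody, Prog.run, NExp.eval, hc, Mem.putN_narr, h2]

/-- Whether the vertex `e` is chosen. -/
def whiteTest (e : NExp) : Guard := .eqN (.get 20 e) (.const 1)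

/-- Whether the chosen vertices are valid at the vertex in variable `2`. -/
def validTest : Guard :=
  let t := whiteTest (.var 2)
  let a := whiteTest (.get 4 (.var 2))
  let b := whiteTest (.get 5 (.var 2))
  let c := whiteTest (.get 6 (.var 2))
  (Guard.and t (.and (.not a) (.and (.not b) (.not c)))).or (.and (.not t)
    ((Guard.and (.not a) (.and b c)).or ((Guard.and a (.and (.not b) c)).or
      (.and a (.and b (.not c))))))

theorem validTest_holds {s : Mem} (h : Nbrs H n (s.narr 4) (s.narr 5) (s.narr 6))
    (hv : s.nvar 2 < n) :
    validTest.Holds s ↔ Valid H (fun v => s.narr 20 v = 1) (s.nvar 2) := by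
  rw [valid_iff_of_nbrs (h.adj _ hv) (h.ne_ab _ hv) (h.ne_ac _ hv) (h.ne_bc _ hv)]
  simp only [validTest, whiteTest, Guard.holds_or, Guard.Holds, NExp.eval]

/-- The array 17 holds component labels. Array 21 flags components with an invalid vertex, and the
real array 3 sums the weighted degrees of their chosen vertices. -/
def statBody : Prog :=
  .seq (.ite validTest .skip (.nput 21 (.get 17 (.var 2)) (.const 1)))
    (.ite (whiteTest (.var 2))
      (.rput 3 (.get 17 (.var 2)) (.add (.get 3 (.get 17 (.var 2))) (.get 1 (.var 2)))) .skip)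

open Classical in
theorem statBody_run (s : Mem) (k : ℕ) :
    ((statBody.run s).narr 21 k =
      if k = s.narr 17 (s.nvar 2) ∧ ¬ validTest.Holds s then 1 else s.narr 21 k) ∧
    ((statBody.run s).rarr 3 k = s.rarr 3 k +
      if s.narr 17 (s.nvar 2) = k ∧ s.narr 20 (s.nvar 2) = 1 then s.rarr 1 (s.nvar 2) else 0) := by
  by_cases h1 : validTest.Holds s <;> by_cases h2 : s.narr 20 (s.nvar 2) = 1 <;>
    by_cases h3 : s.narr 17 (s.nvar 2) = k <;>
    simp [statBody, whiteTest, Prog.run, NExp.eval, RExp.eval, Guard.Holds, Mem.putR_rarr,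
      Mem.putR_narr, Mem.putN_rarr, Mem.putN_narr, Mem.putN_nvar, h1, h2, h3, eq_comm (a := k)]

theorem stat_reaches {s : Mem} (hn : s.nvar 0 = n)
    (hN : Nbrs H n (s.narr 4) (s.narr 5) (s.narr 6)) (h0 : ∀ k, s.narr 21 k = 0)
    (h0' : ∀ k, s.rarr 3 k = 0) :
    Reaches (forLoop 0 statBody) (forCost statBody 1) n s fun s' => ∀ k,
      (s'.narr 21 k = 0 ↔ ∀ v < n, s.narr 17 v = k → Valid H (fun v => s.narr 20 v = 1) v) ∧
      s'.rarr 3 k = total n (s.rarr 1) (fun v => s.narr 17 v = k) (fun v => s.narr 20 v = 1) := by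
  have key := Reaches.forLoop (A := statBody) (x := 0) (k := 1) (N := n) (s := s)
    (by simp [statBody, Prog.Straight]) (by decide) (by decide)
    (by decide) (fun i s' => ∀ k,
      (s'.narr 21 k = 0 ↔ ∀ v < i, s.narr 17 v = k → Valid H (fun v => s.narr 20 v = 1) v) ∧
      s'.rarr 3 k = total i (s.rarr 1) (fun v => s.narr 17 v = k) (fun v => s.narr 20 v = 1))
    (by rw [hn, one_mul]) ?_ ?_
  · rwa [hn] at key
  · rintro s' e e' - k
    rw [e, e', h0, h0']
    simp [total]
  intro i s' hi h2 hF h k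
  have e4 : s'.narr 4 = s.narr 4 := hF.narr 4 (by decide)
  have e5 : s'.narr 5 = s.narr 5 := hF.narr 5 (by decide)
  have e6 : s'.narr 6 = s.narr 6 := hF.narr 6 (by decide)
  have e17 : s'.narr 17 = s.narr 17 := hF.narr 17 (by decide)
  have e20 : s'.narr 20 = s.narr 20 := hF.narr 20 (by decide)
  have e1 : s'.rarr 1 = s.rarr 1 := hF.rarr 1 (by decide)
  obtain ⟨h3, h4⟩ := h k
  obtain ⟨r1, r2⟩ := statBody_run s' k
  have ht := validTest_holds (s := s') (by rw [e4, e5, e6]; exact hN) (by rw [h2, ← hn]; exact hi)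
  rw [e20, h2] at ht
  rw [ht, e17, h2] at r1
  rw [Mem.setN_rarr, Mem.setN_narr, r2, h4, e17, e20, e1, h2]
  refine ⟨?_, by rw [total, total, Finset.sum_range_succ]; congr⟩
  rw [r1]
  simp only [Nat.lt_succ_iff_lt_or_eq, or_imp, forall_and, forall_eq]
  rw [← h3]
  split_ifs with hc
  · simp [hc.1, hc.2]
  · constructor
    · intro hz
      refine ⟨hz, fun hk => ?_⟩
      by_contra hv
      exact hc ⟨hk.symm, hv⟩
    · exact fun hz => hz.1

/-- Whether the edge with the number in variable `2` is left out. -/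
def dropTest : Guard :=
  .and (.and (.eqN (.get 21 (.get 17 (.get 0 (.var 2)))) (.const 0))
    (.not (.ltR (.get 3 (.get 17 (.get 0 (.var 2)))) .zero)))
    ((whiteTest (.get 0 (.var 2))).or (whiteTest (.get 1 (.var 2))))

def outBody : Prog := .ite dropTest (.nput 2 (.var 2) (.const 0)) (.nput 2 (.var 2) (.const 1))

theorem out_reaches {s : Mem} (hm : s.nvar 1 = m) (hmn : m ≤ 2 * n) :
    Reaches (forLoop 1 outBody) (forCost outBody 2) n s fun s' => ∀ j < m, s'.narr 2 j = 1 ↔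
      ¬ ((s.narr 21 (s.narr 17 (s.narr 0 j)) = 0 ∧ 0 ≤ s.rarr 3 (s.narr 17 (s.narr 0 j))) ∧
        (s.narr 20 (s.narr 0 j) = 1 ∨ s.narr 20 (s.narr 1 j) = 1)) := by
  have key := Reaches.forLoop (A := outBody) (x := 1) (k := 2) (N := n) (s := s)
    (by simp [outBody, Prog.Straight]) (by decide) (by decide)
    (by decide) (fun i s' => ∀ j < i, s'.narr 2 j = 1 ↔
      ¬ ((s.narr 21 (s.narr 17 (s.narr 0 j)) = 0 ∧ 0 ≤ s.rarr 3 (s.narr 17 (s.narr 0 j))) ∧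
        (s.narr 20 (s.narr 0 j) = 1 ∨ s.narr 20 (s.narr 1 j) = 1)))
    (by rw [hm]; exact hmn) (by simp) ?_
  · rwa [hm] at key
  intro i s' hi h2 hF h j hj
  have e0 : s'.narr 0 = s.narr 0 := hF.narr 0 (by decide)
  have e1 : s'.narr 1 = s.narr 1 := hF.narr 1 (by decide)
  have e17 : s'.narr 17 = s.narr 17 := hF.narr 17 (by decide)
  have e20 : s'.narr 20 = s.narr 20 := hF.narr 20 (by decide)
  have e21 : s'.narr 21 = s.narr 21 := hF.narr 21 (by decide)
  have e3 : s'.rarr 3 = s.rarr 3 := hF.rarr 3 (by decide)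
  have ht : dropTest.Holds s' ↔
      ((s.narr 21 (s.narr 17 (s.narr 0 i)) = 0 ∧ 0 ≤ s.rarr 3 (s.narr 17 (s.narr 0 i))) ∧
        (s.narr 20 (s.narr 0 i) = 1 ∨ s.narr 20 (s.narr 1 i) = 1)) := by
    simp only [dropTest, whiteTest, Guard.holds_or, Guard.Holds, NExp.eval, RExp.eval, not_lt, h2,
      e0, e1, e17, e20, e21, e3]
  rw [Mem.setN_narr]
  rcases Nat.lt_succ_iff_lt_or_eq.1 hj with h1 | rfl
  · rw [← h j h1]
    by_cases hc : dropTest.Holds s' <;>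
      simp [outBody, Prog.run, NExp.eval, hc, Mem.putN_narr, h2, h1.ne]
  · rw [← ht]
    by_cases hc : dropTest.Holds s' <;>
      simp [outBody, Prog.run, NExp.eval, hc, Mem.putN_narr, h2]

end Selection

end EdgeDom

namespace EdgeDom

/-! ### Composition of the passes -/

section Correctness

variable {H : SimpleGraph ℕ} {n m : ℕ}

/-- The component with the label `k` is better served by the complement of the vertices in `F`
than by all its edges. -/
def Selected (H : SimpleGraph ℕ) (n : ℕ) (g : ℕ → ℝ) (comp : ℕ → ℕ) (F : ℕ → Prop) (k : ℕ) : Prop :=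
  (∀ v < n, comp v = k → Valid H F v) ∧ 0 ≤ total n g (fun v => comp v = k) F

theorem total_congr {g : ℕ → ℝ} {C F F' : ℕ → Prop} (h : ∀ v < n, C v → (F v ↔ F' v)) :
    total n g C F = total n g C F' := by
  refine Finset.sum_congr rfl fun v hv => ?_
  have : C v ∧ F v ↔ C v ∧ F' v := and_congr_right (h v (Finset.mem_range.1 hv))
  by_cases hF : C v ∧ F v
  · rw [if_pos hF, if_pos (this.1 hF)]
  · rw [if_neg hF, if_neg (mt this.2 hF)]

theorem selected_congr (hlt : ∀ {u v}, H.Adj u v → v < n) {g : ℕ → ℝ} {comp : ℕ → ℕ}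
    {F F' : ℕ → Prop} (h : ∀ v < n, (F v ↔ F' v)) (k : ℕ) :
    Selected H n g comp F k ↔ Selected H n g comp F' k := by
  rw [Selected, Selected, total_congr fun v hv _ => h v hv]
  refine and_congr_left fun _ => forall_congr' fun v => forall_congr' fun hv =>
    forall_congr' fun _ => valid_congr ?_
  rintro u (rfl | hu)
  exacts [h u hv, h u (hlt hu)]

/-- What the algorithm computes: the edges not marked in `out` are those of the selected
components that have an end among the chosen vertices. -/
structure Answer (H : SimpleGraph ℕ) (n m : ℕ) (src dst : ℕ → ℕ) (g : ℕ → ℝ)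
    (p q o x lab col a b c comp par out : ℕ → ℕ) : Prop where
  shape : Local H n p q o
  marks : Propagated H n p q o x
  flips : UnknownLabelled n p q o x lab col
  nbrs : Nbrs H n a b c
  comps : Labelled n a b c comp par
  out : ∀ j < m, out j = 1 ↔
    ¬ (Selected H n g comp (Chosen x lab col fun k => 0 ≤ diff n g x lab col k) (comp (src j)) ∧
      (Chosen x lab col (fun k => 0 ≤ diff n g x lab col k) (src j) ∨
        Chosen x lab col (fun k => 0 ≤ diff n g x lab col k) (dst j)))

/-- The linear-time algorithm. -/
def solver : Prog :=
  .seq (forLoop 1 adjBody) (.seq (forLoop 0 shapeBody) (.seq propLoop (.seq (forLoop 0 linkBody)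
    (.seq (search 11 12 13 14) (.seq (forLoop 0 diffBody) (.seq (forLoop 0 chosenBody)
      (.seq (search 4 5 6 17) (.seq (forLoop 0 statBody) (forLoop 1 outBody)))))))))

/-- The constant in the running time of `solver`. -/
def solverCost : ℕ :=
  forCost adjBody 2 + (forCost shapeBody 1 + (propCost + (forCost linkBody 1 +
    (searchCost 11 12 13 14 + (forCost diffBody 1 + (forCost chosenBody 1 +
      (searchCost 4 5 6 17 + (forCost statBody 1 + forCost outBody 2))))))))

/-- The search needs undirected links: `o` is an involution, and unknown mates are mates of each
other. -/
theorem Propagated.link_symm {p q o x : ℕ → ℕ} (X : Propagated H n p q o x) (L : Local H n p q o)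
    {v u : ℕ} (h : Link n (fun v => if x v = 0 then o v else v)
      (fun v => if x v = 0 ∧ x (p v) = 0 then p v else v)
      (fun v => if x v = 0 ∧ x (q v) = 0 then q v else v) v u) :
    Link n (fun v => if x v = 0 then o v else v)
      (fun v => if x v = 0 ∧ x (p v) = 0 then p v else v)
      (fun v => if x v = 0 ∧ x (q v) = 0 then q v else v) u v := by
  obtain ⟨hv, hu, hne, h⟩ := h
  refine ⟨hu, hv, hne.symm, ?_⟩
  rcases h with h | h | h <;> simp only at h <;> split_ifs at h with hx
  · have hT := X.tri L hv hx
    subst h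
    left
    simp only [if_pos (X.outer L hv hx)]
    exact (hT.outer L).2.symm
  · exact absurd h hne
  · have hT := X.tri L hv hx.1
    subst h
    right
    rcases hT.mate_p L (X.tri L hu hx.2) with ⟨e, -⟩ | ⟨e, -⟩
    · left
      simp [e, hx]
    · right
      simp [e, hx]
  · exact absurd h hne
  · have hT := X.tri L hv hx.1
    subst h
    right
    rcases hT.mate_q L (X.tri L hu hx.2) with ⟨e, -⟩ | ⟨e, -⟩
    · left
      simp [e, hx]
    · right
      simp [e, hx]
  · exact absurd h hne

theorem Propagated.link_lt {p q o x : ℕ → ℕ} (X : Propagated H n p q o x) (L : Local H n p q o)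
    {v : ℕ} (hv : v < n) : (if x v = 0 then o v else v) < n ∧
      (if x v = 0 ∧ x (p v) = 0 then p v else v) < n ∧
      (if x v = 0 ∧ x (q v) = 0 then q v else v) < n := by
  refine ⟨?_, ?_, ?_⟩ <;> split_ifs with hx
  exacts [L.lt (X.tri L hv hx).adj_o, hv, L.lt (X.tri L hv hx.1).adj_p, hv,
    L.lt (X.tri L hv hx.1).adj_q, hv]

theorem Nbrs.link_symm {a b c : ℕ → ℕ} (hN : Nbrs H n a b c) {v u : ℕ} (h : Link n a b c v u) :
    Link n a b c u v :=
  ⟨h.2.1, h.1, h.2.2.1.symm,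
    (hN.adj u h.2.1 v).1 ((hN.adj v h.1 u).2 h.2.2.2).symm⟩

theorem solver_reaches {s : Mem} (hn : s.nvar 0 = n) (hm : s.nvar 1 = m) (hmn : m ≤ 2 * n)
    (hL : Listing H n m (s.narr 0) (s.narr 1)) (h0 : ∀ a, 2 ≤ a → ∀ j, s.narr a j = 0)
    (h0' : ∀ a, 1 ≤ a → ∀ j, s.rarr a j = 0) :
    Reaches solver solverCost n s fun s' => ∃ p q o x lab col a b c comp par,
      Answer H n m (s.narr 0) (s.narr 1) (wdeg m (s.narr 0) (s.narr 1) (s.rarr 0))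
        p q o x lab col a b c comp par (s'.narr 2) := by
  refine (adj_reaches hm hmn hL (h0' 1 le_rfl)).seq fun s1 F1 ⟨hN, hg⟩ => ?_
  have n1 : s1.nvar 0 = n := (F1.nvar 0 (by decide)).trans hn
  have m1 : s1.nvar 1 = m := (F1.nvar 1 (by decide)).trans hm
  refine (shape_reaches n1 hL hN fun v => by
    rw [F1.narr 10 (by decide), h0 10 (by decide)]).seq fun s2 F2 ⟨hLoc, hx0⟩ => ?_
  have n2 : s2.nvar 0 = n := (F2.nvar 0 (by decide)).trans n1
  have m2 : s2.nvar 1 = m := (F2.nvar 1 (by decide)).trans m1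
  refine (propLoop_reaches n2 hLoc hx0).seq fun s3 F3 hX => ?_
  have n3 : s3.nvar 0 = n := (F3.nvar 0 (by decide)).trans n2
  have m3 : s3.nvar 1 = m := (F3.nvar 1 (by decide)).trans m2
  rw [← F3.narr 7 (by decide), ← F3.narr 8 (by decide), ← F3.narr 9 (by decide)] at hX hLoc
  refine (link_reaches n3).seq fun s4 F4 hd => ?_
  have n4 : s4.nvar 0 = n := (F4.nvar 0 (by decide)).trans n3
  have m4 : s4.nvar 1 = m := (F4.nvar 1 (by decide)).trans m3
  have hd' : ∀ v < n, s4.narr 11 v = (if s3.narr 10 v = 0 then s3.narr 9 v else v) ∧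
    s4.narr 12 v = (if s3.narr 10 v = 0 ∧ s3.narr 10 (s3.narr 7 v) = 0 then s3.narr 7 v else v) ∧
    s4.narr 13 v =
      (if s3.narr 10 v = 0 ∧ s3.narr 10 (s3.narr 8 v) = 0 then s3.narr 8 v else v) := hd
  refine (search_reaches (e1 := 11) (e2 := 12) (e3 := 13) (k := 14) (by decide) n4
    (fun v u => ?_) (fun v hv => ?_) fun v _ => ?_).seq fun s5 F5 hlab => ?_
  · rw [Link.congr hd']
    exact hX.link_symm hLoc
  · rw [(hd v hv).1, (hd v hv).2.1, (hd v hv).2.2]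
    exact hX.link_lt hLoc hv
  · rw [F4.narr 14 (by decide), F3.narr 14 (by decide), F2.narr 14 (by decide),
      F1.narr 14 (by decide), h0 14 (by decide)]
  have n5 : s5.nvar 0 = n := (F5.nvar 0 (by decide)).trans n4
  have m5 : s5.nvar 1 = m := (F5.nvar 1 (by decide)).trans m4
  replace hlab := hlab.congr hd'
  refine (diff_reaches n5 fun k => ?_).seq fun s6 F6 hdiff => ?_
  · rw [F5.rarr 2 (by decide), F4.rarr 2 (by decide), F3.rarr 2 (by decide),
      F2.rarr 2 (by decide), F1.rarr 2 (by decide), h0' 2 (by decide)]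
  have n6 : s6.nvar 0 = n := (F6.nvar 0 (by decide)).trans n5
  have m6 : s6.nvar 1 = m := (F6.nvar 1 (by decide)).trans m5
  have x5 : s5.narr 10 = s3.narr 10 :=
    (F5.narr 10 (by decide)).trans (F4.narr 10 (by decide))
  have g5 : s5.rarr 1 = wdeg m (s.narr 0) (s.narr 1) (s.rarr 0) := by
    rw [F5.rarr 1 (by decide), F4.rarr 1 (by decide), F3.rarr 1 (by decide),
      F2.rarr 1 (by decide)]
    exact funext hg
  rw [x5, g5] at hdiff
  refine (chosen_reaches n6).seq fun s7 F7 hfin => ?_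
  have n7 : s7.nvar 0 = n := (F7.nvar 0 (by decide)).trans n6
  have m7 : s7.nvar 1 = m := (F7.nvar 1 (by decide)).trans m6
  rw [F6.narr 10 (by decide), F6.narr 14 (by decide), F6.narr 15 (by decide), x5] at hfin
  simp only [hdiff] at hfin
  -- Arrays outside this list, in particular the adjacency lists 4, 5, 6 and the still empty 17 and
  -- 21, survive from the first pass.
  have a7 : ∀ a, a ∉ [7, 8, 9, 10, 11, 12, 13, 14, 15, 16, 20] → s7.narr a = s1.narr a :=
    fun a ha => by
      rw [F7.narr a, F6.narr a, F5.narr a, F4.narr a, F3.narr a, F2.narr a]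
      all_goals
        simp only [List.mem_cons, List.not_mem_nil, or_false, not_or] at ha
        simp [forLoop, shapeBody, setTri, propLoop, propBody, propWhite, linkBody, search,
          searchBody, popStep, rootStep, visitAt, visit, diffBody, chosenBody, Prog.narrs, ha]
  rw [← a7 4 (by decide), ← a7 5 (by decide), ← a7 6 (by decide)] at hN
  have hadj : ∀ v < n, H.Adj v (s7.narr 4 v) ∧ H.Adj v (s7.narr 5 v) ∧ H.Adj v (s7.narr 6 v) :=
    fun v hv => ⟨(hN.adj v hv _).2 (by simp), (hN.adj v hv _).2 (by simp),
      (hN.adj v hv _).2 (by simp)⟩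
  refine (search_reaches (e1 := 4) (e2 := 5) (e3 := 6) (k := 17) (by decide) n7
    (fun v u => hN.link_symm) (fun v hv => ⟨hL.lt (hadj v hv).1, hL.lt (hadj v hv).2.1,
      hL.lt (hadj v hv).2.2⟩) fun v _ => ?_).seq fun s8 F8 hcomp => ?_
  · rw [a7 17 (by decide), F1.narr 17 (by decide), h0 17 (by decide)]
  have n8 : s8.nvar 0 = n := (F8.nvar 0 (by decide)).trans n7
  have m8 : s8.nvar 1 = m := (F8.nvar 1 (by decide)).trans m7
  refine (stat_reaches n8 (by
    rw [F8.narr 4 (by decide), F8.narr 5 (by decide), F8.narr 6 (by decide)]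
    exact hN) (fun k => ?_) fun k => ?_).seq fun s9 F9 hstat => ?_
  · rw [F8.narr 21 (by decide), a7 21 (by decide), F1.narr 21 (by decide), h0 21 (by decide)]
  · rw [F8.rarr 3 (by decide), F7.rarr 3 (by decide), F6.rarr 3 (by decide),
      F5.rarr 3 (by decide), F4.rarr 3 (by decide), F3.rarr 3 (by decide),
      F2.rarr 3 (by decide), F1.rarr 3 (by decide), h0' 3 (by decide)]
  have m9 : s9.nvar 1 = m := (F9.nvar 1 (by decide)).trans m8
  have g8 : s8.rarr 1 = wdeg m (s.narr 0) (s.narr 1) (s.rarr 0) := by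
    rw [F8.rarr 1 (by decide), F7.rarr 1 (by decide), F6.rarr 1 (by decide), g5]
  have hfin8 : ∀ v < n, s8.narr 20 v = 1 ↔ Chosen (s3.narr 10) (s5.narr 14) (s5.narr 15)
      (fun k => 0 ≤ diff n (wdeg m (s.narr 0) (s.narr 1) (s.rarr 0)) (s3.narr 10) (s5.narr 14)
        (s5.narr 15) k) v := by
    rw [F8.narr 20 (by decide)]
    exact hfin
  have hsel : ∀ k, (s9.narr 21 k = 0 ∧ 0 ≤ s9.rarr 3 k) ↔
      Selected H n (wdeg m (s.narr 0) (s.narr 1) (s.rarr 0)) (s8.narr 17)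
        (Chosen (s3.narr 10) (s5.narr 14) (s5.narr 15)
          (fun k => 0 ≤ diff n (wdeg m (s.narr 0) (s.narr 1) (s.rarr 0)) (s3.narr 10) (s5.narr 14)
            (s5.narr 15) k)) k := fun k => by
    rw [← selected_congr hL.lt hfin8, (hstat k).1, (hstat k).2, Selected, g8]
  refine (out_reaches m9 hmn).mono fun s10 hout => ?_
  have a9 : ∀ a, a < 2 → s9.narr a = s.narr a := fun a ha => by
    rw [F9.narr a, F8.narr a, a7 a, F1.narr a]
    all_goals
      simp [forLoop, statBody, adjBody, pushNbr, search,
        searchBody, popStep, rootStep, visitAt, visit, Prog.narrs]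
      try omega
  rw [a9 0 (by decide), a9 1 (by decide), F9.narr 17 (by decide), F9.narr 20 (by decide)] at hout
  refine ⟨_, _, _, _, _, _, _, _, _, _, _, hLoc, hX, hlab, hN, hcomp, fun j hj => ?_⟩
  rw [hout j hj, hsel, hfin8 _ (hL.lt (hL.edge j hj).symm), hfin8 _ (hL.lt (hL.edge j hj))]

end Correctness

end EdgeDom

namespace EdgeDom

/-! ### Passing between a PEDS and its white vertices -/

section White

variable {V : Type*} {G : SimpleGraph V} {P : Set (Sym2 V)}

/-- The vertex is not an end of an edge in `P`. -/
def White (P : Set (Sym2 V)) (v : V) : Prop := ∀ e ∈ P, v ∉ e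

/-- If both ends of a missing edge are covered, the covering edges coincide, so they are the missing
edge itself. -/
theorem IsPEDS.mem_iff_white (h : IsPEDS G P) {a b : V} (hab : G.Adj a b) :
    s(a, b) ∈ P ↔ ¬ White P a ∧ ¬ White P b := by
  constructor
  · exact fun hP => ⟨fun ha => ha _ hP (by simp), fun hb => hb _ hP (by simp)⟩
  · rintro ⟨ha, hb⟩
    by_contra hn
    simp only [White, not_forall, not_not] at ha hb
    obtain ⟨f, hf, haf⟩ := ha
    obtain ⟨g, hg, hbg⟩ := hb
    have e := h.eq_of_dominates hab hn hf hg (.inl haf) (.inr hbg)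
    subst e
    have : f = s(a, b) := (Sym2.mem_and_mem_iff hab.ne).1 ⟨haf, hbg⟩
    exact hn (this ▸ hf)

theorem IsPEDS.not_white_of_adj (h : IsPEDS G P) {a b : V} (hab : G.Adj a b) (ha : White P a) :
    ¬ White P b := by
  intro hb
  have hn : s(a, b) ∉ P := fun hP => ha _ hP (by simp)
  obtain ⟨f, hf, hf' | hf'⟩ := h.exists_dominates hab hn
  exacts [ha f hf hf', hb f hf hf']

theorem IsPEDS.existsUnique_of_not_black (h : IsPEDS G P) {v : V} (hv : ¬ White P v)
    (hb : ¬ Black G P v) : ∃! u, G.Adj v u ∧ ¬ White P u := by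
  simp only [White, Black, not_forall, not_not] at hv hb
  obtain ⟨f, hf, hvf⟩ := hv
  obtain ⟨x, hvx, hx⟩ := hb
  obtain ⟨u, rfl⟩ := Sym2.mem_iff_exists.1 hvf
  have hv : ¬ White P v := fun hw => hw _ hf (by simp)
  refine ⟨u, ⟨h.subset hf, fun hw => hw _ hf (by simp)⟩, ?_⟩
  rintro y ⟨hvy, hy⟩
  have hP := (h.mem_iff_white hvy).2 ⟨hv, hy⟩
  have e := h.eq_of_dominates hvx hx hP hf (.inl (by simp)) (.inl (by simp))
  exact Sym2.congr_right.1 e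

/-- A missing edge ab has an end in T, say a. No edge of P meets a, and the only one at b leads to
the unique neighbour of b outside T. -/
theorem isPEDS_of_white {T : V → Prop} (hsub : P ⊆ G.edgeSet)
    (hP : ∀ a b, G.Adj a b → (s(a, b) ∈ P ↔ ¬ T a ∧ ¬ T b))
    (hT : ∀ a b, G.Adj a b → T a → ¬ T b ∧ ∃! u, G.Adj b u ∧ ¬ T u) : IsPEDS G P := by
  have key : ∀ a b, G.Adj a b → T a → ∃! f, f ∈ P ∧ Dominates f s(a, b) := by
    intro a b hab ha
    obtain ⟨hb, u, ⟨hbu, hu⟩, huniq⟩ := hT a b hab ha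
    refine ⟨s(b, u), ⟨(hP b u hbu).2 ⟨hb, hu⟩, dominates_mk_iff.2 (.inr (by simp))⟩, ?_⟩
    rintro g ⟨hg, hdom⟩
    rcases dominates_mk_iff.1 hdom with h | h
    · obtain ⟨y, rfl⟩ := Sym2.mem_iff_exists.1 h
      exact absurd ha ((hP a y (hsub hg)).1 hg).1
    · obtain ⟨y, rfl⟩ := Sym2.mem_iff_exists.1 h
      rw [huniq y ⟨hsub hg, ((hP b y (hsub hg)).1 hg).2⟩]
  refine ⟨hsub, fun e => ?_⟩
  induction e with
  | _ a b =>
    intro hab hn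
    have hab : G.Adj a b := hab
    rw [hP a b hab, not_and_or, not_not, not_not] at hn
    rcases hn with h | h
    · exact key a b hab h
    · rw [Sym2.eq_swap]
      exact key b a hab.symm h

end White

/-! ### Natural numbers as vertices, and optimality in each component -/

section Natural

variable {n : ℕ} {G : SimpleGraph (Fin n)}

/-- The graph `G` with its vertices regarded as natural numbers. -/
def natGraph (G : SimpleGraph (Fin n)) : SimpleGraph ℕ := G.map Fin.valEmbedding

theorem natGraph_adj {u v : ℕ} :
    (natGraph G).Adj u v ↔ ∃ (hu : u < n) (hv : v < n), G.Adj ⟨u, hu⟩ ⟨v, hv⟩ := by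
  rw [natGraph, SimpleGraph.map_adj]
  constructor
  · rintro ⟨a, b, h, rfl, rfl⟩
    exact ⟨a.2, b.2, h⟩
  · rintro ⟨hu, hv, h⟩
    exact ⟨_, _, h, rfl, rfl⟩

theorem natGraph_adj_val {a b : Fin n} : (natGraph G).Adj a b ↔ G.Adj a b := by
  rw [natGraph_adj]
  exact ⟨fun ⟨_, _, h⟩ => h, fun h => ⟨a.2, b.2, h⟩⟩

/-- The vertices that are not ends of edges in `P`. -/
def whites (P : Set (Sym2 (Fin n))) (v : ℕ) : Prop := ∃ h : v < n, White P ⟨v, h⟩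

theorem whites_val {P : Set (Sym2 (Fin n))} {a : Fin n} : whites P a ↔ White P a :=
  ⟨fun ⟨_, h⟩ => h, fun h => ⟨a.2, h⟩⟩

theorem valid_val_iff {W : ℕ → Prop} {a : Fin n} : Valid (natGraph G) W a ↔
    (W a → ∀ b : Fin n, G.Adj a b → ¬ W b) ∧
      (¬ W a → ∃! b : Fin n, G.Adj a b ∧ ¬ W b) := by
  unfold Valid
  refine and_congr (imp_congr_right fun _ => ⟨fun h b hb => h b (natGraph_adj_val.2 hb), ?_⟩)
    (imp_congr_right fun _ => ⟨?_, ?_⟩)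
  · intro h u hu
    obtain ⟨_, hu', h'⟩ := natGraph_adj.1 hu
    exact h ⟨u, hu'⟩ h'
  · rintro ⟨u, ⟨h1, h2⟩, h3⟩
    obtain ⟨_, hu', h'⟩ := natGraph_adj.1 h1
    refine ⟨⟨u, hu'⟩, ⟨h', h2⟩, fun y hy => Fin.ext ?_⟩
    exact h3 y ⟨natGraph_adj_val.2 hy.1, hy.2⟩
  · rintro ⟨b, ⟨h1, h2⟩, h3⟩
    refine ⟨b, ⟨natGraph_adj_val.2 h1, h2⟩, ?_⟩
    rintro u ⟨hu, hW⟩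
    obtain ⟨_, hu', h'⟩ := natGraph_adj.1 hu
    exact congrArg Fin.val (h3 ⟨u, hu'⟩ ⟨h', hW⟩)

variable {a b c comp par : ℕ → ℕ}

theorem Labelled.reachable (hl : Labelled n a b c comp par) (hN : Nbrs (natGraph G) n a b c)
    {u v : Fin n} (h : comp u = comp v) : G.Reachable u v := by
  have key : ∀ (r : ℕ) (hr : r < n) (w k : ℕ), AltWalk (Link n a b c) r w k →
      ∃ hw : w < n, G.Reachable ⟨r, hr⟩ ⟨w, hw⟩ := by
    intro r hr w k hw
    induction hw with
    | refl => exact ⟨hr, .refl _⟩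
    | step _ hL ih =>
      obtain ⟨hw, ih⟩ := ih
      obtain ⟨h1, h2, h3⟩ := natGraph_adj.1 ((hN.adj _ hL.1 _).2 hL.2.2.2)
      exact ⟨h2, ih.trans h3.reachable⟩
  obtain ⟨r, hr, e, hw⟩ := hl.walk u u.2
  obtain ⟨r', hr', e', hw'⟩ := hl.walk v v.2
  obtain rfl : r = r' := by omega
  obtain ⟨_, h1⟩ := key r hr _ _ hw
  obtain ⟨_, h2⟩ := key r hr _ _ hw'
  exact h1.symm.trans h2

theorem Labelled.closed {H : SimpleGraph ℕ} (hl : Labelled n a b c comp par) (hN : Nbrs H n a b c)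
    (hlt : ∀ {u v}, H.Adj u v → v < n) (k : ℕ) : Closed H fun v => comp v = k := by
  intro u v huv hu
  have hs := hl.same u (hlt huv.symm)
  rcases (hN.adj u (hlt huv.symm) v).1 huv with rfl | rfl | rfl
  exacts [hs.1.trans hu, hs.2.1.trans hu, hs.2.2.trans hu]

/-- The dichotomy inside one component: equal labels mean reachability, so a single black vertex
makes the whole component black. -/
theorem IsPEDS.black_or_solves {P : Set (Sym2 (Fin n))} (h : IsPEDS G P)
    (ht : ∀ v, InTriangle G v) (hl : Labelled n a b c comp par)
    (hN : Nbrs (natGraph G) n a b c) (k : ℕ) :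
    (∀ v < n, comp v = k → ¬ whites P v) ∨
      Solves (natGraph G) n (fun v => comp v = k) (whites P) := by
  by_cases hb : ∃ v : Fin n, comp v = k ∧ Black G P v
  · obtain ⟨v, hv, hB⟩ := hb
    left
    rintro u hu hk ⟨_, hw⟩
    have hBu := h.black_of_reachable ht hB
      (hl.reachable hN (u := v) (v := ⟨u, hu⟩) (hv.trans hk.symm))
    -- A vertex without edges would be black and white at once; the triangle supplies an edge.
    obtain ⟨x, -, hx, -⟩ := ht ⟨u, hu⟩
    exact hw _ (hBu x hx) (by simp)
  · push Not at hb
    right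
    refine ⟨hl.closed hN (fun h => (natGraph_adj.1 h).2.1) k, fun v hv hk => ?_⟩
    have : Valid (natGraph G) (whites P) ((⟨v, hv⟩ : Fin n) : ℕ) := by
      have e (y : Fin n) : whites P y = White P y := propext whites_val
      rw [valid_val_iff, e]
      simp only [e]
      exact ⟨fun hw y hy => h.not_white_of_adj hy hw,
        fun hw => h.existsUnique_of_not_black hw (hb ⟨v, hv⟩ hk)⟩
    exact this

open Classical in
theorem total_eq_sum_fibers (g : ℕ → ℝ) (comp : ℕ → ℕ) (W : ℕ → Prop) :
    total n g (fun _ => True) W =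
      ∑ k ∈ (Finset.range n).image comp, total n g (fun v => comp v = k) W := by
  rw [total, ← Finset.sum_fiberwise_of_maps_to (t := (Finset.range n).image comp) (g := comp)
    (fun v hv => Finset.mem_image_of_mem _ hv)]
  refine Finset.sum_congr rfl fun k _ => ?_
  rw [total, Finset.sum_filter]
  refine Finset.sum_congr rfl fun v _ => ?_
  by_cases h1 : comp v = k <;> by_cases h2 : W v <;> simp [h1, h2]

/-- The vertices of `F` in selected components. -/
def Taken (H : SimpleGraph ℕ) (n : ℕ) (g : ℕ → ℝ) (comp : ℕ → ℕ) (F : ℕ → Prop) (v : ℕ) : Prop :=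
  Selected H n g comp F (comp v) ∧ F v

theorem total_taken (H : SimpleGraph ℕ) (g : ℕ → ℝ) (comp : ℕ → ℕ) (F : ℕ → Prop) (k : ℕ) :
    (Selected H n g comp F k ∧ total n g (fun v => comp v = k) (Taken H n g comp F) =
      total n g (fun v => comp v = k) F) ∨
    (¬ Selected H n g comp F k ∧ total n g (fun v => comp v = k) (Taken H n g comp F) = 0) := by
  by_cases hs : Selected H n g comp F k
  · refine .inl ⟨hs, total_congr fun v _ hk => ?_⟩
    rw [Taken, hk]
    simp [hs]
  · refine .inr ⟨hs, Finset.sum_eq_zero fun v _ => if_neg ?_⟩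
    rintro ⟨hk, ht, -⟩
    exact hs (hk ▸ ht)

/-- Component by component. If P takes all edges, its white sum is 0, and what is taken is never
negative. Otherwise a solution exists there, so the chosen set is valid and at least as heavy; it is
then rejected only for a negative sum, and 0 is better. -/
theorem IsPEDS.total_whites_le {P : Set (Sym2 (Fin n))} (h : IsPEDS G P)
    (ht : ∀ v, InTriangle G v) {m : ℕ} {src dst : ℕ → ℕ} {g : ℕ → ℝ}
    {p q o x lab col out : ℕ → ℕ}
    (A : Answer (natGraph G) n m src dst g p q o x lab col a b c comp par out) :
    total n g (fun _ => True) (whites P) ≤ total n g (fun _ => True)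
      (Taken (natGraph G) n g comp (Chosen x lab col fun k => 0 ≤ diff n g x lab col k)) := by
  set F := Chosen x lab col fun k => 0 ≤ diff n g x lab col k with hF
  rw [total_eq_sum_fibers g comp, total_eq_sum_fibers g comp]
  refine Finset.sum_le_sum fun k _ => ?_
  rcases h.black_or_solves ht A.comps A.nbrs k with hb | S
  · have h0 : total n g (fun v => comp v = k) (whites P) = 0 :=
      Finset.sum_eq_zero fun v hv => if_neg fun hw => hb v (Finset.mem_range.1 hv) hw.1 hw.2
    rw [h0]
    rcases total_taken (n := n) (natGraph G) g comp F k with ⟨hs, e⟩ | ⟨-, e⟩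
    · rw [e]
      exact hs.2
    · exact e.ge
  · have hle := S.total_le A.shape A.marks A.flips g
    have hv := (S.chosen A.shape A.marks A.flips fun k => 0 ≤ diff n g x lab col k).valid
    rcases total_taken (n := n) (natGraph G) g comp F k with ⟨hs, e⟩ | ⟨hs, e⟩
    · rw [e]
      exact hle
    · rw [e]
      refine hle.trans (le_of_lt ?_)
      by_contra hn
      exact hs ⟨hv, not_lt.1 hn⟩

end Natural

/-! ### From the input encoding to the optimal PEDS -/

section Output

variable {n : ℕ} {G : SimpleGraph (Fin n)}

theorem EdgeList.adj (L : EdgeList G) (j : Fin L.m) : G.Adj (L.src j) (L.dst j) := by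
  have : s(L.src j, L.dst j) ∈ G.edgeSet := L.range ▸ Set.mem_range_self j
  exact this

theorem EdgeList.exists_edge (L : EdgeList G) {e : Sym2 (Fin n)} (he : e ∈ G.edgeSet) :
    ∃ j, L.edge j = e := by
  rw [← L.range] at he
  exact he

theorem EdgeList.two_mul_m [DecidableRel G.Adj] (L : EdgeList G) (hr : G.IsRegularOfDegree 3) :
    2 * L.m = 3 * n := by
  have h1 := G.sum_degrees_eq_twice_card_edges
  have h2 : G.edgeFinset = Finset.univ.image L.edge := by
    rw [← Finset.coe_inj, SimpleGraph.coe_edgeFinset, Finset.coe_image, Finset.coe_univ,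
      Set.image_univ]
    exact L.range.symm
  rw [h2, Finset.card_image_of_injective _ (show Function.Injective L.edge from L.inj),
    Finset.card_univ, Fintype.card_fin, Finset.sum_congr rfl fun v _ => hr v] at h1
  simp at h1
  omega

theorem EdgeList.input_src (L : EdgeList G) (w : Sym2 (Fin n) → ℝ) (j : Fin L.m) :
    (L.input w).narr 0 j = L.src j := by
  simp [EdgeList.input]

theorem EdgeList.input_dst (L : EdgeList G) (w : Sym2 (Fin n) → ℝ) (j : Fin L.m) :
    (L.input w).narr 1 j = L.dst j := by
  simp [EdgeList.input]

theorem EdgeList.input_weight (L : EdgeList G) (w : Sym2 (Fin n) → ℝ) (j : Fin L.m) :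
    (L.input w).rarr 0 j = w (L.edge j) := by
  simp [EdgeList.input]

theorem EdgeList.listing [DecidableRel G.Adj] (L : EdgeList G) (w : Sym2 (Fin n) → ℝ)
    (hr : G.IsRegularOfDegree 3) (hc : ClawFree G) :
    Listing (natGraph G) n L.m ((L.input w).narr 0) ((L.input w).narr 1) where
  lt h := (natGraph_adj.1 h).2.1
  edge j hj := by
    have h1 := L.input_src w ⟨j, hj⟩
    have h2 := L.input_dst w ⟨j, hj⟩
    rw [h1, h2, natGraph_adj_val]
    exact L.adj _
  exists_joins := by
    intro u v huv
    obtain ⟨hu, hv, h⟩ := natGraph_adj.1 huv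
    obtain ⟨j, hj⟩ := L.exists_edge (e := s(⟨u, hu⟩, ⟨v, hv⟩)) h
    refine ⟨j, j.2, ?_⟩
    rw [Joins, L.input_src, L.input_dst]
    rcases Sym2.eq_iff.1 hj with ⟨h1, h2⟩ | ⟨h1, h2⟩ <;> simp [h1, h2]
  inj := by
    intro j k u v hj hk h1 h2
    have e1 := L.input_src w ⟨j, hj⟩
    have e2 := L.input_dst w ⟨j, hj⟩
    have e3 := L.input_src w ⟨k, hk⟩
    have e4 := L.input_dst w ⟨k, hk⟩
    simp only at e1 e2 e3 e4
    rw [Joins, e1, e2] at h1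
    rw [Joins, e3, e4] at h2
    have : s(L.src ⟨j, hj⟩, L.dst ⟨j, hj⟩) = s(L.src ⟨k, hk⟩, L.dst ⟨k, hk⟩) := by
      rw [Sym2.eq_iff]
      simp only [Fin.ext_iff]
      omega
    simpa using L.inj this
  cubic v hv := by
    obtain ⟨a, b, c, hab, hac, hbc, hN⟩ := Finset.card_eq_three.1 (hr ⟨v, hv⟩)
    refine ⟨a, b, c, fun u => ?_, Fin.val_ne_of_ne hab, Fin.val_ne_of_ne hac,
      Fin.val_ne_of_ne hbc⟩
    have hm : ∀ y, G.Adj ⟨v, hv⟩ y ↔ y = a ∨ y = b ∨ y = c := fun y => by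
      rw [← G.mem_neighborFinset, hN]; simp
    constructor
    · intro h
      obtain ⟨_, hu, h'⟩ := natGraph_adj.1 h
      simpa [Fin.ext_iff] using (hm _).1 h'
    · intro h
      have hu : u < n := by
        rcases h with rfl | rfl | rfl
        exacts [a.2, b.2, c.2]
      exact natGraph_adj.2 ⟨hv, hu, (hm _).2 (by simpa [Fin.ext_iff] using h)⟩
  claw := by
    intro v a b c h1 h2 h3 hab hac hbc
    obtain ⟨hv, ha, h1⟩ := natGraph_adj.1 h1
    obtain ⟨_, hb, h2⟩ := natGraph_adj.1 h2
    obtain ⟨_, hc', h3⟩ := natGraph_adj.1 h3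
    have := exists_pair_of_clawFree hc h1 h2 h3 (by simpa using hab) (by simpa using hac)
      (by simpa using hbc)
    simpa only [natGraph_adj, ha, hb, hc', exists_true_left] using this

open Classical in
-- Each edge outside P has exactly one end in W by independence, so summing weighted degrees over W
-- counts each missing edge once.
theorem EdgeList.weight_eq (L : EdgeList G) (w : Sym2 (Fin n) → ℝ) {P : Finset (Sym2 (Fin n))}
    (hP : (P : Set (Sym2 (Fin n))) ⊆ G.edgeSet) {W : ℕ → Prop}
    (hW : ∀ j, L.edge j ∈ P ↔ ¬ W (L.src j) ∧ ¬ W (L.dst j))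
    (hind : ∀ j, W (L.src j) → ¬ W (L.dst j)) :
    weight w P = ∑ j, w (L.edge j) - total n
      (wdeg L.m ((L.input w).narr 0) ((L.input w).narr 1) ((L.input w).rarr 0))
      (fun _ => True) W := by
  have h1 : P = (Finset.univ.filter fun j => L.edge j ∈ P).image L.edge := by
    ext e
    simp only [Finset.mem_image, Finset.mem_filter, Finset.mem_univ, true_and]
    constructor
    · intro he
      obtain ⟨j, rfl⟩ := L.exists_edge (hP he)
      exact ⟨j, he, rfl⟩
    · rintro ⟨j, hj, rfl⟩
      exact hj
  have h2 : weight w P = ∑ j, if L.edge j ∈ P then w (L.edge j) else 0 := by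
    have hinj : Function.Injective L.edge := L.inj
    exact (congrArg (weight w) h1).trans
      ((Finset.sum_image hinj.injOn).trans (Finset.sum_filter _ _))
  have h3 : total n (wdeg L.m ((L.input w).narr 0) ((L.input w).narr 1) ((L.input w).rarr 0))
      (fun _ => True) W = ∑ j, ((if W (L.src j) then w (L.edge j) else 0) +
        if W (L.dst j) then w (L.edge j) else 0) := by
    have h4 : ∀ v, (if True ∧ W v then
        wdeg L.m ((L.input w).narr 0) ((L.input w).narr 1) ((L.input w).rarr 0) v else 0) =
        ∑ j : Fin L.m, ((if v = L.src j then (if W v then w (L.edge j) else 0) else 0) +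
          if v = L.dst j then (if W v then w (L.edge j) else 0) else 0) := by
      intro v
      rw [wdeg, Finset.sum_range]
      simp only [L.input_src, L.input_dst, L.input_weight, true_and]
      by_cases hv : W v
      · simp only [if_pos hv]
        refine Finset.sum_congr rfl fun j _ => ?_
        have hne : (L.src j : ℕ) ≠ L.dst j := Fin.val_ne_of_ne (L.adj j).ne
        by_cases h5 : v = L.src j
        · have h6 : v ≠ L.dst j := h5 ▸ hne
          simp [h5, hne]
        · by_cases h6 : v = L.dst j
          · simp [h6, hne, hne.symm]
          · simp [h5, h6, Ne.symm h5, Ne.symm h6]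
      · simp [hv]
    refine (Finset.sum_congr rfl fun v _ => Eq.trans ?_ (h4 v)).trans ?_
    · by_cases hv : W v <;> simp [hv]
    rw [Finset.sum_comm]
    refine Finset.sum_congr rfl fun j _ => ?_
    rw [Finset.sum_add_distrib, Finset.sum_ite_eq', Finset.sum_ite_eq']
    simp
  rw [h2, h3, ← Finset.sum_sub_distrib]
  refine Finset.sum_congr rfl fun j _ => ?_
  have h5 := hW j
  have h6 := hind j
  by_cases h7 : W (L.src j) <;> by_cases h8 : W (L.dst j)
  · exact absurd h8 (h6 h7)
  all_goals simp [h5, h7, h8]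

variable {p q o x lab col a b c comp par : ℕ → ℕ}

/-- Both the output and any competitor weigh the total of all edges minus the white sum, so
minimality is the comparison of white sums. -/
theorem EdgeList.isMinPEDS_output (L : EdgeList G) (w : Sym2 (Fin n) → ℝ)
    (ht : ∀ v, InTriangle G v) {s : Mem}
    (A : Answer (natGraph G) n L.m ((L.input w).narr 0) ((L.input w).narr 1)
      (wdeg L.m ((L.input w).narr 0) ((L.input w).narr 1) ((L.input w).rarr 0))
      p q o x lab col a b c comp par (s.narr 2)) : IsMinPEDS G w (L.output s) := by
  set g := wdeg L.m ((L.input w).narr 0) ((L.input w).narr 1) ((L.input w).rarr 0) with hg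
  set F := Chosen x lab col fun k => 0 ≤ diff n g x lab col k with hF
  set T := Taken (natGraph G) n g comp F with hT
  have hcomp : ∀ u v : Fin n, G.Adj u v → comp v = comp u := fun u v huv =>
    A.comps.closed A.nbrs (fun h => (natGraph_adj.1 h).2.1) (comp u) (natGraph_adj_val.2 huv) rfl
  have hmem : ∀ j, L.edge j ∈ L.output s ↔ ¬ T (L.src j) ∧ ¬ T (L.dst j) := by
    intro j
    have h1 : L.edge j ∈ L.output s ↔ s.narr 2 j = 1 := by
      simp only [EdgeList.output, Finset.mem_image, Finset.mem_filter, Finset.mem_univ, true_and]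
      exact ⟨fun ⟨k, hk, e⟩ => L.inj e ▸ hk, fun h => ⟨j, h, rfl⟩⟩
    rw [h1, A.out j j.2, L.input_src, L.input_dst, hT, Taken, Taken, hcomp _ _ (L.adj j)]
    tauto
  have hsub : ((L.output s : Finset (Sym2 (Fin n))) : Set (Sym2 (Fin n))) ⊆ G.edgeSet := by
    intro e he
    obtain ⟨j, -, rfl⟩ := Finset.mem_image.1 (Finset.mem_coe.1 he)
    exact L.adj j
  have hvalid : ∀ u v : Fin n, G.Adj u v → T u → ¬ T v ∧ ∃! y : Fin n, G.Adj v y ∧ ¬ T y := by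
    rintro u v huv ⟨hs, hFu⟩
    have hu := valid_val_iff.1 (hs.1 u u.2 rfl)
    have hv := valid_val_iff.1 (hs.1 v v.2 (hcomp u v huv))
    have hFv := hu.1 hFu v huv
    refine ⟨fun h => hFv h.2, ?_⟩
    -- Selection is constant on a component, so near a taken vertex `T` and `F` coincide.
    have e : ∀ y : Fin n, G.Adj v y ∧ ¬ T y ↔ G.Adj v y ∧ ¬ F y := fun y =>
      and_congr_right fun hy => by
        rw [hT, Taken, hcomp v y hy, hcomp u v huv]
        simp [hs]
    simp only [e]
    exact hv.2 hFv
  have hP : IsPEDS G (L.output s : Set (Sym2 (Fin n))) := by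
    refine isPEDS_of_white (T := fun v => T v) hsub (fun u v huv => ?_) hvalid
    obtain ⟨j, hj⟩ := L.exists_edge (e := s(u, v)) huv
    rw [Finset.mem_coe, ← hj, hmem j]
    rcases Sym2.eq_iff.1 hj with ⟨rfl, rfl⟩ | ⟨rfl, rfl⟩
    exacts [Iff.rfl, and_comm]
  refine ⟨hP, fun Q hQ => ?_⟩
  have hw1 := L.weight_eq w hsub (W := T) hmem fun j h => (hvalid _ _ (L.adj j) h).1
  have hw2 := L.weight_eq w hQ.subset (W := whites (Q : Set (Sym2 (Fin n)))) (fun j => by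
    rw [whites_val, whites_val, ← Finset.mem_coe]
    exact hQ.mem_iff_white (L.adj j)) fun j => by
      rw [whites_val, whites_val]
      exact hQ.not_white_of_adj (L.adj j)
  rw [hw1, hw2]
  exact sub_le_sub_left (hQ.total_whites_le ht A) _

theorem exists_linear_time_algorithm : ∃ (A : Prog) (c : ℕ), ∀ (n : ℕ) (G : SimpleGraph (Fin n))
    [DecidableRel G.Adj], G.IsRegularOfDegree 3 → ClawFree G →
      ∀ (w : Sym2 (Fin n) → ℝ) (L : EdgeList G), ∃ (t : ℕ) (s : Mem),
        Exec A (L.input w) t s ∧ t ≤ c * n + c ∧ IsMinPEDS G w (L.output s) := by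
  refine ⟨solver, solverCost, fun n G _ hr hc w L => ?_⟩
  have hm := L.two_mul_m hr
  obtain ⟨t, s, hE, ht, p, q, o, x, lab, col, a, b, c, comp, par, hA⟩ :=
    solver_reaches (n := n) (m := L.m) (s := L.input w) rfl rfl (by omega) (L.listing w hr hc)
      (fun i hi j => by
        have h0 : i ≠ 0 := by omega
        have h1 : i ≠ 1 := by omega
        simp [EdgeList.input, h0, h1])
      (fun i hi j => by
        have h0 : i ≠ 0 := by omega
        simp [EdgeList.input, h0])
  exact ⟨t, s, hE, by rwa [mul_add, mul_one] at ht,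
    L.isMinPEDS_output w (inTriangle_of_clawFree hr hc) hA⟩

end Output

end EdgeDom

theorem mainTheorem11 :
    -- a connected graph in which every vertex lies in a triangle has no proper PEDS
    (∀ (V : Type*) (G : SimpleGraph V), G.Connected → (∀ v, EdgeDom.InTriangle G v) →
      ¬ ∃ P : Set (Sym2 V), EdgeDom.IsProperPEDS G P) ∧
    -- weighted PEDS in connected cubic claw-free graphs
    (∀ (V : Type*) [Fintype V] [DecidableEq V] (G : SimpleGraph V) [DecidableRel G.Adj],
      G.Connected → G.IsRegularOfDegree 3 → EdgeDom.ClawFree G → ∀ w : Sym2 V → ℝ,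
      (∃ P, EdgeDom.IsMinPEDS G w P) ∧
      (∀ P, EdgeDom.IsMinPEDS G w P → P = G.edgeFinset ∨ EdgeDom.IsMinEEDS G w P) ∧
      (∀ D, EdgeDom.IsMinEEDS G w D →
        (EdgeDom.weight w D ≤ EdgeDom.weight w G.edgeFinset → EdgeDom.IsMinPEDS G w D) ∧
        (EdgeDom.weight w G.edgeFinset ≤ EdgeDom.weight w D →
          EdgeDom.IsMinPEDS G w G.edgeFinset)) ∧
      ((¬ ∃ D : Finset (Sym2 V), EdgeDom.IsEEDS G D) →
        ∀ P : Finset (Sym2 V), EdgeDom.IsPEDS G P ↔ P = G.edgeFinset)) ∧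
    -- a linear-time algorithm on all cubic claw-free graphs
    (∃ (A : EdgeDom.Prog) (c : ℕ), ∀ (n : ℕ) (G : SimpleGraph (Fin n)) [DecidableRel G.Adj],
      G.IsRegularOfDegree 3 → EdgeDom.ClawFree G →
      ∀ (w : Sym2 (Fin n) → ℝ) (L : EdgeDom.EdgeList G),
        ∃ (t : ℕ) (s : EdgeDom.Mem), EdgeDom.Exec A (L.input w) t s ∧ t ≤ c * n + c ∧
          EdgeDom.IsMinPEDS G w (L.output s)) := by
  exact ⟨fun V G hG ht => EdgeDom.not_exists_isProperPEDS hG ht,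
    fun V _ _ G _ hG hr hc w => EdgeDom.weighted_connected w hG hr hc,
    EdgeDom.exists_linear_time_algorithm⟩
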